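/- Setup. Let $m\ge 3$ and let $\{1,\dots,n\}$ be divided into consecutive nonempty intervals, the colors $C^{(1)},\dots,C^{(m)}$. Let $\mathbf k=(k_1,\dots,k_n)$ be nonnegative integers with $\sum_i k_i=n-3$ such that within each color the positive exponents stand on an initial segment and are weakly increasing there. Write $k_S=\sum_{i\in S}k_i$. A number $i$ is boxed if $k_i>0$; the smallest number in each of the first three colors is crossed out. A set is monochromatic if its elements have the same color. Decorations. A decoration $D$ consists of a set partition of the boxed numbers into monochromatic blocks (called hues), an assignment of a hue to every number that is not crossed out, and a set of underlined numbers, such that: for each hue $B$, all elements of $B$ except $\min B$ have hue $B$ and are underlined, $\min B$ is not underlined, and exactly $k_B$ numbers in total have hue $B$; and every underlined unboxed number has a hue of its own color. Let $u(D)$ be the number of underlined numbers and $(-1)^{u(D)}$ the sign of $D$. Let $\mathcal D(\mathbf k)$ be the set of decorations, and $\mathcal{MD}(\mathbf k)$ the set of mismatched ones, in which no unboxed number has a hue of its own color. A sign-reversing involution is an involution that changes the sign of every element it does not fix. The map $\underline\varphi$ on $\mathcal D(\mathbf k)$ toggles the underline of the smallest unboxed number that has a hue of its own color; if there is none, it does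 nothing. Chains. Let $D\in\mathcal{MD}(\mathbf k)$, let $C$ be a color, and let $I$ be the set of boxed numbers of color $C$ that are neither crossed out nor underlined and have a hue of color $C$. The number chain decomposition lists $I$ as follows. Open a chain with $i_1=\min I$. If $i_1,\dots,i_s$ are listed, $I$ is not exhausted, and $b$ is the minimum of the hue of $i_s$, then: if $b\in I\setminus\{i_1,\dots,i_s\}$, the current chain continues with $i_{s+1}=b$; otherwise it is closed and a new chain is opened with $i_{s+1}=\min(I\setminus\{i_1,\dots,i_s\})$. The order of this list is the number chain order. The hue chain decomposition is the corresponding sequence of the hues of $i_1,i_2,\dots$, with the same division into chains. The permission list of a set $S$ of numbers whose hues have color $C$ lists first the elements of $S$ of color $C$ in number chain order, then the others in ascending order. Permission. A singleton hue $\{t\}$ has permission to merge with a hue $B_t$ of the same color $C$, where $r=\min B_t$, if $t<r$; the number $r$ has hue $\{t\}$; $r$ is the first number of hue $\{t\}$ in number chain order; and in the permission list of the set of all non-underlined numbers of hue $\{t\}$ or $B_t$, other than $r$ and other than the number immediately preceding $r$ in its chain (if any), all numbers of hue $B_t$ precede all numbers of hue $\{t\}$. The map $\varphi^{\mathrm{hue}}$.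 For $D\in\mathcal{MD}(\mathbf k)$ let $a$ (if it exists) be the smallest minimum of a non-singleton hue, $B$ the hue with minimum $a$, and $t$ (if it exists) the smallest number such that $\{t\}$ has permission to merge with some hue $B_t$. - Split: if $a$ exists and either $t$ does not exist or $a<t$, replace $B$ by $\{a\}$ and $B'=B\setminus\{a\}$. Let $r=\min B'$. If a number chain of $D$ that starts with a number less than $r$ contains a number of hue $B$, let $q$ be the first number of hue $B$ in number chain order. Give $r$ the hue $\{a\}$ and remove its underline; give the other elements of $B'$, and $q$ if it exists, the hue $B'$; among the remaining numbers of hue $B$, in the order of their permission list in $D$, give hue $B'$ to the first ones until $k_{B'}$ numbers have hue $B'$, and hue $\{a\}$ to the rest. - Merge: if $t$ exists and either $a$ does not exist or $t<a$, replace $\{t\}$ and $B_t$ by $\{t\}\cup B_t$, give this hue to all numbers of hue $\{t\}$ or $B_t$, and underline $\min B_t$. - If neither $a$ nor $t$ exists, do nothing. A fixed point decoration is a mismatched decoration all of whose hues are singletons and in which no hue has permission to merge with a hue. Let $$A(\mathbf k)=\sum_{\mathcal P}(-1)^{\sum_{B\in\mathcal P}(|B|-1)}\binom{\ell(\mathcal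 P)-3}{\,k_{B}-|B|+1 \;:\; B\in\mathcal P\,},$$ where $\mathcal P$ runs over the set partitions of $\{1,\dots,n\}$ into monochromatic blocks, $\ell(\mathcal P)$ is the number of blocks, and the multinomial coefficient is $0$ if some $k_B-|B|+1$ is negative. Theorem. 1. $A(\mathbf k)=\sum_{D\in\mathcal D(\mathbf k)}(-1)^{u(D)}$. 2. $\underline\varphi$ is a sign-reversing involution on $\mathcal D(\mathbf k)$ whose fixed points are exactly the elements of $\mathcal{MD}(\mathbf k)$, and $A(\mathbf k)=\sum_{D\in\mathcal{MD}(\mathbf k)}(-1)^{u(D)}$. 3. In a mismatched decoration, $\{t\}$ has permission to merge with at most one hue, and $\varphi^{\mathrm{hue}}$ is a well-defined sign-reversing involution on $\mathcal{MD}(\mathbf k)$. 4. The fixed points of $\varphi^{\mathrm{hue}}$ are exactly the fixed point decorations; they have no underlined numbers, and all have sign $+1$. 5. $A(\mathbf k)$ equals the number of fixed point decorations. -/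

import Mathlib

/-- The combinatorial data of a product of `ψ` classes on a multicolored space with `n` marked
points and `m ≥ 3` colors. The marked points are the elements of `Fin n`; the color classes are
consecutive nonempty intervals (of sizes `r₁, …, r_m`), encoded by a monotone surjective color
function; `k i` is the exponent at the point `i`. Within each color the positive exponents stand on
an initial segment and are weakly increasing there, and the exponents add up to `n - 3`. -/
structure ColoredExponents (n m : ℕ) where
  color : Fin n → Fin m
  k : Fin n → ℕ
  three_le : 3 ≤ m
  color_monotone : Monotone color
  color_surjective : Function.Surjective color
  sum_k : (∑ i, k i) + 3 = n
  k_sorted : ∀ i j, i < j → color i = color j → 0 < k j → 0 < k i ∧ k i ≤ k j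

/-- A way of marking the numbers in `Fin n`: a finite set of hues (each hue `C_B` is represented by
its block `B`), the hue of every number, and the set of underlined numbers. A number without hue
gets the value `∅`, which is never a block. -/
structure Marking (n : ℕ) where
  hues : Finset (Finset (Fin n))
  hue : Fin n → Finset (Fin n)
  under : Finset (Fin n)

namespace Marking

/-- A marking is a triple. -/
def equivProd (n : ℕ) :
    Marking n ≃ Finset (Finset (Fin n)) × (Fin n → Finset (Fin n)) × Finset (Fin n) where
  toFun D := (D.hues, D.hue, D.under)
  invFun x := ⟨x.1, x.2.1, x.2.2⟩
  left_inv _ := rfl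
  right_inv _ := rfl

instance (n : ℕ) : DecidableEq (Marking n) := (equivProd n).decidableEq

instance (n : ℕ) : Fintype (Marking n) := Fintype.ofEquiv _ (equivProd n).symm

/-- The sign `(-1)^{u(D)}`, where `u(D)` is the number of underlined numbers. -/
def sign {n : ℕ} (D : Marking n) : ℤ := (-1) ^ D.under.card

end Marking

/-- `φ` restricts to a sign-reversing involution of the finite set `X` with sign `ε`. -/
def IsSignReversingInvolution {α : Type*} (X : Finset α) (ε : α → ℤ) (φ : α → α) : Prop :=
  (∀ x ∈ X, φ x ∈ X) ∧ (∀ x ∈ X, φ (φ x) = x) ∧ (∀ x ∈ X, φ x ≠ x → ε (φ x) = -ε x)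

/-- The chains of the number chain decomposition that remain to be written when the number `cur` has
just been written and `R` is the set of numbers not yet listed. The first chain of the output is the
rest, beginning with `cur`, of the current chain. If `b`, the minimum of the hue of `cur`, belongs to
`R`, the chain continues with `b`; otherwise it is closed and a new one is opened at `min R`. -/
def chainsFrom {n : ℕ} (hue : Fin n → Finset (Fin n)) (cur : Fin n) (R : Finset (Fin n)) :
    List (List (Fin n)) :=
  if h : ∃ hB : (hue cur).Nonempty, (hue cur).min' hB ∈ R then
    (chainsFrom hue ((hue cur).min' h.1) (R.erase ((hue cur).min' h.1))).modifyHead (cur :: ·)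
  else if hR : R.Nonempty then
    [cur] :: chainsFrom hue (R.min' hR) (R.erase (R.min' hR))
  else [[cur]]
termination_by R.card
decreasing_by
  · exact Finset.card_erase_lt_of_mem h.2
  · exact Finset.card_erase_lt_of_mem (R.min'_mem hR)

namespace ColoredExponents

variable {n m : ℕ} (P : ColoredExponents n m)

/-- `k_S`, the sum of the exponents over `S`. -/
def kSum (S : Finset (Fin n)) : ℕ := ∑ i ∈ S, P.k i

/-- The boxed numbers are those with positive exponent. -/
def boxed : Finset (Fin n) := Finset.univ.filter fun i => 0 < P.k i

/-- The crossed out numbers: the smallest number in each of the first three colors. -/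
def crossed : Finset (Fin n) :=
  Finset.univ.filter fun i => (P.color i : ℕ) < 3 ∧ ∀ j, P.color j = P.color i → i ≤ j

/-- All elements of `B` have the same color. -/
def Monochromatic (B : Finset (Fin n)) : Prop := ∀ i ∈ B, ∀ j ∈ B, P.color i = P.color j

instance (B : Finset (Fin n)) : Decidable (P.Monochromatic B) := by
  unfold Monochromatic; infer_instance

/-- The number `i` has a hue, and that hue matches the color of `i`. -/
def HueMatches (D : Marking n) (i : Fin n) : Prop := ∃ b ∈ D.hue i, P.color b = P.color i

instance (D : Marking n) (i : Fin n) : Decidable (P.HueMatches D i) := by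
  unfold HueMatches; infer_instance

/-- The decorations with parameters `k`. -/
structure IsDecoration (D : Marking n) : Prop where
  /-- The hues form a partition of the boxed numbers, with monochromatic blocks. -/
  hues_nonempty : ∀ B ∈ D.hues, B.Nonempty
  hues_disjoint : ∀ B ∈ D.hues, ∀ B' ∈ D.hues, B ≠ B' → Disjoint B B'
  hues_union : D.hues.biUnion id = P.boxed
  hues_monochromatic : ∀ B ∈ D.hues, P.Monochromatic B
  /-- Exactly the numbers that are not crossed out have a hue. -/
  hue_crossed : ∀ i ∈ P.crossed, D.hue i = ∅
  hue_mem : ∀ i, i ∉ P.crossed → D.hue i ∈ D.hues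
  /-- All numbers of a block `B` but the smallest one have hue `B`. -/
  hue_block : ∀ B ∈ D.hues, ∀ i ∈ B, (∃ j ∈ B, j < i) → D.hue i = B
  /-- In total, `k_B` numbers have hue `B`. -/
  hue_card : ∀ B ∈ D.hues, (Finset.univ.filter fun i => D.hue i = B).card = P.kSum B
  /-- The underlined boxed numbers are the non-minimal elements of the blocks. -/
  under_boxed : ∀ i ∈ P.boxed, i ∈ D.under ↔ ∃ B ∈ D.hues, i ∈ B ∧ ∃ j ∈ B, j < i
  /-- The underlined unboxed numbers are arbitrary among those whose hue matches their color. -/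
  under_unboxed : ∀ i ∉ P.boxed, i ∈ D.under → P.HueMatches D i

open Classical in
/-- The set `𝒟(k)` of all decorations. -/
noncomputable def decorations : Finset (Marking n) := Finset.univ.filter P.IsDecoration

/-- The decoration is mismatched: no unboxed number has a hue that matches its color. -/
def IsMismatched (D : Marking n) : Prop := ∀ i ∉ P.boxed, ¬ P.HueMatches D i

open Classical in
/-- The set `ℳ𝒟(k)` of all mismatched decorations. -/
noncomputable def mismatchedDecorations : Finset (Marking n) := P.decorations.filter P.IsMismatched

/-! ### The first involution -/

/-- The unboxed numbers whose hue matches their color. -/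
def matchedUnboxed (D : Marking n) : Finset (Fin n) :=
  Finset.univ.filter fun i => i ∉ P.boxed ∧ P.HueMatches D i

/-- Toggle the underline of the smallest unboxed number whose hue matches its color, if any. -/
def phiUnder (D : Marking n) : Marking n :=
  if h : (P.matchedUnboxed D).Nonempty then
    { D with under := symmDiff D.under {(P.matchedUnboxed D).min' h} }
  else D

/-! ### Chains and permission -/

/-- The set `I` for the color `c`: boxed numbers of color `c` that are not crossed out, not
underlined, and whose hue matches their color. -/
def chainSet (D : Marking n) (c : Fin m) : Finset (Fin n) :=
  Finset.univ.filter fun i =>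
    i ∈ P.boxed ∧ P.color i = c ∧ i ∉ P.crossed ∧ i ∉ D.under ∧ P.HueMatches D i

/-- The number chain decomposition in the color `c`, as the list of its chains. -/
def numberChains (D : Marking n) (c : Fin m) : List (List (Fin n)) :=
  if h : (P.chainSet D c).Nonempty then
    chainsFrom D.hue ((P.chainSet D c).min' h) ((P.chainSet D c).erase ((P.chainSet D c).min' h))
  else []

/-- The number chain order in the color `c`: the decomposition without its parentheses. -/
def chainOrder (D : Marking n) (c : Fin m) : List (Fin n) := (P.numberChains D c).flatten

/-- The permission list of a set `S` of numbers whose hues have color `c`: first the elements of `S`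
of color `c` in number chain order, then the other elements of `S` in ascending order. -/
def permissionList (D : Marking n) (c : Fin m) (S : Finset (Fin n)) : List (Fin n) :=
  (P.chainOrder D c).filter (fun i => i ∈ S) ++ (S.filter fun i => P.color i ≠ c).sort (· ≤ ·)

/-- The singleton hue `{t}` wants to merge with the hue `B` of the same color, where `r = min B`. -/
def WantsToMerge (D : Marking n) (t : Fin n) (B : Finset (Fin n)) (r : Fin n) : Prop :=
  {t} ∈ D.hues ∧ B ∈ D.hues ∧ B.min = (r : WithTop (Fin n)) ∧ P.color r = P.color t ∧ t < r ∧
    D.hue r = {t}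

instance (D : Marking n) (t : Fin n) (B : Finset (Fin n)) (r : Fin n) :
    Decidable (P.WantsToMerge D t B r) := by
  unfold WantsToMerge; infer_instance

/-- The number `q` immediately precedes `r` in one of the number chains of the color `c`. -/
def PrecedesInChain (D : Marking n) (c : Fin m) (q r : Fin n) : Prop :=
  ∃ l ∈ P.numberChains D c, [q, r] <:+: l

instance (D : Marking n) (c : Fin m) (q r : Fin n) : Decidable (P.PrecedesInChain D c q r) := by
  unfold PrecedesInChain; infer_instance

/-- The set `S` in the second condition for permission: the non-underlined numbers with hue `{t}` or
`B`, other than `r` and other than the number preceding `r` in its chain (if any). -/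
def permissionSet (D : Marking n) (t : Fin n) (B : Finset (Fin n)) (r : Fin n) :
    Finset (Fin n) :=
  Finset.univ.filter fun x =>
    x ∉ D.under ∧ (D.hue x = {t} ∨ D.hue x = B) ∧ x ≠ r ∧ ¬ P.PrecedesInChain D (P.color t) x r

/-- The singleton hue `{t}` has permission to merge with `B`: it wants to; `r = min B` is the first
number of hue `{t}` in number chain order; and in the permission list of the set `S` above, no
number of hue `{t}` comes before a number of hue `B`. -/
def HasPermission (D : Marking n) (t : Fin n) (B : Finset (Fin n)) : Prop :=
  ∃ r, P.WantsToMerge D t B r ∧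
    (P.chainOrder D (P.color t)).find? (fun i => D.hue i = {t}) = some r ∧
    (P.permissionList D (P.color t) (P.permissionSet D t B r)).Pairwise
      (fun x y => ¬ (D.hue x = {t} ∧ D.hue y = B))

instance (D : Marking n) (t : Fin n) (B : Finset (Fin n)) :
    Decidable (P.HasPermission D t B) := by
  unfold HasPermission; infer_instance

/-! ### The second involution -/

/-- The minima of the non-singleton hues. -/
def splitCandidates (D : Marking n) : Finset (Fin n) :=
  Finset.univ.filter fun i => ∃ B ∈ D.hues, 1 < B.card ∧ B.min = (i : WithTop (Fin n))

/-- The numbers `t` such that `{t}` has permission to merge with some hue. -/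
def mergeCandidates (D : Marking n) : Finset (Fin n) :=
  Finset.univ.filter fun t => ∃ B ∈ D.hues, P.HasPermission D t B

/-- The unique non-singleton hue with minimum `a` (written as the union of all of them). -/
def splitBlock (D : Marking n) (a : Fin n) : Finset (Fin n) :=
  (D.hues.filter fun B => 1 < B.card ∧ B.min = (a : WithTop (Fin n))).sup id

/-- The unique hue with which `{t}` has permission to merge (written as the union of all of them). -/
def mergeBlock (D : Marking n) (t : Fin n) : Finset (Fin n) :=
  (D.hues.filter fun B => P.HasPermission D t B).sup id

/-- The number `q` of the split procedure for the block `B` with `B' = B \ {min B}` in the color `c`: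
if some chain that starts with a number less than `r = min B'` contains a number of hue `B`, then
`q` is the first number of hue `B` in number chain order. -/
def splitQ (D : Marking n) (c : Fin m) (B B' : Finset (Fin n)) : Option (Fin n) :=
  if ∃ l ∈ P.numberChains D c,
      (∃ i ∈ l.head?, (i : WithTop (Fin n)) < B'.min) ∧ ∃ x ∈ l, D.hue x = B then
    (P.chainOrder D c).find? (fun i => D.hue i = B)
  else none

/-- The hues after the first three steps of splitting `B` into `{a}` and `B'`: the number `min B'`
gets hue `{a}`; the other numbers in `B'` and the number `q` (if it exists) get hue `B'`. -/
def splitHueAux (D : Marking n) (a : Fin n) (B B' : Finset (Fin n)) (x : Fin n) :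
    Finset (Fin n) :=
  if B'.min = (x : WithTop (Fin n)) then {a}
  else if x ∈ B' then B'
  else if P.splitQ D (P.color a) B B' = some x then B'
  else D.hue x

/-- The numbers of hue `B` that become `B'` in the fourth step: an initial piece of the permission
list of the numbers that still have hue `B`, such that the number of all numbers of hue `B'` becomes
`k_{B'}`. -/
def splitInitial (D : Marking n) (a : Fin n) (B B' : Finset (Fin n)) : List (Fin n) :=
  (P.permissionList D (P.color a)
      (Finset.univ.filter fun x => P.splitHueAux D a B B' x = B)).take
    (P.kSum B' - (Finset.univ.filter fun x => P.splitHueAux D a B B' x = B').card)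

/-- Split `B` into `{a}` and `B'`; the underline of `min B'` is removed. -/
def splitInto (D : Marking n) (a : Fin n) (B B' : Finset (Fin n)) : Marking n where
  hues := insert {a} (insert B' (D.hues.erase B))
  hue x :=
    if P.splitHueAux D a B B' x = B then
      if x ∈ P.splitInitial D a B B' then B' else {a}
    else P.splitHueAux D a B B' x
  under := D.under.filter fun x => B'.min ≠ (x : WithTop (Fin n))

/-- Split the non-singleton hue with minimum `a`. -/
def splitAt (D : Marking n) (a : Fin n) : Marking n :=
  P.splitInto D a (splitBlock D a) ((splitBlock D a).erase a)

/-- Merge the hues `{t}` and `B` into one hue, and underline `min B`. -/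
def mergeWith (D : Marking n) (t : Fin n) (B : Finset (Fin n)) : Marking n where
  hues := insert (insert t B) ((D.hues.erase {t}).erase B)
  hue x := if D.hue x = {t} ∨ D.hue x = B then insert t B else D.hue x
  under := D.under ∪ B.filter fun x => B.min = (x : WithTop (Fin n))

/-- The map `φ^hue`. The minimum of a `Finset` is `⊤` when it is empty, so the first comparison says
that `m` exists, and `m < t` or `t` does not exist; similarly for the second one. -/
def phiHue (D : Marking n) : Marking n :=
  if h : (splitCandidates D).Nonempty ∧ (splitCandidates D).min < (P.mergeCandidates D).min then
    P.splitAt D ((splitCandidates D).min' h.1)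
  else if h : (P.mergeCandidates D).Nonempty ∧
      (P.mergeCandidates D).min < (splitCandidates D).min then
    mergeWith D ((P.mergeCandidates D).min' h.1)
      (P.mergeBlock D ((P.mergeCandidates D).min' h.1))
  else D

/-- A fixed point decoration is a mismatched decoration all of whose hues are singletons, none of
which has permission to merge with another. -/
def IsFixedPoint (D : Marking n) : Prop :=
  D ∈ P.mismatchedDecorations ∧ (∀ B ∈ D.hues, B.card = 1) ∧ ∀ t B, ¬ P.HasPermission D t B

open Classical in
/-- The set of all fixed point decorations. -/
noncomputable def fixedPointDecorations : Finset (Marking n) := Finset.univ.filter P.IsFixedPoint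

/-! ### The alternating sum -/

/-- The multinomial coefficient of `ℓ(𝒫) - 3` over the numbers `k_B - |B| + 1` for `B ∈ 𝒫`, and zero
if one of these is negative. (The numbers `k_B - |B| + 1` add up to `ℓ(𝒫) - 3`, because the
exponents add up to `n - 3`.) -/
def multinomialTerm (Q : Finpartition (Finset.univ : Finset (Fin n))) : ℕ :=
  if ∀ B ∈ Q.parts, B.card ≤ P.kSum B + 1 then
    Nat.multinomial Q.parts fun B => P.kSum B + 1 - B.card
  else 0

/-- The alternating multinomial sum over all set partitions with monochromatic blocks. -/
def alternatingSum : ℤ :=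
  ∑ Q : Finpartition (Finset.univ : Finset (Fin n)) with ∀ B ∈ Q.parts, P.Monochromatic B,
    (-1) ^ (∑ B ∈ Q.parts, (B.card - 1)) * (P.multinomialTerm Q : ℤ)

end ColoredExponents

/-! The alternating sum becomes a signed count of decorations, which is then cancelled twice.

Counting. Let $\mathcal P$ be a monochromatic partition with $|A|\le k_A+1$ for every part $A$. Each
non-minimal element of a part is underlined and gets the hue of its part. Crossed out numbers are
minima of their parts, so $\ell-3$ minima remain, and the multinomial coefficient counts the ways to
distribute them so that $A$ receives $k_A-|A|+1$ of them, hence $k_A$ numbers altogether. The sign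
of $\mathcal P$ counts the non-minima, that is, the underlines. A decoration records only the boxed
elements of a part. Nothing is lost: a part with at least two elements has $k_A>0$, so it contains a
boxed number, and its unboxed elements are non-minimal, hence underlined and of its hue
(`isDecoration_toMarking`, `toMarking_injective`, `IsDecoration.exists_toMarking_eq`). Toggling an
underline then removes all decorations that are not mismatched.

The second involution rests on the number chain order. It is a walk in which the target of a number
is the minimum of its hue, and a walk is determined by its targets and its set of members
(`IsWalk.eq_of_mem_iff`). Merging $\{t\}$ with $B$, where $r=\min B$ has hue $\{t\}$, underlines $r$
and redirects all targets $r$ to $t$, the target of $r$. Because $t<r$, the walk simply skips $r$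
(`IsWalk.filter_ne`, `WantsToMerge.chainOrder_mergeWith`). What has to be recovered is the
predecessor of $r$ in its chain, if any, and this is the number $q$ of the split
(`WantsToMerge.splitQ_mergeWith`). Permission says exactly that the remaining hues are distributed
as a split would do it. So a split undoes a permitted merge (`WantsToMerge.splitInto_mergeWith`),
every split creates the permission to merge back (`SplitData.hasPermission`), and merging back
restores the decoration (`SplitData.mergeWith_splitInto`).

It remains to see that the map returns to the same place, that is, that a merge at $t$ neither
creates nor destroys candidates $t'<t$ for merging (`WantsToMerge.hasPermission_of_mergeWith`,
`IsDecoration.hasPermission_mergeWith`). The delicate case has $\{t\}$, or $\{t\}\cup B$ after the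
merge, as the partner of $\{t'\}$; there $k_{t'}\le k_t$ is needed to ensure that some number other
than $r$ has hue $\{t\}$. Fixed points have singleton hues only, hence no underlines and sign $+1$.
-/

open scoped List

/-! ### Order in duplicate-free lists, and walks in a linear order -/

section Walk

variable {α : Type*} [LinearOrder α]

/-- Throughout, `[x, y] <+ L` expresses that `x` stands before `y` in `L`. On the members of a list
without duplicates this is a strict linear order, and it behaves well under appending and filtering.
-/
theorem List.pair_sublist_iff_append {β : Type*} {L : List β} {x y : β} :
    [x, y] <+ L ↔ ∃ A C, L = A ++ x :: C ∧ y ∈ C := by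
  constructor
  · intro h
    induction L with
    | nil => simp at h
    | cons z L ih =>
      rcases List.cons_sublist_cons'.1 h with h1 | ⟨rfl, h1⟩
      · obtain ⟨A, C, rfl, hy⟩ := ih h1
        exact ⟨z :: A, C, rfl, hy⟩
      · exact ⟨[], L, rfl, List.singleton_sublist.1 h1⟩
  · rintro ⟨A, C, rfl, hy⟩
    exact ((List.singleton_sublist.2 hy).cons_cons x).trans (List.sublist_append_right A _)

theorem List.pair_sublist_cons_iff {β : Type*} {L : List β} {x y z : β} :
    [x, y] <+ z :: L ↔ (x = z ∧ y ∈ L) ∨ [x, y] <+ L := by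
  rw [List.cons_sublist_cons', List.singleton_sublist, or_comm]

theorem List.pair_sublist_append_iff {β : Type*} {L M : List β} {x y : β} :
    [x, y] <+ L ++ M ↔ [x, y] <+ L ∨ (x ∈ L ∧ y ∈ M) ∨ [x, y] <+ M := by
  induction L with
  | nil => simp
  | cons z L ih =>
    rw [List.cons_append, List.pair_sublist_cons_iff, ih, List.pair_sublist_cons_iff]
    simp only [List.mem_append, List.mem_cons]
    tauto

theorem List.pair_sublist_filter_iff {β : Type*} {L : List β} {p : β → Bool} {x y : β} :
    [x, y] <+ L.filter p ↔ [x, y] <+ L ∧ p x ∧ p y := by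
  induction L with
  | nil => simp
  | cons z L ih =>
    rw [List.pair_sublist_cons_iff, List.filter_cons]
    split_ifs with h
    · rw [List.pair_sublist_cons_iff, ih, List.mem_filter]
      constructor
      · rintro (⟨rfl, h1, h2⟩ | h1)
        · exact ⟨Or.inl ⟨rfl, h1⟩, h, h2⟩
        · exact ⟨Or.inr h1.1, h1.2⟩
      · rintro ⟨⟨rfl, h1⟩ | h1, h2, h3⟩
        · exact Or.inl ⟨rfl, h1, h3⟩
        · exact Or.inr ⟨h1, h2, h3⟩
    · rw [ih]
      constructor
      · exact fun h1 => ⟨Or.inr h1.1, h1.2⟩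
      · rintro ⟨⟨rfl, h1⟩ | h1, h2, h3⟩
        · exact absurd h2 h
        · exact ⟨h1, h2, h3⟩

theorem List.mem_left_of_pair_sublist {β : Type*} {L : List β} {x y : β} (h : [x, y] <+ L) :
    x ∈ L := h.subset (by simp)

theorem List.mem_right_of_pair_sublist {β : Type*} {L : List β} {x y : β} (h : [x, y] <+ L) :
    y ∈ L := h.subset (by simp)

theorem List.pair_sublist_total {β : Type*} {L : List β} {x y : β} (hx : x ∈ L) (hy : y ∈ L)
    (hxy : x ≠ y) : [x, y] <+ L ∨ [y, x] <+ L := by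
  induction L with
  | nil => simp at hx
  | cons z L ih =>
    simp only [List.pair_sublist_cons_iff]
    rcases List.mem_cons.1 hx with rfl | hx' <;> rcases List.mem_cons.1 hy with rfl | hy'
    · exact absurd rfl hxy
    · exact Or.inl (Or.inl ⟨rfl, hy'⟩)
    · exact Or.inr (Or.inl ⟨rfl, hx'⟩)
    · rcases ih hx' hy' with h | h
      · exact Or.inl (Or.inr h)
      · exact Or.inr (Or.inr h)

theorem List.Nodup.pair_sublist_asymm {β : Type*} {L : List β} (hL : L.Nodup) {x y : β}
    (h : [x, y] <+ L) (h' : [y, x] <+ L) : False := by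
  induction L with
  | nil => simp at h
  | cons z L ih =>
    rw [List.nodup_cons] at hL
    rw [List.pair_sublist_cons_iff] at h h'
    rcases h with ⟨rfl, h⟩ | h <;> rcases h' with ⟨rfl, h'⟩ | h'
    · exact hL.1 h'
    · exact hL.1 (List.mem_right_of_pair_sublist h')
    · exact hL.1 (List.mem_right_of_pair_sublist h)
    · exact ih hL.2 h h'

theorem List.Nodup.pair_sublist_ne {β : Type*} {L : List β} (hL : L.Nodup) {x y : β}
    (h : [x, y] <+ L) : x ≠ y := by
  rintro rfl
  exact hL.pair_sublist_asymm h h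

theorem List.Nodup.pair_sublist_trans {β : Type*} {L : List β} (hL : L.Nodup) {x y z : β}
    (h : [x, y] <+ L) (h' : [y, z] <+ L) : [x, z] <+ L := by
  induction L with
  | nil => simp at h
  | cons w L ih =>
    rw [List.nodup_cons] at hL
    rw [List.pair_sublist_cons_iff] at h h' ⊢
    rcases h with ⟨rfl, h⟩ | h <;> rcases h' with ⟨rfl, h'⟩ | h'
    · exact absurd h hL.1
    · exact Or.inl ⟨rfl, List.mem_right_of_pair_sublist h'⟩
    · exact absurd (List.mem_right_of_pair_sublist h) hL.1
    · exact Or.inr (ih hL.2 h h')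

theorem List.Nodup.find?_eq_some_iff {β : Type*} {L : List β} (hL : L.Nodup) {p : β → Bool}
    {r : β} : L.find? p = some r ↔ r ∈ L ∧ p r ∧ ∀ x, [x, r] <+ L → ¬ p x := by
  induction L with
  | nil => simp
  | cons z L ih =>
    rw [List.nodup_cons] at hL
    by_cases hz : p z
    · rw [List.find?_cons_of_pos hz, Option.some_inj]
      constructor
      · rintro rfl
        refine ⟨by simp, hz, fun x hx => ?_⟩
        rcases List.pair_sublist_cons_iff.1 hx with ⟨_, h⟩ | h
        · exact absurd h hL.1
        · exact absurd (List.mem_right_of_pair_sublist h) hL.1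
      · rintro ⟨h1, _, h3⟩
        rcases List.mem_cons.1 h1 with rfl | h1
        · rfl
        · exact absurd hz (h3 z (List.pair_sublist_cons_iff.2 (Or.inl ⟨rfl, h1⟩)))
    · rw [List.find?_cons_of_neg hz, ih hL.2]
      constructor
      · rintro ⟨h1, h2, h3⟩
        refine ⟨by simp [h1], h2, fun x hx => ?_⟩
        rcases List.pair_sublist_cons_iff.1 hx with ⟨rfl, _⟩ | h
        · exact hz
        · exact h3 x h
      · rintro ⟨h1, h2, h3⟩
        rcases List.mem_cons.1 h1 with rfl | h1
        · exact absurd h2 hz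
        · exact ⟨h1, h2, fun x hx => h3 x (List.pair_sublist_cons_iff.2 (Or.inr hx))⟩

theorem List.pair_sublist_of_mem_take {β : Type*} {L : List β} {j : ℕ} {x y : β}
    (hx : x ∈ L.take j) (hy : y ∈ L) (hy' : y ∉ L.take j) : [x, y] <+ L := by
  have h : L.take j ++ L.drop j = L := List.take_append_drop j L
  rw [← h] at hy ⊢
  rw [List.mem_append] at hy
  exact List.pair_sublist_append_iff.2 (Or.inr (Or.inl ⟨hx, hy.resolve_left hy'⟩))

/-- Used for the last step of a split: when the elements satisfying `p` all come first, knowing how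
many there are is enough to find them. -/
theorem List.take_countP_eq_filter {β : Type*} {L : List β} {p : β → Bool}
    (h : L.Pairwise fun x y => ¬ (¬ p x ∧ p y)) : L.take (L.countP p) = L.filter p := by
  induction L with
  | nil => simp
  | cons z L ih =>
    rw [List.pairwise_cons] at h
    by_cases hz : p z
    · rw [List.countP_cons_of_pos hz, List.take_succ_cons, ih h.2, List.filter_cons_of_pos hz]
    · have h0 : ∀ x ∈ L, ¬ p x := fun x hx hp => h.1 x hx ⟨hz, hp⟩
      rw [List.countP_cons_of_neg hz, List.countP_eq_zero.2 h0, List.filter_cons_of_neg hz,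
        List.filter_eq_nil_iff.2 h0, List.take_zero]

/-- The list `L` is produced by the following walk: the next element is the target `o` of the
previous one if `o` has not been listed before, and the smallest remaining element otherwise. The
target of `x` is `g x`, where `⊤` stands for a missing target. -/
def IsWalk (g : α → WithTop α) : WithTop α → List α → Prop
  | _, [] => True
  | o, y :: L =>
    y ∉ L ∧ (o = y ∨ ((∀ z ∈ L, o ≠ z) ∧ ∀ z ∈ L, y < z)) ∧ IsWalk g (g y) L

namespace IsWalk

variable {g g' : α → WithTop α} {o o' : WithTop α} {L L' : List α}

theorem nodup (h : IsWalk g o L) : L.Nodup := by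
  induction L generalizing o with
  | nil => exact List.nodup_nil
  | cons y L ih => exact List.nodup_cons.2 ⟨h.1, ih h.2.2⟩

/-- Each step is forced by the current target and the set of elements still to come. Chain orders
are identified in this way: it suffices to exhibit a walk with the right members. -/
theorem eq_of_mem_iff (h : IsWalk g o L) (h' : IsWalk g o L') (hm : ∀ x, x ∈ L ↔ x ∈ L') :
    L = L' := by
  induction L generalizing o L' with
  | nil =>
    symm
    rw [List.eq_nil_iff_forall_not_mem]
    intro x hx
    simpa using (hm x).2 hx
  | cons y L ih =>
    cases L' with
    | nil => simpa using (hm y).1 (by simp)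
    | cons y' L' =>
      have hy : y = y' := by
        have h1 := List.mem_cons.1 ((hm y).1 (by simp))
        have h2 := List.mem_cons.1 ((hm y').2 (by simp))
        rcases h1 with h1 | h1
        · exact h1
        rcases h2 with h2 | h2
        · exact h2.symm
        rcases h.2.1 with h3 | h3 <;> rcases h'.2.1 with h4 | h4
        · exact WithTop.coe_injective (h3.symm.trans h4)
        · exact absurd h3 (h4.1 y h1)
        · exact absurd h4 (h3.1 y' h2)
        · exact absurd (h3.2 y' h2) (h4.2 y h1).asymm
      subst hy
      rw [ih h.2.2 h'.2.2]
      intro x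
      have := hm x
      rw [List.mem_cons, List.mem_cons] at this
      constructor
      · intro hx
        rcases this.1 (Or.inr hx) with rfl | h5
        · exact absurd hx h.1
        · exact h5
      · intro hx
        rcases this.2 (Or.inr hx) with rfl | h5
        · exact absurd hx h'.1
        · exact h5

theorem congr (h : IsWalk g o L) (hg : ∀ x ∈ L, g' x = g x) : IsWalk g' o L := by
  induction L generalizing o with
  | nil => trivial
  | cons y L ih =>
    refine ⟨h.1, h.2.1, ?_⟩
    rw [hg y (by simp)]
    exact ih h.2.2 fun x hx => hg x (by simp [hx])

/-- A target that is still available is taken at once, so nothing stands between `x` and `y`. -/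
theorem eq_or_pair_sublist_of_target_mem (h : IsWalk g o L) {x y z : α} (hxy : [x, y] <+ L)
    (hg : g x = y) (hxz : [x, z] <+ L) : z = y ∨ [y, z] <+ L := by
  induction L generalizing o with
  | nil => simp at hxy
  | cons w L ih =>
    rw [List.pair_sublist_cons_iff] at hxy hxz
    have hnd := h.nodup
    rw [List.nodup_cons] at hnd
    rcases hxy with ⟨rfl, hy⟩ | hxy <;> rcases hxz with ⟨hxw, hz⟩ | hxz
    · cases L with
      | nil => simp at hy
      | cons v L =>
        have h2 := h.2.2.2.1
        rw [hg] at h2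
        have hyv : y = v := by
          rcases h2 with h2 | h2
          · exact WithTop.coe_injective h2
          · rcases List.mem_cons.1 hy with hy | hy
            · exact hy
            · exact absurd rfl (h2.1 y hy)
        subst hyv
        rcases List.mem_cons.1 hz with hz | hz
        · exact Or.inl hz
        · exact Or.inr (List.pair_sublist_cons_iff.2 (Or.inr
            (List.pair_sublist_cons_iff.2 (Or.inl ⟨rfl, hz⟩))))
    · exact absurd (List.mem_left_of_pair_sublist hxz) hnd.1
    · subst hxw
      exact absurd (List.mem_left_of_pair_sublist hxy) hnd.1
    · exact (ih h.2.2 hxy hxz).imp_right fun h5 => List.pair_sublist_cons_iff.2 (Or.inr h5)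

/-- Both `x` and `z` would have to stand immediately before `y`. -/
theorem pred_unique (h : IsWalk g o L) {x y z : α} (hxy : [x, y] <+ L) (hx : g x = y)
    (hzy : [z, y] <+ L) (hz : g z = y) : x = z := by
  by_contra hne
  have key : ∀ {x z : α}, [x, y] <+ L → g x = y → [z, y] <+ L → [x, z] <+ L → False := by
    intro x z hxy hx hzy hxz
    rcases h.eq_or_pair_sublist_of_target_mem hxy hx hxz with rfl | h1
    · exact h.nodup.pair_sublist_ne hzy rfl
    · exact h.nodup.pair_sublist_asymm hzy h1
  rcases List.pair_sublist_total (List.mem_left_of_pair_sublist hxy)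
    (List.mem_left_of_pair_sublist hzy) hne with h1 | h1
  · exact key hxy hx hzy h1
  · exact key hzy hz hxy h1

/-- An element that no earlier one targets can only have been reached as the minimum of what
remained. In the application it opens a chain, so chain heads increase. -/
theorem lt_of_no_pred (h : IsWalk g o L) {y z : α} (ho : o ≠ y)
    (hy : ∀ x, [x, y] <+ L → g x ≠ y) (hyz : [y, z] <+ L) : y < z := by
  induction L generalizing o with
  | nil => simp at hyz
  | cons w L ih =>
    rcases List.pair_sublist_cons_iff.1 hyz with ⟨rfl, hz⟩ | hyz'
    · exact (h.2.1.resolve_left ho).2 z hz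
    · refine ih h.2.2 (hy w (List.pair_sublist_cons_iff.2
        (Or.inl ⟨rfl, List.mem_left_of_pair_sublist hyz'⟩))) ?_ hyz'
      exact fun x hx => hy x (List.pair_sublist_cons_iff.2 (Or.inr hx))

/-- Contracting an edge `r → t` in the walk removes `r` from the list. -/
theorem filter_ne {r t : α} (htr : t < r) (hr : g' r = t) (h : IsWalk g' o' L)
    (hg : ∀ x ∈ L, x ≠ r → (g x = g' x ∧ g' x ≠ r) ∨ (g' x = r ∧ g x = t)) (hrL : r ∈ L)
    (ho : (o = o' ∧ o' ≠ r) ∨ (o' = r ∧ o = t)) : IsWalk g o (L.filter (· ≠ r)) := by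
  -- Once neither `r` nor `t` lies ahead, redirecting a target from `r` to `t` has no effect: both
  -- count as missing.
  have post : ∀ (C : List α) (o o' : WithTop α), IsWalk g' o' C → r ∉ C → t ∉ C →
      (∀ x ∈ C, x ≠ r → g x = g' x ∨ (g' x = r ∧ g x = t)) →
      (o = o' ∨ ((∀ z ∈ C, o ≠ z) ∧ ∀ z ∈ C, o' ≠ z)) → IsWalk g o C := by
    intro C
    induction C with
    | nil => intros; trivial
    | cons y C ih =>
      intro o o' h hrC htC hg ho
      rw [List.mem_cons, not_or] at hrC htC
      have hy := hg y (by simp) (Ne.symm hrC.1)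
      refine ⟨h.1, ?_, ih _ (g' y) h.2.2 hrC.2 htC.2 (fun x hx => hg x (by simp [hx])) ?_⟩
      · rcases ho with rfl | ho
        · exact h.2.1
        · exact Or.inr ⟨fun z hz => ho.1 z (by simp [hz]),
            (h.2.1.resolve_left (ho.2 y (by simp))).2⟩
      · rcases hy with hy | ⟨hy1, hy2⟩
        · exact Or.inl hy
        · right
          rw [hy1, hy2]
          refine ⟨fun z hz hzt => htC.2 ?_, fun z hz hzt => hrC.2 ?_⟩
          · rwa [WithTop.coe_injective hzt]
          · rwa [WithTop.coe_injective hzt]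
  induction L generalizing o o' with
  | nil => trivial
  | cons y L ih =>
    by_cases hyr : y = r
    · subst hyr
      have hf : (y :: L).filter (· ≠ y) = L := by
        rw [List.filter_cons_of_neg (by simp), List.filter_eq_self]
        intro x hx
        simp only [ne_eq, decide_not, Bool.not_eq_eq_eq_not, Bool.not_true, decide_eq_false_iff_not]
        rintro rfl
        exact h.1 hx
      rw [hf]
      have hL := h.2.2
      rw [hr] at hL
      have hgL : ∀ x ∈ L, x ≠ y → g x = g' x ∨ (g' x = y ∧ g x = t) :=
        fun x hx hxy => (hg x (by simp [hx]) hxy).imp_left And.left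
      -- If `t` is still to come when `r` is listed, then `r` is not the minimum of what remains, so
      -- it was listed as the target `o'`. The contracted walk has target `t` at this point, and `t`
      -- is what follows `r`.
      by_cases htL : t ∈ L
      · have ho' : o' = y := by
          rcases h.2.1 with h1 | h1
          · exact h1
          · exact absurd (h1.2 t htL) htr.asymm
        have hot : o = t := (ho.resolve_left fun h1 => h1.2 ho').2
        rcases L with _ | ⟨v, L⟩
        · trivial
        · have hvt : t = v := by
            rcases hL.2.1 with h2 | h2
            · exact WithTop.coe_injective h2
            · rcases List.mem_cons.1 htL with h3 | h3
              · exact h3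
              · exact absurd rfl (h2.1 t h3)
          subst hvt
          have hyL := h.1
          rw [List.mem_cons, not_or] at hyL
          have ht := hgL t (by simp) htr.ne
          refine ⟨hL.1, Or.inl hot, post L _ (g' t) hL.2.2 hyL.2 hL.1
            (fun x hx => hgL x (by simp [hx])) ?_⟩
          rcases ht with ht | ⟨ht1, ht2⟩
          · exact Or.inl ht
          · right
            rw [ht1, ht2]
            refine ⟨fun z hz hzt => hL.1 ?_, fun z hz hzt => hyL.2 ?_⟩
            · rwa [WithTop.coe_injective hzt]
            · rwa [WithTop.coe_injective hzt]
      -- Otherwise `r` has no available target, so the next element is the minimum of the rest. The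
      -- target `o` of the contracted walk is not available either, so it continues in the same way.
      · have hotL : (∀ z ∈ L, o ≠ z) := by
          intro z hz hoz
          rcases ho with ho | ho
          · rcases h.2.1 with h1 | h1
            · apply h.1
              rw [← WithTop.coe_injective ((hoz.symm.trans ho.1).trans h1)]
              exact hz
            · exact h1.1 z hz (ho.1.symm.trans hoz)
          · apply htL
            rw [WithTop.coe_injective (ho.2.symm.trans hoz)]
            exact hz
        refine post L o t hL h.1 htL hgL (Or.inr ⟨hotL, fun z hz hzt => htL ?_⟩)
        rwa [WithTop.coe_injective hzt]
    · have hrL' : r ∈ L := (List.mem_cons.1 hrL).resolve_left (Ne.symm hyr)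
      have hf : (y :: L).filter (· ≠ r) = y :: L.filter (· ≠ r) :=
        List.filter_cons_of_pos (by simpa using hyr)
      rw [hf]
      -- The target `r` is still available here and would have been listed instead of `y`.
      have ho' : o' ≠ r := by
        intro h0
        rcases h.2.1 with h1 | h1
        · exact hyr (WithTop.coe_injective (h1.symm.trans h0))
        · exact h1.1 r hrL' h0
      have hoo : o = o' := (ho.resolve_right fun h0 => ho' h0.1).1
      subst hoo
      refine ⟨fun h0 => h.1 (List.mem_filter.1 h0).1, ?_,
        ih h.2.2 (fun x hx => hg x (by simp [hx])) hrL' (hg y (by simp) hyr)⟩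
      refine h.2.1.imp_right fun h0 => ⟨fun z hz => h0.1 z (List.mem_filter.1 hz).1,
        fun z hz => h0.2 z (List.mem_filter.1 hz).1⟩

end IsWalk

end Walk

/-! ### Chains as pieces of a walk -/

theorem List.head?_eq_or_infix {β : Type*} {l : List β} {y : β} (hy : y ∈ l) :
    l.head? = some y ∨ ∃ z, [z, y] <:+: l := by
  induction l with
  | nil => simp at hy
  | cons a l ih =>
    rcases List.mem_cons.1 hy with rfl | hy
    · exact Or.inl rfl
    · right
      rcases ih hy with h | ⟨z, h⟩
      · obtain ⟨l', rfl⟩ := List.head?_eq_some_iff.1 h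
        exact ⟨a, [], l', rfl⟩
      · exact ⟨z, h.trans (List.suffix_cons a l).isInfix⟩

section Chains

variable {α : Type*} [LinearOrder α] {g : α → WithTop α} {o : WithTop α} {X Z LL : List (List α)}

/-- Earlier chains do not target the head by `hp`, and within its own chain nothing stands before
it. -/
theorem IsWalk.no_pred_of_head {h : α} {l : List α}
    (hw : IsWalk g o (X ++ (h :: l) :: Z).flatten)
    (hp : (X ++ (h :: l) :: Z).Pairwise fun l l' => ∀ z ∈ l, ∀ y : α, y ∈ l'.head? → g z ≠ y) {z : α}
    (hz : [z, h] <+ (X ++ (h :: l) :: Z).flatten) : g z ≠ h := by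
  have hnd := hw.nodup
  rw [List.flatten_append, List.flatten_cons, List.cons_append] at hz hnd
  rw [List.pair_sublist_append_iff, List.pair_sublist_cons_iff] at hz
  rw [List.nodup_append, List.nodup_cons] at hnd
  have hzX : z ∈ X.flatten := by
    rcases hz with h1 | h1 | ⟨rfl, h1⟩ | h1
    · exact absurd rfl (hnd.2.2 h (List.mem_right_of_pair_sublist h1) h (by simp))
    · exact h1.1
    · exact absurd h1 hnd.2.1.1
    · exact absurd (List.mem_right_of_pair_sublist h1) hnd.2.1.1
  obtain ⟨l', hl', hzl'⟩ := List.mem_flatten.1 hzX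
  exact (List.pairwise_append.1 hp).2.2 l' hl' (h :: l) (by simp) z hzl' h (by simp)

theorem List.IsChain.rel_of_infix {β : Type*} {R : β → β → Prop} {l : List β} (h : l.IsChain R)
    {x y : β} (hxy : [x, y] <:+: l) : R x y := by
  simpa using h.infix hxy

/-- Adjacency in a chain is expressed by order and targets alone: a number targeted by an earlier
one is not a head, and its neighbor in the chain is the only earlier number that targets it. -/
theorem IsWalk.infix_iff (hw : IsWalk g o LL.flatten) (hc : ∀ l ∈ LL, l.IsChain fun x y => g x = y)
    (hp : LL.Pairwise fun l l' => ∀ z ∈ l, ∀ y : α, y ∈ l'.head? → g z ≠ y) {x y : α} :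
    (∃ l ∈ LL, [x, y] <:+: l) ↔ [x, y] <+ LL.flatten ∧ g x = y := by
  constructor
  · rintro ⟨l, hl, hxy⟩
    exact ⟨hxy.sublist.trans (List.sublist_flatten_of_mem hl), (hc l hl).rel_of_infix hxy⟩
  · rintro ⟨hxy, hg⟩
    obtain ⟨l, hl, hyl⟩ := List.mem_flatten.1 (List.mem_right_of_pair_sublist hxy)
    rcases List.head?_eq_or_infix hyl with h | ⟨z, h⟩
    · obtain ⟨l', rfl⟩ := List.head?_eq_some_iff.1 h
      obtain ⟨X, Z, rfl⟩ := List.append_of_mem hl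
      exact absurd hg (hw.no_pred_of_head hp hxy)
    · have hz : z = x := hw.pred_unique (h.sublist.trans (List.sublist_flatten_of_mem hl))
        ((hc l hl).rel_of_infix h) hxy hg
      exact ⟨l, hl, hz ▸ h⟩

/-- The chain heads are the elements that no earlier element targets, and they increase along the
walk. So the head of the chain of `x` is the largest head at or before `x`, and bounding it amounts
to bounding all of them. The right-hand side mentions only order and targets, which can be followed
through a merge. -/
theorem IsWalk.exists_chain_iff (hw : IsWalk g ⊤ LL.flatten)
    (hc : ∀ l ∈ LL, l.IsChain fun x y => g x = y) (hne : ∀ l ∈ LL, l ≠ [])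
    (hp : LL.Pairwise fun l l' => ∀ z ∈ l, ∀ y : α, y ∈ l'.head? → g z ≠ y) {p : α → Prop}
    {ρ : WithTop α} :
    (∃ l ∈ LL, (∃ i ∈ l.head?, (i : WithTop α) < ρ) ∧ ∃ x ∈ l, p x) ↔
      ∃ x ∈ LL.flatten, p x ∧ ∀ s, (s = x ∨ [s, x] <+ LL.flatten) →
        (∀ z, [z, s] <+ LL.flatten → g z ≠ s) → (s : WithTop α) < ρ := by
  constructor
  · rintro ⟨l, hl, ⟨i, hi, hiρ⟩, x, hx, hpx⟩
    refine ⟨x, List.mem_flatten.2 ⟨l, hl, hx⟩, hpx, fun s hs hst => ?_⟩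
    obtain ⟨l', rfl⟩ := List.head?_eq_some_iff.1 hi
    obtain ⟨X, Z, rfl⟩ := List.append_of_mem hl
    have hloc : s ∈ X.flatten ∨ s ∈ i :: l' := by
      rcases hs with rfl | hs
      · exact Or.inr hx
      · have hnd := hw.nodup
        rw [List.flatten_append, List.flatten_cons] at hs hnd
        rw [List.nodup_append, List.nodup_append] at hnd
        rw [List.pair_sublist_append_iff, List.pair_sublist_append_iff] at hs
        rcases hs with h1 | h1 | h1 | h1 | h1
        · exact Or.inl (List.mem_left_of_pair_sublist h1)
        · exact Or.inl h1.1
        · exact Or.inr (List.mem_left_of_pair_sublist h1)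
        · exact Or.inr h1.1
        · exact absurd rfl (hnd.2.1.2.2 x hx x (List.mem_right_of_pair_sublist h1))
    rcases hloc with h1 | h1
    · have : [s, i] <+ (X ++ (i :: l') :: Z).flatten := by
        rw [List.flatten_append, List.flatten_cons, List.pair_sublist_append_iff]
        exact Or.inr (Or.inl ⟨h1, by simp⟩)
      exact lt_trans (WithTop.coe_lt_coe.2 (hw.lt_of_no_pred (by simp) hst this)) hiρ
    · rcases List.head?_eq_or_infix h1 with h2 | ⟨z, h2⟩
      · rw [List.head?_cons, Option.some_inj] at h2
        exact h2 ▸ hiρ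
      · exact absurd ((hc _ hl).rel_of_infix h2)
          (hst z (h2.sublist.trans (List.sublist_flatten_of_mem hl)))
  · rintro ⟨x, hx, hpx, hs⟩
    obtain ⟨l, hl, hxl⟩ := List.mem_flatten.1 hx
    obtain ⟨i, l', rfl⟩ := List.exists_cons_of_ne_nil (hne l hl)
    refine ⟨i :: l', hl, ⟨i, by simp, hs i ?_ ?_⟩, x, hxl, hpx⟩
    · rcases List.mem_cons.1 hxl with h | h
      · exact Or.inl h.symm
      · exact Or.inr ((List.pair_sublist_cons_iff.2 (Or.inl ⟨rfl, h⟩)).trans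
          (List.sublist_flatten_of_mem hl))
    · intro z hz
      obtain ⟨X, Z, rfl⟩ := List.append_of_mem hl
      exact hw.no_pred_of_head hp hz

end Chains

/-! ### The recursive construction produces a walk cut into chains -/

section ChainsFrom

variable {n : ℕ}

/-- Induction on the size of `R`. The walk describes what comes after `cur`, so its initial target
is the minimum of the hue of `cur`. The last clause, that no number targets the head of a later
chain, is what allows the chains to be recovered from the flattened list. -/
theorem chainsFrom_spec (hue : Fin n → Finset (Fin n)) (N : ℕ) : ∀ (cur : Fin n)
    (R : Finset (Fin n)), R.card = N → cur ∉ R → ∃ l LL, chainsFrom hue cur R = (cur :: l) :: LL ∧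
      IsWalk (fun x => (hue x).min) (hue cur).min (l ++ LL.flatten) ∧
      (∀ x, x ∈ l ++ LL.flatten ↔ x ∈ R) ∧
      (cur :: l).IsChain (fun x y => (hue x).min = y) ∧
      (∀ l' ∈ LL, l' ≠ [] ∧ l'.IsChain fun x y => (hue x).min = y) ∧
      ((cur :: l) :: LL).Pairwise fun l l' => ∀ z ∈ l, ∀ y : Fin n, y ∈ l'.head? → (hue z).min ≠ y := by
  induction N with
  | zero =>
    intro cur R hR hcur
    rw [Finset.card_eq_zero] at hR
    subst hR
    refine ⟨[], [], ?_, trivial, by simp, by simp, by simp, by simp⟩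
    rw [chainsFrom]
    simp
  | succ N ih =>
    intro cur R hR hcur
    have hRne : R.Nonempty := Finset.card_pos.1 (by omega)
    by_cases h : ∃ hB : (hue cur).Nonempty, (hue cur).min' hB ∈ R
    · obtain ⟨hB, hb⟩ := h
      obtain ⟨l, LL, h1, h2, h3, h4, h5, h6⟩ := ih ((hue cur).min' hB)
        (R.erase ((hue cur).min' hB)) (by rw [Finset.card_erase_of_mem hb]; omega)
        (Finset.notMem_erase _ _)
      have h0 : chainsFrom hue cur R = (((hue cur).min' hB :: l) :: LL).modifyHead (cur :: ·) := by
        rw [chainsFrom, dif_pos ⟨hB, hb⟩, h1]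
      have hmin : (hue cur).min = (hue cur).min' hB := (Finset.coe_min' hB).symm
      generalize (hue cur).min' hB = b at *
      have hbL : b ∉ l ++ LL.flatten := fun h => Finset.notMem_erase b R ((h3 b).1 h)
      refine ⟨b :: l, LL, h0, ⟨hbL, Or.inl hmin, h2⟩, ?_, ?_, h5, ?_⟩
      · intro x
        rw [List.cons_append, List.mem_cons, h3, Finset.mem_erase]
        constructor
        · rintro (rfl | h)
          · exact hb
          · exact h.2
        · intro hx
          by_cases hxb : x = b
          · exact Or.inl hxb
          · exact Or.inr ⟨hxb, hx⟩
      · exact List.isChain_cons_cons.2 ⟨hmin, h4⟩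
      · rw [List.pairwise_cons] at h6 ⊢
        refine ⟨fun l' hl' z hz y hy => ?_, h6.2⟩
        rcases List.mem_cons.1 hz with rfl | hz
        · rw [hmin]
          intro hby
          rw [WithTop.coe_inj] at hby
          subst hby
          exact hbL (List.mem_append_right _ (List.mem_flatten.2 ⟨l', hl', List.mem_of_mem_head? hy⟩))
        · exact h6.1 l' hl' z hz y hy
    · obtain ⟨l, LL, h1, h2, h3, h4, h5, h6⟩ := ih (R.min' hRne)
        (R.erase (R.min' hRne)) (by rw [Finset.card_erase_of_mem (R.min'_mem hRne)]; omega)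
        (Finset.notMem_erase _ _)
      have hcurR : ∀ y ∈ R, (hue cur).min ≠ y := by
        intro y hy hmin
        have hB : (hue cur).Nonempty := ⟨y, Finset.mem_of_min hmin⟩
        refine h ⟨hB, ?_⟩
        rw [← Finset.coe_min' hB, WithTop.coe_inj] at hmin
        rwa [hmin]
      have hbL : R.min' hRne ∉ l ++ LL.flatten := fun h => Finset.notMem_erase _ R ((h3 _).1 h)
      have hmem : ∀ x, x ∈ (R.min' hRne :: l) ++ LL.flatten ↔ x ∈ R := by
        intro x
        rw [List.cons_append, List.mem_cons, h3, Finset.mem_erase]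
        constructor
        · rintro (rfl | h)
          · exact R.min'_mem hRne
          · exact h.2
        · intro hx
          by_cases hxb : x = R.min' hRne
          · exact Or.inl hxb
          · exact Or.inr ⟨hxb, hx⟩
      refine ⟨[], (R.min' hRne :: l) :: LL, ?_, ⟨hbL, Or.inr ⟨?_, ?_⟩, h2⟩, hmem, by simp, ?_, ?_⟩
      · rw [chainsFrom, dif_neg h, dif_pos hRne, h1]
      · exact fun z hz => hcurR z ((hmem z).1 (List.mem_cons_of_mem _ hz))
      · intro z hz
        have := Finset.mem_erase.1 ((h3 z).1 hz)
        exact lt_of_le_of_ne (R.min'_le z this.2) (Ne.symm this.1)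
      · intro l' hl'
        rcases List.mem_cons.1 hl' with rfl | hl'
        · exact ⟨by simp, h4⟩
        · exact h5 l' hl'
      · rw [List.pairwise_cons]
        refine ⟨fun l' hl' z hz y hy => ?_, h6⟩
        rw [List.mem_singleton] at hz
        subst hz
        refine hcurR y ((hmem y).1 ?_)
        have : y ∈ ((R.min' hRne :: l) :: LL).flatten :=
          List.mem_flatten.2 ⟨l', hl', List.mem_of_mem_head? hy⟩
        rwa [List.flatten_cons] at this

end ChainsFrom

/-! ### Number chains of a marking in terms of order and targets -/

namespace ColoredExponents

variable {n m : ℕ} (P : ColoredExponents n m) (D : Marking n) (c : Fin m)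

/-- The initial target `⊤` is missing, so the walk starts at the minimum of the chain set. -/
theorem numberChains_spec :
    IsWalk (fun x => (D.hue x).min) ⊤ (P.chainOrder D c) ∧
    (∀ x, x ∈ P.chainOrder D c ↔ x ∈ P.chainSet D c) ∧
    (∀ l ∈ P.numberChains D c, l ≠ [] ∧ l.IsChain fun x y => (D.hue x).min = y) ∧
    (P.numberChains D c).Pairwise fun l l' => ∀ z ∈ l, ∀ y : Fin n, y ∈ l'.head? → (D.hue z).min ≠ y := by
  rw [chainOrder]
  by_cases h : (P.chainSet D c).Nonempty
  · obtain ⟨l, LL, h1, h2, h3, h4, h5, h6⟩ := chainsFrom_spec D.hue _ ((P.chainSet D c).min' h)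
      ((P.chainSet D c).erase ((P.chainSet D c).min' h)) rfl (Finset.notMem_erase _ _)
    rw [numberChains, dif_pos h, h1]
    have hb : (P.chainSet D c).min' h ∉ l ++ LL.flatten :=
      fun h0 => Finset.notMem_erase _ _ ((h3 _).1 h0)
    refine ⟨⟨hb, Or.inr ⟨by simp, fun z hz => ?_⟩, h2⟩, fun x => ?_, fun l' hl' => ?_, h6⟩
    · have := Finset.mem_erase.1 ((h3 z).1 hz)
      exact lt_of_le_of_ne (Finset.min'_le _ z this.2) (Ne.symm this.1)
    · rw [List.flatten_cons, List.cons_append, List.mem_cons, h3, Finset.mem_erase]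
      constructor
      · rintro (rfl | h0)
        · exact Finset.min'_mem _ h
        · exact h0.2
      · intro hx
        by_cases hxb : x = (P.chainSet D c).min' h
        · exact Or.inl hxb
        · exact Or.inr ⟨hxb, hx⟩
    · rcases List.mem_cons.1 hl' with rfl | hl'
      · exact ⟨by simp, h4⟩
      · exact h5 l' hl'
  · rw [numberChains, dif_neg h]
    rw [Finset.not_nonempty_iff_eq_empty] at h
    rw [h]
    exact ⟨trivial, by simp, by simp, by simp⟩

theorem isWalk_chainOrder : IsWalk (fun x => (D.hue x).min) ⊤ (P.chainOrder D c) :=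
  (P.numberChains_spec D c).1

theorem nodup_chainOrder : (P.chainOrder D c).Nodup := (P.isWalk_chainOrder D c).nodup

variable {D c}

theorem mem_chainOrder {x : Fin n} : x ∈ P.chainOrder D c ↔ x ∈ P.chainSet D c :=
  (P.numberChains_spec D c).2.1 x

theorem precedesInChain_iff {x y : Fin n} :
    P.PrecedesInChain D c x y ↔ [x, y] <+ P.chainOrder D c ∧ (D.hue x).min = y :=
  (P.isWalk_chainOrder D c).infix_iff (fun l hl => ((P.numberChains_spec D c).2.2.1 l hl).2)
    (P.numberChains_spec D c).2.2.2

theorem exists_chain_iff {p : Fin n → Prop} {ρ : WithTop (Fin n)} :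
    (∃ l ∈ P.numberChains D c, (∃ i ∈ l.head?, (i : WithTop (Fin n)) < ρ) ∧ ∃ x ∈ l, p x) ↔
      ∃ x ∈ P.chainOrder D c, p x ∧ ∀ s, (s = x ∨ [s, x] <+ P.chainOrder D c) →
        (∀ z, [z, s] <+ P.chainOrder D c → (D.hue z).min ≠ s) → (s : WithTop (Fin n)) < ρ :=
  (P.isWalk_chainOrder D c).exists_chain_iff
    (fun l hl => ((P.numberChains_spec D c).2.2.1 l hl).2)
    (fun l hl => ((P.numberChains_spec D c).2.2.1 l hl).1) (P.numberChains_spec D c).2.2.2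

end ColoredExponents

theorem List.pair_sublist_iff_of_pairwise_lt {α : Type*} [LinearOrder α] {L : List α}
    (hL : L.Pairwise (· < ·)) {x y : α} : [x, y] <+ L ↔ x ∈ L ∧ y ∈ L ∧ x < y := by
  constructor
  · exact fun h => ⟨List.mem_left_of_pair_sublist h, List.mem_right_of_pair_sublist h,
      List.pairwise_iff_forall_sublist.1 hL h⟩
  · rintro ⟨hx, hy, hxy⟩
    refine (List.pair_sublist_total hx hy hxy.ne).resolve_right fun h => ?_
    exact hxy.asymm (List.pairwise_iff_forall_sublist.1 hL h)

/-! ### Hues, underlines and chain members of a mismatched decoration -/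

namespace ColoredExponents

variable {n m : ℕ} {P : ColoredExponents n m} {D : Marking n}

theorem mem_mismatchedDecorations :
    D ∈ P.mismatchedDecorations ↔ P.IsDecoration D ∧ P.IsMismatched D := by
  simp [mismatchedDecorations, decorations]

theorem mem_boxed {i : Fin n} : i ∈ P.boxed ↔ 0 < P.k i := by simp [boxed]

namespace IsDecoration

theorem eq_of_mem (hD : P.IsDecoration D)
    {B B' : Finset (Fin n)} (hB : B ∈ D.hues) (hB' : B' ∈ D.hues) {i : Fin n}
    (hi : i ∈ B) (hi' : i ∈ B') : B = B' := by
  by_contra h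
  exact Finset.disjoint_left.1 (hD.hues_disjoint B hB B' hB' h) hi hi'

theorem mem_boxed_iff (hD : P.IsDecoration D) {i : Fin n} : i ∈ P.boxed ↔ ∃ B ∈ D.hues, i ∈ B := by
  rw [← hD.hues_union]
  simp

theorem boxed_of_mem (hD : P.IsDecoration D)
    {B : Finset (Fin n)} (hB : B ∈ D.hues) {i : Fin n} (hi : i ∈ B) :
    i ∈ P.boxed := hD.mem_boxed_iff.2 ⟨B, hB, hi⟩

theorem notMem_crossed (hD : P.IsDecoration D)
    {x : Fin n} (h : D.hue x ∈ D.hues) : x ∉ P.crossed := by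
  intro hx
  have := hD.hues_nonempty _ h
  rw [hD.hue_crossed x hx] at this
  exact Finset.not_nonempty_empty this

theorem hueMatches_iff (hD : P.IsDecoration D)
    {x b : Fin n} (h : D.hue x ∈ D.hues) (hb : b ∈ D.hue x) :
    P.HueMatches D x ↔ P.color b = P.color x := by
  constructor
  · rintro ⟨b', hb', h'⟩
    rw [← h']
    exact hD.hues_monochromatic _ h b hb b' hb'
  · exact fun h' => ⟨b, hb, h'⟩

theorem hue_mem_of_hueMatches (hD : P.IsDecoration D)
    {x : Fin n} (h : P.HueMatches D x) : D.hue x ∈ D.hues := by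
  apply hD.hue_mem
  intro hx
  obtain ⟨b, hb, _⟩ := h
  rw [hD.hue_crossed x hx] at hb
  simp at hb

/-- An underlined unboxed number would have a matching hue, which is excluded in a mismatched
decoration. Hence the underlines carry no information beyond the hues. -/
theorem mem_under_iff (hD : P.IsDecoration D) (hM : P.IsMismatched D) {x : Fin n} :
    x ∈ D.under ↔ ∃ B ∈ D.hues, x ∈ B ∧ ∃ j ∈ B, j < x := by
  by_cases hx : x ∈ P.boxed
  · exact hD.under_boxed x hx
  · constructor
    · exact fun h => absurd (hD.under_unboxed x hx h) (hM x hx)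
    · rintro ⟨B, hB, hxB, _⟩
      exact absurd (hD.boxed_of_mem hB hxB) hx

theorem mem_under_iff_of_mem (hD : P.IsDecoration D)
    (hM : P.IsMismatched D) {B : Finset (Fin n)} (hB : B ∈ D.hues)
    {x : Fin n} (hx : x ∈ B) : x ∈ D.under ↔ ∃ j ∈ B, j < x := by
  rw [hD.mem_under_iff hM]
  constructor
  · rintro ⟨B', hB', hxB', h⟩
    rwa [hD.eq_of_mem hB hB' hx hxB']
  · exact fun h => ⟨B, hB, hx, h⟩

theorem min_notMem_under (hD : P.IsDecoration D)
    (hM : P.IsMismatched D) {B : Finset (Fin n)} (hB : B ∈ D.hues)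
    {x : Fin n} (hx : B.min = (x : WithTop (Fin n))) : x ∉ D.under := by
  rw [hD.mem_under_iff_of_mem hM hB (Finset.mem_of_min hx)]
  rintro ⟨j, hj, hjx⟩
  exact absurd (Finset.min_le_of_eq hj hx) (not_le.2 hjx)

/-- The two omitted conditions are automatic: a crossed out number has no hue, and an unboxed number
has no matching one. -/
theorem mem_chainSet_iff (hD : P.IsDecoration D) (hM : P.IsMismatched D) {c : Fin m} {x : Fin n} :
    x ∈ P.chainSet D c ↔ P.color x = c ∧ x ∉ D.under ∧ P.HueMatches D x := by
  simp only [chainSet, Finset.mem_filter, Finset.mem_univ, true_and]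
  constructor
  · rintro ⟨_, h1, _, h2, h3⟩
    exact ⟨h1, h2, h3⟩
  · rintro ⟨h1, h2, h3⟩
    refine ⟨?_, h1, hD.notMem_crossed (hD.hue_mem_of_hueMatches h3), h2, h3⟩
    by_contra hx
    exact hM x hx h3

theorem mem_chainOrder_iff_of_hue (hD : P.IsDecoration D)
    (hM : P.IsMismatched D) {x b : Fin n} {B : Finset (Fin n)}
    (hx : D.hue x = B) (hb : b ∈ B) :
    x ∈ P.chainOrder D (P.color b) ↔ P.color x = P.color b ∧ x ∉ D.under := by
  rw [P.mem_chainOrder, hD.mem_chainSet_iff hM]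
  constructor
  · exact fun h => ⟨h.1, h.2.1⟩
  · rintro ⟨h1, h2⟩
    exact ⟨h1, h2, b, hx ▸ hb, h1.symm⟩

end IsDecoration

/-! ### The order of the permission lists -/

/-- The order in which the numbers appear in permission lists for the color `c`. -/
def PermissionBefore (P : ColoredExponents n m) (D : Marking n) (c : Fin m) (x y : Fin n) : Prop :=
  [x, y] <+ P.chainOrder D c ∨ (x ∈ P.chainOrder D c ∧ P.color y ≠ c) ∨
    (P.color x ≠ c ∧ P.color y ≠ c ∧ x < y)

theorem color_eq_of_mem_chainOrder {c : Fin m} {x : Fin n} (h : x ∈ P.chainOrder D c) :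
    P.color x = c := by
  rw [P.mem_chainOrder, chainSet, Finset.mem_filter] at h
  exact h.2.2.1

theorem mem_permissionList {c : Fin m} {S : Finset (Fin n)} {x : Fin n} :
    x ∈ P.permissionList D c S ↔ x ∈ S ∧ (x ∈ P.chainOrder D c ∨ P.color x ≠ c) := by
  simp only [permissionList, List.mem_append, List.mem_filter, decide_eq_true_eq, Finset.mem_sort,
    Finset.mem_filter]
  tauto

theorem nodup_permissionList {c : Fin m} {S : Finset (Fin n)} :
    (P.permissionList D c S).Nodup := by
  rw [permissionList, List.nodup_append]
  refine ⟨(P.nodup_chainOrder D c).filter _, Finset.sort_nodup _ _, ?_⟩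
  rintro x hx y hy rfl
  rw [Finset.mem_sort, Finset.mem_filter] at hy
  exact hy.2 (color_eq_of_mem_chainOrder (List.mem_filter.1 hx).1)

theorem pair_sublist_permissionList {c : Fin m} {S : Finset (Fin n)} {x y : Fin n} :
    [x, y] <+ P.permissionList D c S ↔ x ∈ S ∧ y ∈ S ∧ P.PermissionBefore D c x y := by
  rw [permissionList, List.pair_sublist_append_iff, List.pair_sublist_filter_iff,
    List.pair_sublist_iff_of_pairwise_lt (Finset.sortedLT_sort _).pairwise, PermissionBefore]
  simp only [List.mem_filter, decide_eq_true_eq, Finset.mem_sort, Finset.mem_filter]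
  tauto

theorem PermissionBefore.trans {c : Fin m} {x y z : Fin n} (h : P.PermissionBefore D c x y)
    (h' : P.PermissionBefore D c y z) : P.PermissionBefore D c x z := by
  rcases h with h | h | h <;> rcases h' with h' | h' | h'
  · exact Or.inl ((P.nodup_chainOrder D c).pair_sublist_trans h h')
  · exact Or.inr (Or.inl ⟨List.mem_left_of_pair_sublist h, h'.2⟩)
  · exact absurd (color_eq_of_mem_chainOrder (List.mem_right_of_pair_sublist h)) h'.1
  · exact absurd (color_eq_of_mem_chainOrder (List.mem_left_of_pair_sublist h')) h.2
  · exact absurd (color_eq_of_mem_chainOrder h'.1) h.2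
  · exact Or.inr (Or.inl ⟨h.1, h'.2.1⟩)
  · exact absurd (color_eq_of_mem_chainOrder (List.mem_left_of_pair_sublist h')) h.2.1
  · exact absurd (color_eq_of_mem_chainOrder h'.1) h.2.1
  · exact Or.inr (Or.inr ⟨h.1, h'.2.1, h.2.2.trans h'.2.2⟩)

theorem PermissionBefore.asymm {c : Fin m} {x y : Fin n} (h : P.PermissionBefore D c x y)
    (h' : P.PermissionBefore D c y x) : False := by
  rcases h with h | h | h <;> rcases h' with h' | h' | h'
  · exact (P.nodup_chainOrder D c).pair_sublist_asymm h h'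
  · exact h'.2 (color_eq_of_mem_chainOrder (List.mem_left_of_pair_sublist h))
  · exact h'.2.1 (color_eq_of_mem_chainOrder (List.mem_left_of_pair_sublist h))
  · exact h.2 (color_eq_of_mem_chainOrder (List.mem_left_of_pair_sublist h'))
  · exact h.2 (color_eq_of_mem_chainOrder h'.1)
  · exact h'.2.1 (color_eq_of_mem_chainOrder h.1)
  · exact h.1 (color_eq_of_mem_chainOrder (List.mem_right_of_pair_sublist h'))
  · exact h.2.1 (color_eq_of_mem_chainOrder h'.1)
  · exact h.2.2.asymm h'.2.2

theorem PermissionBefore.total {c : Fin m} {x y : Fin n}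
    (hx : x ∈ P.chainOrder D c ∨ P.color x ≠ c) (hy : y ∈ P.chainOrder D c ∨ P.color y ≠ c)
    (hxy : x ≠ y) : P.PermissionBefore D c x y ∨ P.PermissionBefore D c y x := by
  rcases hx with hx | hx <;> rcases hy with hy | hy
  · exact (List.pair_sublist_total hx hy hxy).imp Or.inl Or.inl
  · exact Or.inl (Or.inr (Or.inl ⟨hx, hy⟩))
  · exact Or.inr (Or.inr (Or.inl ⟨hy, hx⟩))
  · exact (lt_or_gt_of_ne hxy).imp (fun h => Or.inr (Or.inr ⟨hx, hy, h⟩))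
      (fun h => Or.inr (Or.inr ⟨hy, hx, h⟩))

/-- The number `r` is the first number of hue `H` in the number chain order of the color `c`. -/
def IsFirstOfHue (P : ColoredExponents n m) (D : Marking n) (c : Fin m) (H : Finset (Fin n))
    (r : Fin n) : Prop :=
  r ∈ P.chainOrder D c ∧ D.hue r = H ∧ ∀ x, [x, r] <+ P.chainOrder D c → D.hue x ≠ H

theorem find?_eq_some_iff {c : Fin m} {H : Finset (Fin n)} {r : Fin n} :
    (P.chainOrder D c).find? (fun i => D.hue i = H) = some r ↔ P.IsFirstOfHue D c H r := by
  rw [(P.nodup_chainOrder D c).find?_eq_some_iff]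
  simp [IsFirstOfHue]

theorem mem_permissionSet {t : Fin n} {B : Finset (Fin n)} {r x : Fin n} :
    x ∈ P.permissionSet D t B r ↔ x ∉ D.under ∧ (D.hue x = {t} ∨ D.hue x = B) ∧ x ≠ r ∧
      ¬ ([x, r] <+ P.chainOrder D (P.color t) ∧ (D.hue x).min = r) := by
  rw [permissionSet, Finset.mem_filter, P.precedesInChain_iff]
  simp

theorem hasPermission_iff {t : Fin n} {B : Finset (Fin n)} :
    P.HasPermission D t B ↔ ∃ r, P.WantsToMerge D t B r ∧
      P.IsFirstOfHue D (P.color t) {t} r ∧ ∀ x ∈ P.permissionSet D t B r,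
        ∀ y ∈ P.permissionSet D t B r, P.PermissionBefore D (P.color t) x y →
          ¬ (D.hue x = {t} ∧ D.hue y = B) := by
  simp only [HasPermission, find?_eq_some_iff, List.pairwise_iff_forall_sublist,
    pair_sublist_permissionList]
  refine exists_congr fun r => and_congr_right fun _ => and_congr_right fun _ => ?_
  exact ⟨fun h x hx y hy hxy => h ⟨hx, hy, hxy⟩, fun h x y hxy => h x hxy.1 y hxy.2.1 hxy.2.2⟩

theorem IsFirstOfHue.unique {c : Fin m} {H : Finset (Fin n)} {r r' : Fin n}
    (h : P.IsFirstOfHue D c H r) (h' : P.IsFirstOfHue D c H r') : r = r' :=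
  Option.some_injective _ ((find?_eq_some_iff.2 h).symm.trans (find?_eq_some_iff.2 h'))

/-- The number `r` is determined as the first number of hue $\{t\}$, and `B` as the hue that
contains it. -/
theorem IsDecoration.hasPermission_unique (hD : P.IsDecoration D) {t : Fin n}
    {B B' : Finset (Fin n)} (h : P.HasPermission D t B) (h' : P.HasPermission D t B') :
    B = B' := by
  obtain ⟨r, hw, hf, _⟩ := hasPermission_iff.1 h
  obtain ⟨r', hw', hf', _⟩ := hasPermission_iff.1 h'
  obtain rfl := hf.unique hf'
  exact hD.eq_of_mem hw.2.1 hw'.2.1 (Finset.mem_of_min hw.2.2.1) (Finset.mem_of_min hw'.2.2.1)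

/-! ### Merging -/

section Merge

variable {E : Marking n} {t r : Fin n} {B : Finset (Fin n)}

theorem WantsToMerge.mem (hw : P.WantsToMerge E t B r) : r ∈ B := Finset.mem_of_min hw.2.2.1

theorem WantsToMerge.le (hw : P.WantsToMerge E t B r) {x : Fin n} (hx : x ∈ B) : r ≤ x :=
  Finset.min_le_of_eq hx hw.2.2.1

theorem WantsToMerge.lt (hw : P.WantsToMerge E t B r) : t < r := hw.2.2.2.2.1

theorem WantsToMerge.hue_eq (hw : P.WantsToMerge E t B r) : E.hue r = {t} := hw.2.2.2.2.2

theorem WantsToMerge.notMem (hw : P.WantsToMerge E t B r) : t ∉ B :=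
  fun h => absurd (hw.le h) (not_le.2 hw.lt)

theorem WantsToMerge.ne_singleton (hw : P.WantsToMerge E t B r) : B ≠ {t} :=
  fun h => hw.notMem (h ▸ Finset.mem_singleton_self t)

theorem WantsToMerge.min_insert (hw : P.WantsToMerge E t B r) :
    (insert t B).min = (t : WithTop (Fin n)) := by
  rw [Finset.min_insert, hw.2.2.1]
  exact min_eq_left (WithTop.coe_le_coe.2 hw.lt.le)

theorem WantsToMerge.min_eq_iff (hw : P.WantsToMerge E t B r) {x : Fin n} :
    B.min = (x : WithTop (Fin n)) ↔ x = r := by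
  rw [hw.2.2.1, WithTop.coe_inj, eq_comm]

theorem WantsToMerge.mem_under_mergeWith (hw : P.WantsToMerge E t B r) {x : Fin n} :
    x ∈ (mergeWith E t B).under ↔ x ∈ E.under ∨ x = r := by
  simp only [mergeWith, Finset.mem_union, Finset.mem_filter, hw.min_eq_iff]
  constructor
  · rintro (h | h)
    · exact Or.inl h
    · exact Or.inr h.2
  · rintro (h | rfl)
    · exact Or.inl h
    · exact Or.inr ⟨hw.mem, rfl⟩

theorem hue_mergeWith (x : Fin n) : (mergeWith E t B).hue x =
    if E.hue x = {t} ∨ E.hue x = B then insert t B else E.hue x := rfl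

theorem hue_mergeWith_eq_of_ne {H : Finset (Fin n)} (h1 : H ≠ {t}) (h2 : H ≠ B)
    (h3 : H ≠ insert t B) {x : Fin n} : (mergeWith E t B).hue x = H ↔ E.hue x = H := by
  rw [hue_mergeWith]
  split_ifs with h
  · constructor
    · exact fun h' => absurd h'.symm h3
    · rintro rfl
      tauto
  · rfl

theorem mem_hues_mergeWith {H : Finset (Fin n)} :
    H ∈ (mergeWith E t B).hues ↔ H = insert t B ∨ (H ∈ E.hues ∧ H ≠ {t} ∧ H ≠ B) := by
  simp only [mergeWith, Finset.mem_insert, Finset.mem_erase]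
  tauto

theorem WantsToMerge.insert_notMem (hE : P.IsDecoration E)
    (hw : P.WantsToMerge E t B r) : insert t B ∉ E.hues := by
  intro h
  refine hw.ne_singleton ?_
  rw [hE.eq_of_mem hw.2.1 h hw.mem (Finset.mem_insert_of_mem hw.mem)]
  exact hE.eq_of_mem h hw.1 (Finset.mem_insert_self t B) (Finset.mem_singleton_self t)

theorem WantsToMerge.hue_ne_insert (hE : P.IsDecoration E)
    (hw : P.WantsToMerge E t B r) (x : Fin n) : E.hue x ≠ insert t B := by
  intro h
  by_cases hx : x ∈ P.crossed
  · rw [hE.hue_crossed x hx] at h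
    exact Finset.insert_ne_empty t B h.symm
  · exact hw.insert_notMem hE (h ▸ hE.hue_mem x hx)

theorem WantsToMerge.hue_mergeWith_eq_insert (hE : P.IsDecoration E)
    (hw : P.WantsToMerge E t B r) {x : Fin n} :
    (mergeWith E t B).hue x = insert t B ↔ E.hue x = {t} ∨ E.hue x = B := by
  rw [hue_mergeWith]
  split_ifs with h
  · simp [h]
  · simp [h, hw.hue_ne_insert hE x]

theorem WantsToMerge.color_eq (hE : P.IsDecoration E)
    (hw : P.WantsToMerge E t B r) {b : Fin n} (hb : b ∈ B) : P.color b = P.color t := by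
  rw [← hw.2.2.2.1]
  exact hE.hues_monochromatic B hw.2.1 b hb r hw.mem

theorem WantsToMerge.hueMatches_mergeWith (hE : P.IsDecoration E)
    (hw : P.WantsToMerge E t B r) {x : Fin n} :
    P.HueMatches (mergeWith E t B) x ↔ P.HueMatches E x := by
  by_cases h : E.hue x = {t} ∨ E.hue x = B
  · have h1 : P.HueMatches E x ↔ P.color t = P.color x := by
      rcases h with h | h
      · rw [hE.hueMatches_iff (h ▸ hw.1) (by rw [h]; exact Finset.mem_singleton_self t)]
      · rw [hE.hueMatches_iff (h ▸ hw.2.1) (by rw [h]; exact hw.mem), hw.2.2.2.1]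
    rw [h1, HueMatches, hue_mergeWith, if_pos h]
    simp only [Finset.mem_insert, exists_eq_or_imp]
    constructor
    · rintro (h2 | ⟨b, hb, h2⟩)
      · exact h2
      · rw [← h2, hw.color_eq hE hb]
    · exact Or.inl
  · rw [HueMatches, HueMatches, hue_mergeWith, if_neg h]

theorem WantsToMerge.isMismatched_mergeWith (hE : P.IsDecoration E)
    (hM : P.IsMismatched E) (hw : P.WantsToMerge E t B r) : P.IsMismatched (mergeWith E t B) :=
  fun i hi h => hM i hi ((hw.hueMatches_mergeWith hE).1 h)

/-- The only element of `B` that becomes non-minimal is `r`, and it acquires the merged hue because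
it had hue $\{t\}$. Permission is not needed here. -/
theorem WantsToMerge.isDecoration_mergeWith (hE : P.IsDecoration E)
    (hM : P.IsMismatched E) (hw : P.WantsToMerge E t B r) : P.IsDecoration (mergeWith E t B) where
  hues_nonempty H hH := by
    rcases mem_hues_mergeWith.1 hH with rfl | h
    · exact Finset.insert_nonempty t B
    · exact hE.hues_nonempty H h.1
  hues_disjoint := by
    have key : ∀ H ∈ E.hues, H ≠ {t} → H ≠ B → Disjoint (insert t B) H := by
      intro H hH h1 h2
      rw [Finset.disjoint_insert_left]
      refine ⟨fun ht => h1 (hE.eq_of_mem hH hw.1 ht (Finset.mem_singleton_self t)),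
        hE.hues_disjoint B hw.2.1 H hH h2.symm⟩
    intro H hH H' hH' hne
    rcases mem_hues_mergeWith.1 hH with rfl | h <;>
      rcases mem_hues_mergeWith.1 hH' with rfl | h'
    · exact absurd rfl hne
    · exact key H' h'.1 h'.2.1 h'.2.2
    · exact (key H h.1 h.2.1 h.2.2).symm
    · exact hE.hues_disjoint H h.1 H' h'.1 hne
  hues_union := by
    ext i
    rw [hE.mem_boxed_iff, Finset.mem_biUnion]
    simp only [mem_hues_mergeWith, id]
    constructor
    · rintro ⟨H, rfl | h, hi⟩
      · rcases Finset.mem_insert.1 hi with rfl | hi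
        · exact ⟨{i}, hw.1, Finset.mem_singleton_self i⟩
        · exact ⟨B, hw.2.1, hi⟩
      · exact ⟨H, h.1, hi⟩
    · rintro ⟨H, hH, hi⟩
      by_cases h1 : H = {t}
      · subst h1
        exact ⟨insert t B, Or.inl rfl, by rw [Finset.mem_singleton.1 hi]; exact Finset.mem_insert_self t B⟩
      by_cases h2 : H = B
      · exact ⟨insert t B, Or.inl rfl, Finset.mem_insert_of_mem (h2 ▸ hi)⟩
      exact ⟨H, Or.inr ⟨hH, h1, h2⟩, hi⟩
  hues_monochromatic H hH := by
    rcases mem_hues_mergeWith.1 hH with rfl | h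
    · have : ∀ i ∈ insert t B, P.color i = P.color t := by
        intro i hi
        rcases Finset.mem_insert.1 hi with rfl | hi
        · rfl
        · exact hw.color_eq hE hi
      intro i hi j hj
      rw [this i hi, this j hj]
    · exact hE.hues_monochromatic H h.1
  hue_crossed i hi := by
    rw [hue_mergeWith, hE.hue_crossed i hi, if_neg]
    rintro (h | h)
    · exact Finset.singleton_ne_empty t h.symm
    · exact (hE.hues_nonempty B hw.2.1).ne_empty h.symm
  hue_mem i hi := by
    rw [mem_hues_mergeWith, hue_mergeWith]
    split_ifs with h
    · exact Or.inl rfl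
    · rw [not_or] at h
      exact Or.inr ⟨hE.hue_mem i hi, h⟩
  hue_block H hH i hi hj := by
    rcases mem_hues_mergeWith.1 hH with rfl | h
    · rw [hw.hue_mergeWith_eq_insert hE]
      obtain ⟨j, hj, hji⟩ := hj
      have hiB : i ∈ B := by
        rcases Finset.mem_insert.1 hi with rfl | hi
        · rcases Finset.mem_insert.1 hj with rfl | hj
          · exact absurd hji (lt_irrefl _)
          · exact absurd (hw.lt.trans_le (hw.le hj)) hji.asymm
        · exact hi
      by_cases hir : i = r
      · exact Or.inl (hir ▸ hw.hue_eq)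
      · exact Or.inr (hE.hue_block B hw.2.1 i hiB
          ⟨r, hw.mem, lt_of_le_of_ne (hw.le hiB) (Ne.symm hir)⟩)
    · rw [hue_mergeWith_eq_of_ne h.2.1 h.2.2 fun h' => hw.insert_notMem hE (h' ▸ h.1)]
      exact hE.hue_block H h.1 i hi hj
  hue_card H hH := by
    rcases mem_hues_mergeWith.1 hH with rfl | h
    · simp only [hw.hue_mergeWith_eq_insert hE]
      rw [Finset.filter_or, Finset.card_union_of_disjoint, hE.hue_card _ hw.1,
        hE.hue_card _ hw.2.1, kSum, kSum, kSum, Finset.sum_insert hw.notMem,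
        Finset.sum_singleton]
      rw [Finset.disjoint_filter]
      intro x _ h1 h2
      exact hw.ne_singleton (h2.symm.trans h1)
    · rw [← hE.hue_card H h.1]
      congr 1
      ext x
      simp only [Finset.mem_filter,
        hue_mergeWith_eq_of_ne h.2.1 h.2.2 fun h' => hw.insert_notMem hE (h' ▸ h.1)]
  under_boxed i hi := by
    rw [hw.mem_under_mergeWith, hE.mem_under_iff hM]
    simp only [mem_hues_mergeWith]
    constructor
    · rintro (⟨H, hH, hiH, j, hj, hji⟩ | rfl)
      · have h1 : H ≠ {t} := by
          rintro rfl
          rw [Finset.mem_singleton] at hiH hj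
          exact hji.ne (hj.trans hiH.symm)
        by_cases h2 : H = B
        · subst h2
          exact ⟨_, Or.inl rfl, Finset.mem_insert_of_mem hiH, j, Finset.mem_insert_of_mem hj, hji⟩
        · exact ⟨H, Or.inr ⟨hH, h1, h2⟩, hiH, j, hj, hji⟩
      · exact ⟨_, Or.inl rfl, Finset.mem_insert_of_mem hw.mem, t, Finset.mem_insert_self t B, hw.lt⟩
    · rintro ⟨H, rfl | h, hiH, j, hj, hji⟩
      · have hiB : i ∈ B := by
          rcases Finset.mem_insert.1 hiH with rfl | hi
          · rcases Finset.mem_insert.1 hj with rfl | hj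
            · exact absurd hji (lt_irrefl _)
            · exact absurd (hw.lt.trans_le (hw.le hj)) hji.asymm
          · exact hi
        by_cases hir : i = r
        · exact Or.inr hir
        · exact Or.inl ⟨B, hw.2.1, hiB, r, hw.mem, lt_of_le_of_ne (hw.le hiB) (Ne.symm hir)⟩
      · exact Or.inl ⟨H, h.1, hiH, j, hj, hji⟩
  under_unboxed i hi h := by
    rcases hw.mem_under_mergeWith.1 h with h | rfl
    · exact absurd (hE.under_unboxed i hi h) (hM i hi)
    · exact absurd (hE.boxed_of_mem hw.2.1 hw.mem) hi

theorem WantsToMerge.notMem_under (hE : P.IsDecoration E)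
    (hM : P.IsMismatched E) (hw : P.WantsToMerge E t B r) : r ∉ E.under := hE.min_notMem_under hM hw.2.1 hw.2.2.1

theorem WantsToMerge.mem_chainOrder (hE : P.IsDecoration E)
    (hM : P.IsMismatched E) (hw : P.WantsToMerge E t B r) : r ∈ P.chainOrder E (P.color t) := by
  rw [hE.mem_chainOrder_iff_of_hue hM hw.hue_eq (Finset.mem_singleton_self t)]
  exact ⟨hw.2.2.2.1, hw.notMem_under hE hM⟩

theorem WantsToMerge.chainSet_mergeWith (hE : P.IsDecoration E)
    (hM : P.IsMismatched E) (hw : P.WantsToMerge E t B r) (c : Fin m) :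
    P.chainSet (mergeWith E t B) c = (P.chainSet E c).erase r := by
  ext x
  rw [Finset.mem_erase, hE.mem_chainSet_iff hM, (hw.isDecoration_mergeWith hE hM).mem_chainSet_iff
    (hw.isMismatched_mergeWith hE hM), hw.mem_under_mergeWith, hw.hueMatches_mergeWith hE]
  tauto

/-- The numbers of hue `B` change their target from `r` to `t`, all other targets stay, and `r`
leaves the chain set by being underlined. This is the contraction of the edge from `r` to `t`. -/
theorem WantsToMerge.chainOrder_mergeWith (hE : P.IsDecoration E)
    (hM : P.IsMismatched E) (hw : P.WantsToMerge E t B r) (c : Fin m) :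
    P.chainOrder (mergeWith E t B) c = (P.chainOrder E c).filter (· ≠ r) := by
  have hg : ∀ x ∈ P.chainOrder E c,
      (((mergeWith E t B).hue x).min = (E.hue x).min ∧ (E.hue x).min ≠ r) ∨
        ((E.hue x).min = r ∧ ((mergeWith E t B).hue x).min = t ∧ E.hue x = B) := by
    intro x hx
    rw [P.mem_chainOrder, hE.mem_chainSet_iff hM] at hx
    have hxh := hE.hue_mem_of_hueMatches hx.2.2
    rw [hue_mergeWith]
    by_cases h1 : E.hue x = B
    · right
      rw [if_pos (Or.inr h1), hw.min_insert]
      exact ⟨h1 ▸ hw.2.2.1, rfl, h1⟩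
    · left
      constructor
      · split_ifs with h
        · rw [hw.min_insert, h.resolve_right h1, Finset.min_singleton]
        · rfl
      · intro h
        exact h1 (hE.eq_of_mem hxh hw.2.1 (Finset.mem_of_min h) hw.mem)
  refine (P.isWalk_chainOrder _ c).eq_of_mem_iff ?_ fun x => ?_
  · by_cases hr : r ∈ P.chainOrder E c
    · refine (P.isWalk_chainOrder E c).filter_ne hw.lt (by rw [hw.hue_eq, Finset.min_singleton])
        (fun x hx _ => (hg x hx).imp_right fun h => ⟨h.1, h.2.1⟩) hr (Or.inl ⟨rfl, by simp⟩)
    -- If `r` is not listed, the color is a different one; no listed number has hue `B`, and no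
    -- target changes.
    · rw [List.filter_eq_self.2]
      · refine (P.isWalk_chainOrder E c).congr fun x hx => ?_
        rcases hg x hx with h | h
        · exact h.1
        · exfalso
          apply hr
          have hxs := hx
          rw [P.mem_chainOrder, hE.mem_chainSet_iff hM,
            hE.hueMatches_iff (h.2.2 ▸ hw.2.1) (h.2.2 ▸ hw.mem), hw.2.2.2.1] at hxs
          rw [← hxs.1, ← hxs.2.2]
          exact hw.mem_chainOrder hE hM
      · intro x hx
        simp only [ne_eq, decide_not, Bool.not_eq_eq_eq_not, Bool.not_true, decide_eq_false_iff_not]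
        rintro rfl
        exact hr hx
  · rw [P.mem_chainOrder, hw.chainSet_mergeWith hE hM, List.mem_filter, P.mem_chainOrder,
      Finset.mem_erase]
    simp only [ne_eq, decide_not, Bool.not_eq_eq_eq_not, Bool.not_true, decide_eq_false_iff_not]
    tauto

end Merge

end ColoredExponents

/-! ### What a merge does to the data of a split and to other permissions -/

namespace ColoredExponents

variable {n m : ℕ} {P : ColoredExponents n m} {E : Marking n} {t r : Fin n} {B : Finset (Fin n)}

theorem IsDecoration.notMem_under_of_hue_eq_singleton (hE : P.IsDecoration E)
    (hM : P.IsMismatched E) {x : Fin n} (hx : E.hue x = {t}) : x ∉ E.under := by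
  rw [hE.mem_under_iff hM]
  rintro ⟨H, hH, hxH, j, hj, hjx⟩
  have := hE.hue_block H hH x hxH ⟨j, hj, hjx⟩
  rw [← this, hx, Finset.mem_singleton] at hxH hj
  exact hjx.ne (hj.trans hxH.symm)

theorem IsDecoration.mem_chainOrder_or_color_ne (hE : P.IsDecoration E) (hM : P.IsMismatched E)
    {x b : Fin n} (hb : b ∈ E.hue x) (hx : x ∉ E.under) :
    x ∈ P.chainOrder E (P.color b) ∨ P.color x ≠ P.color b := by
  rw [hE.mem_chainOrder_iff_of_hue hM rfl hb]
  tauto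

theorem permissionBefore_iff_of_mem {D : Marking n} {c : Fin m} {x y : Fin n}
    (hy : y ∈ P.chainOrder D c) :
    P.PermissionBefore D c x y ↔ [x, y] <+ P.chainOrder D c := by
  have := color_eq_of_mem_chainOrder hy
  rw [PermissionBefore]
  tauto

/-- In a permission list the numbers of other colors come after the chain members, so being first in
chain order means being first altogether. -/
theorem IsFirstOfHue.permissionBefore (hE : P.IsDecoration E) (hM : P.IsMismatched E) {x : Fin n}
    (hf : P.IsFirstOfHue E (P.color t) {t} r) (hx : E.hue x = {t}) (hxr : x ≠ r) :
    P.PermissionBefore E (P.color t) r x := by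
  refine (PermissionBefore.total (Or.inl hf.1) (hE.mem_chainOrder_or_color_ne hM
    (by rw [hx]; exact Finset.mem_singleton_self t)
    (hE.notMem_under_of_hue_eq_singleton hM hx)) hxr.symm).resolve_right fun h => ?_
  rw [permissionBefore_iff_of_mem hf.1] at h
  exact hf.2.2 x h hx

theorem WantsToMerge.pair_sublist_mergeWith (hE : P.IsDecoration E) (hM : P.IsMismatched E)
    (hw : P.WantsToMerge E t B r) {c : Fin m} {x y : Fin n} :
    [x, y] <+ P.chainOrder (mergeWith E t B) c ↔ [x, y] <+ P.chainOrder E c ∧ x ≠ r ∧ y ≠ r := by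
  rw [hw.chainOrder_mergeWith hE hM, List.pair_sublist_filter_iff]
  simp

theorem WantsToMerge.mem_chainOrder_mergeWith (hE : P.IsDecoration E) (hM : P.IsMismatched E)
    (hw : P.WantsToMerge E t B r) {c : Fin m} {x : Fin n} :
    x ∈ P.chainOrder (mergeWith E t B) c ↔ x ∈ P.chainOrder E c ∧ x ≠ r := by
  rw [hw.chainOrder_mergeWith hE hM, List.mem_filter]
  simp

theorem WantsToMerge.permissionBefore_mergeWith (hE : P.IsDecoration E) (hM : P.IsMismatched E)
    (hw : P.WantsToMerge E t B r) {c : Fin m} {x y : Fin n} (hx : x ≠ r) (hy : y ≠ r) :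
    P.PermissionBefore (mergeWith E t B) c x y ↔ P.PermissionBefore E c x y := by
  rw [PermissionBefore, PermissionBefore, hw.pair_sublist_mergeWith hE hM,
    hw.mem_chainOrder_mergeWith hE hM]
  tauto

theorem WantsToMerge.hue_eq_of_min_eq (hE : P.IsDecoration E) (hw : P.WantsToMerge E t B r)
    {x : Fin n} (hx : (E.hue x).min = r) : E.hue x = B := by
  have hr := Finset.mem_of_min hx
  refine hE.eq_of_mem (hE.hue_mem x fun h => ?_) hw.2.1 hr hw.mem
  rw [hE.hue_crossed x h] at hr
  simp at hr

/-- After merging, the number that the split procedure singles out is the predecessor of `r`. -/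
theorem WantsToMerge.splitQ_mergeWith (hE : P.IsDecoration E) (hM : P.IsMismatched E)
    (hw : P.WantsToMerge E t B r) (hf : P.IsFirstOfHue E (P.color t) {t} r) {q : Fin n} :
    P.splitQ (mergeWith E t B) (P.color t) (insert t B) B = some q ↔
      [q, r] <+ P.chainOrder E (P.color t) ∧ (E.hue q).min = r := by
  have hwalk := P.isWalk_chainOrder E (P.color t)
  have hnd := hwalk.nodup
  have hmin : ∀ z, E.hue z ≠ {t} → E.hue z ≠ B → (mergeWith E t B).hue z = E.hue z := by
    intro z h1 h2
    rw [hue_mergeWith, if_neg (not_or.2 ⟨h1, h2⟩)]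
  -- Let `q` precede `r` in its chain. A number of the merged hue before `q` had hue $\{t\}$,
  -- although `r` is the first such number, or hue `B`, and then it would be a second predecessor of
  -- `r`.
  have back : ∀ {q}, [q, r] <+ P.chainOrder E (P.color t) → (E.hue q).min = r →
      P.splitQ (mergeWith E t B) (P.color t) (insert t B) B = some q := by
    intro q hq hqr
    have hqne : q ≠ r := hnd.pair_sublist_ne hq
    have hqB : E.hue q = B := hw.hue_eq_of_min_eq hE hqr
    have hqN : (mergeWith E t B).hue q = insert t B :=
      (hw.hue_mergeWith_eq_insert hE).2 (Or.inr hqB)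
    have hqD : q ∈ P.chainOrder (mergeWith E t B) (P.color t) :=
      (hw.mem_chainOrder_mergeWith hE hM).2 ⟨List.mem_left_of_pair_sublist hq, hqne⟩
    rw [splitQ, if_pos, find?_eq_some_iff]
    · refine ⟨hqD, hqN, fun x hx hxN => ?_⟩
      have hxE := ((hw.pair_sublist_mergeWith hE hM).1 hx).1
      have hxr := hnd.pair_sublist_trans hxE hq
      rcases (hw.hue_mergeWith_eq_insert hE).1 hxN with h | h
      · exact hf.2.2 x hxr h
      · exact hnd.pair_sublist_ne hxE
          (hwalk.pred_unique hxr (by rw [h]; exact hw.2.2.1) hq hqr)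
    -- A chain head `s` at or before `q` was a chain head before the merge as well: among the
    -- numbers before `r` only those of hue `B` change their target, and their old target is `r`.
    -- Since `s` stands before `r`, it is smaller.
    · rw [P.exists_chain_iff]
      refine ⟨q, hqD, hqN, fun s hs hst => ?_⟩
      rw [hw.2.2.1, WithTop.coe_lt_coe]
      have hsr : [s, r] <+ P.chainOrder E (P.color t) := by
        rcases hs with rfl | hs
        · exact hq
        · exact hnd.pair_sublist_trans ((hw.pair_sublist_mergeWith hE hM).1 hs).1 hq
      refine hwalk.lt_of_no_pred (by simp) (fun z hz hzs => ?_) hsr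
      have hzr := hnd.pair_sublist_trans hz hsr
      refine hst z ((hw.pair_sublist_mergeWith hE hM).2
        ⟨hz, hnd.pair_sublist_ne hzr, hnd.pair_sublist_ne hsr⟩) ?_
      rw [hmin z (hf.2.2 z hzr) fun h => ?_]
      · exact hzs
      · rw [h, hw.2.2.1, WithTop.coe_inj] at hzs
        exact hnd.pair_sublist_ne hsr hzs.symm
  refine ⟨fun hq => ?_, fun hq => back hq.1 hq.2⟩
  by_cases hp : ∃ p, [p, r] <+ P.chainOrder E (P.color t) ∧ (E.hue p).min = r
  · obtain ⟨p, hp1, hp2⟩ := hp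
    obtain rfl : p = q := Option.some_injective _ ((back hp1 hp2).symm.trans hq)
    exact ⟨hp1, hp2⟩
  -- Now `r` opened a chain, so it is smaller than the number `s` listed after it. The target `t` of
  -- `r` is less than `r`, so `s` opens a chain too and remains a head after the merge. All numbers
  -- of the merged hue stand at or after `s`, so none lies in a chain with head below `r`.
  · exfalso
    push Not at hp
    rw [splitQ] at hq
    split_ifs at hq with hcond
    obtain ⟨x, hx, hxN, hs⟩ := P.exists_chain_iff.1 hcond
    rw [hw.mem_chainOrder_mergeWith hE hM] at hx
    have hrx : [r, x] <+ P.chainOrder E (P.color t) := by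
      refine (List.pair_sublist_total hf.1 hx.1 hx.2.symm).resolve_right fun h => ?_
      rcases (hw.hue_mergeWith_eq_insert hE).1 hxN with h1 | h1
      · exact hf.2.2 x h h1
      · exact hp x h (by rw [h1]; exact hw.2.2.1)
    obtain ⟨A, C, hAC, hxC⟩ := List.pair_sublist_iff_append.1 hrx
    obtain ⟨s, C, rfl⟩ := List.exists_cons_of_ne_nil (List.ne_nil_of_mem hxC)
    have hrs : [r, s] <+ P.chainOrder E (P.color t) :=
      List.pair_sublist_iff_append.2 ⟨A, s :: C, hAC, by simp⟩
    have hlt : r < s := hwalk.lt_of_no_pred (by simp) hp hrs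
    have hsx : s = x ∨ [s, x] <+ P.chainOrder E (P.color t) := by
      rcases List.mem_cons.1 hxC with h | h
      · exact Or.inl h.symm
      · exact Or.inr (List.pair_sublist_iff_append.2 ⟨A ++ [r], C, by simp [hAC], h⟩)
    have hpred : ∀ z, [z, s] <+ P.chainOrder E (P.color t) → (E.hue z).min ≠ s := by
      intro z hz hzs
      by_cases hzr : z = r
      · subst hzr
        rw [hw.hue_eq, Finset.min_singleton, WithTop.coe_inj] at hzs
        exact hlt.asymm (hzs ▸ hw.lt)
      · have hzA : [z, r] <+ P.chainOrder E (P.color t) := by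
          refine (List.pair_sublist_total (List.mem_left_of_pair_sublist hz) hf.1
            hzr).resolve_right fun h => ?_
          have hnd' := hnd
          rw [hAC] at h hz hnd'
          rw [List.nodup_append, List.nodup_cons, List.nodup_cons] at hnd'
          simp only [List.pair_sublist_append_iff, List.pair_sublist_cons_iff] at h hz
          have hrA : r ∉ A := fun h0 => hnd'.2.2 r h0 r (by simp) rfl
          have hsA : s ∉ A := fun h0 => hnd'.2.2 s h0 s (by simp) rfl
          have hsC := hnd'.2.1.2.1
          rcases hz with h1 | h1 | h1 | h1 | h1
          · exact hsA (List.mem_right_of_pair_sublist h1)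
          · rcases h with h2 | h2 | h2 | h2 | h2
            · exact hrA (List.mem_left_of_pair_sublist h2)
            · exact hrA h2.1
            · exact hnd'.2.2 z h1.1 z (List.mem_cons_of_mem _ h2.2) rfl
            · exact hnd'.2.2 z h1.1 z (by simp [h2.2]) rfl
            · exact hnd'.2.2 z h1.1 z (by simp [List.mem_right_of_pair_sublist h2]) rfl
          · exact hzr h1.1
          · exact hsC h1.2
          · exact hsC (List.mem_right_of_pair_sublist h1)
        rcases hwalk.eq_or_pair_sublist_of_target_mem hz hzs hzA with h | h
        · exact hlt.ne h
        · exact hnd.pair_sublist_asymm h hrs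
    have hslt : (s : WithTop (Fin n)) < B.min := by
      refine hs s (hsx.imp_right fun h => (hw.pair_sublist_mergeWith hE hM).2
        ⟨h, hlt.ne', hx.2⟩) fun z hz hzs => ?_
      have hzE := (hw.pair_sublist_mergeWith hE hM).1 hz
      rw [hue_mergeWith] at hzs
      split_ifs at hzs
      · rw [hw.min_insert, WithTop.coe_inj] at hzs
        exact hlt.asymm (hzs ▸ hw.lt)
      · exact hpred z hzE.1 hzs
    rw [hw.2.2.1, WithTop.coe_lt_coe] at hslt
    exact hlt.asymm hslt

/-- Merging `{t}` and `B` does not affect permissions between two other hues. -/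
theorem WantsToMerge.hasPermission_mergeWith_iff (hE : P.IsDecoration E) (hM : P.IsMismatched E)
    (hw : P.WantsToMerge E t B r) {t' : Fin n} {H : Finset (Fin n)} (ht' : {t'} ∈ E.hues)
    (hH : H ∈ E.hues) (h1 : ({t'} : Finset (Fin n)) ≠ {t}) (h2 : {t'} ≠ B) (h3 : H ≠ {t})
    (h4 : H ≠ B) : P.HasPermission (mergeWith E t B) t' H ↔ P.HasPermission E t' H := by
  have hue_t' : ∀ x, (mergeWith E t B).hue x = {t'} ↔ E.hue x = {t'} := fun x =>
    hue_mergeWith_eq_of_ne h1 h2 fun h => hw.insert_notMem hE (h ▸ ht')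
  have hue_H : ∀ x, (mergeWith E t B).hue x = H ↔ E.hue x = H := fun x =>
    hue_mergeWith_eq_of_ne h3 h4 fun h => hw.insert_notMem hE (h ▸ hH)
  have hne : ∀ x, E.hue x = {t'} ∨ E.hue x = H → x ≠ r := by
    rintro x hx rfl
    rw [hw.hue_eq] at hx
    exact hx.elim (fun h => h1 h.symm) (fun h => h3 h.symm)
  rw [hasPermission_iff, hasPermission_iff]
  refine exists_congr fun r' => ?_
  have hwiff : P.WantsToMerge (mergeWith E t B) t' H r' ↔ P.WantsToMerge E t' H r' := by
    simp only [WantsToMerge, mem_hues_mergeWith, hue_t']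
    tauto
  rw [hwiff]
  refine and_congr_right fun hw' => ?_
  have hr' : r' ≠ r := by
    rintro rfl
    exact h4 (hE.eq_of_mem hH hw.2.1 hw'.mem hw.mem)
  have hfirst : P.IsFirstOfHue (mergeWith E t B) (P.color t') {t'} r' ↔
      P.IsFirstOfHue E (P.color t') {t'} r' := by
    simp only [IsFirstOfHue, hw.mem_chainOrder_mergeWith hE hM, hw.pair_sublist_mergeWith hE hM,
      hue_t']
    constructor
    · rintro ⟨h5, h6, h7⟩
      exact ⟨h5.1, h6, fun x hx hxt => h7 x ⟨hx, hne x (Or.inl hxt), hr'⟩ ((hue_t' x).2 hxt)⟩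
    · rintro ⟨h5, h6, h7⟩
      exact ⟨⟨h5, hr'⟩, h6, fun x hx hxt => h7 x hx.1 ((hue_t' x).1 hxt)⟩
  rw [hfirst]
  refine and_congr_right fun _ => ?_
  have hset : P.permissionSet (mergeWith E t B) t' H r' = P.permissionSet E t' H r' := by
    ext x
    rw [mem_permissionSet, mem_permissionSet, hue_t', hue_H, hw.mem_under_mergeWith,
      hw.pair_sublist_mergeWith hE hM]
    by_cases hx : E.hue x = {t'} ∨ E.hue x = H
    · have : (mergeWith E t B).hue x = E.hue x := by
        rcases hx with h | h
        · rw [h, hue_t', h]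
        · rw [h, hue_H, h]
      rw [this]
      have := hne x hx
      tauto
    · tauto
  rw [hset]
  refine forall₂_congr fun x hx => forall₂_congr fun y hy => ?_
  rw [hw.permissionBefore_mergeWith hE hM (hne x (mem_permissionSet.1 hx).2.1)
    (hne y (mem_permissionSet.1 hy).2.1), hue_t', hue_H]

/-- This is where the weak monotonicity of the exponents within a color enters. -/
theorem IsDecoration.k_le_of_lt (hE : P.IsDecoration E) {t' : Fin n} (ht : {t} ∈ E.hues)
    (htt : t' < t) (hc : P.color t = P.color t') : P.k t' ≤ P.k t :=
  (P.k_sorted t' t htt hc.symm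
    (mem_boxed.1 (hE.boxed_of_mem ht (Finset.mem_singleton_self t)))).2

theorem IsDecoration.card_hue_singleton (hE : P.IsDecoration E) (ht : {t} ∈ E.hues) :
    (Finset.univ.filter fun x => E.hue x = {t}).card = P.k t := by
  rw [hE.hue_card _ ht, kSum, Finset.sum_singleton]

/-- No candidate below `t` is created. The new case is a permission to merge with $\{t\}\cup B$,
whose minimum `t` must have hue $\{t'\}$; then $\{t'\}$ had permission to merge with $\{t\}$ before.
-/
theorem WantsToMerge.hasPermission_of_mergeWith (hE : P.IsDecoration E) (hM : P.IsMismatched E)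
    (hw : P.WantsToMerge E t B r) (hf : P.IsFirstOfHue E (P.color t) {t} r) {t' : Fin n}
    (htt : t' < t) {H : Finset (Fin n)} (h : P.HasPermission (mergeWith E t B) t' H) :
    ∃ H' ∈ E.hues, P.HasPermission E t' H' := by
  obtain ⟨r', hw', hf', hp'⟩ := hasPermission_iff.1 h
  have ht'N : ({t'} : Finset (Fin n)) ≠ insert t B := fun h0 => htt.ne' <|
    Finset.mem_singleton.1 (h0 ▸ Finset.mem_insert_self t B)
  obtain ⟨ht', h1, h2⟩ := (mem_hues_mergeWith.1 hw'.1).resolve_left ht'N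
  rcases mem_hues_mergeWith.1 hw'.2.1 with rfl | ⟨hH, h3, h4⟩
  swap
  · exact ⟨H, hH, (hw.hasPermission_mergeWith_iff hE hM ht' hH h1 h2 h3 h4).1 h⟩
  have hue_t' : ∀ x, (mergeWith E t B).hue x = {t'} ↔ E.hue x = {t'} := fun x =>
    hue_mergeWith_eq_of_ne h1 h2 ht'N
  have hrt : t = r' := WithTop.coe_injective (hw.min_insert.symm.trans hw'.2.2.1)
  subst hrt
  have hct : P.color t = P.color t' := hw'.2.2.2.1
  rw [← hct] at hf' hp'
  have hEt : E.hue t = {t'} := (hue_t' t).1 hw'.hue_eq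
  have hnd := P.nodup_chainOrder E (P.color t)
  have hne : ∀ x, E.hue x = {t'} → x ≠ r := by
    rintro x hx rfl
    exact h1 (hx.symm.trans hw.hue_eq)
  refine ⟨{t}, hw.1, hasPermission_iff.2 ⟨t, ⟨ht', hw.1, Finset.min_singleton, hct, htt, hEt⟩, ?_,
    ?_⟩⟩
  · rw [← hct]
    refine ⟨((hw.mem_chainOrder_mergeWith hE hM).1 hf'.1).1, hEt, fun x hx hxt => ?_⟩
    exact hf'.2.2 x ((hw.pair_sublist_mergeWith hE hM).2 ⟨hx, hne x hxt, hw.lt.ne⟩)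
      ((hue_t' x).2 hxt)
  rintro x hx y hy hxy ⟨hxt', hyt⟩
  rw [← hct] at hxy
  rw [mem_permissionSet, ← hct] at hx hy
  have hxr : x ≠ r := hne x hxt'
  have hxS : x ∈ P.permissionSet (mergeWith E t B) t' (insert t B) t := by
    rw [mem_permissionSet, hw.mem_under_mergeWith, hue_t']
    refine ⟨not_or.2 ⟨hx.1, hxr⟩, Or.inl hxt', hx.2.2.1, fun h0 => ?_⟩
    rw [(hue_t' x).2 hxt', Finset.min_singleton, WithTop.coe_inj] at h0
    exact htt.ne h0.2
  -- Permission in the merged decoration forbids such a `z` after `x`, unless `z` is left out as the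
  -- predecessor of `t`.
  have key : ∀ z, E.hue z = {t} → z ≠ r → P.PermissionBefore E (P.color t) x z →
      [z, t] <+ P.chainOrder E (P.color t) := by
    intro z hz hzr hxz
    by_contra hzt
    refine hp' x hxS z ?_ ((hw.permissionBefore_mergeWith hE hM hxr hzr).2 hxz)
      ⟨(hue_t' x).2 hxt', (hw.hue_mergeWith_eq_insert hE).2 (Or.inl hz)⟩
    rw [mem_permissionSet, hw.mem_under_mergeWith, ← hct, hw.hue_mergeWith_eq_insert hE]
    refine ⟨not_or.2 ⟨hE.notMem_under_of_hue_eq_singleton hM hz, hzr⟩, Or.inr (Or.inl hz), ?_,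
      fun h0 => hzt ((hw.pair_sublist_mergeWith hE hM).1 h0.1).1⟩
    rintro rfl
    exact h1 (hEt.symm.trans hz)
  have hmint : ∀ z, E.hue z = {t} → (E.hue z).min = t := by
    intro z hz
    rw [hz, Finset.min_singleton]
  -- The number `r` is invisible to the permission after the merge, being underlined. Any other
  -- number of hue $\{t\}$ would stand after `r`, hence after `x`, hence before `t` by `key`; then
  -- `r` would also stand before its target `t` and be left out as the predecessor. So $k_t\le 1$,
  -- although `x` and `t` both have hue $\{t'\}$ and $k_{t'}\le k_t$.
  by_cases hyr : y = r
  · subst hyr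
    have hall : ∀ z, E.hue z = {t} → z = y := by
      intro z hz
      by_contra hzr
      have hrz := hf.permissionBefore hE hM hz hzr
      have hzt := key z hz hzr (hxy.trans hrz)
      rw [permissionBefore_iff_of_mem (List.mem_left_of_pair_sublist hzt)] at hrz
      exact hy.2.2.2 ⟨hnd.pair_sublist_trans hrz hzt, hmint _ hyt⟩
    have hk1 : P.k t ≤ 1 := by
      rw [← hE.card_hue_singleton hw.1]
      refine Finset.card_le_one.2 fun a ha b hb => ?_
      rw [Finset.mem_filter] at ha hb
      rw [hall a ha.2, hall b hb.2]
    have hk2 : 1 < P.k t' := by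
      rw [← hE.card_hue_singleton ht']
      exact Finset.one_lt_card.2 ⟨x, by simp [hxt'], t, by simp [hEt], hx.2.2.1⟩
    have := hE.k_le_of_lt hw.1 htt hct
    omega
  · exact hy.2.2.2 ⟨key y hyt hyr hxy, hmint y hyt⟩

/-- No candidate below `t` is lost. The partner of $\{t'\}$ cannot be `B`, because $\min B$ has hue
$\{t\}$; if it is $\{t\}$, the permission passes to $\{t\}\cup B$. -/
theorem IsDecoration.hasPermission_mergeWith (hE : P.IsDecoration E) (hM : P.IsMismatched E)
    (hp : P.HasPermission E t B) {t' : Fin n} (htt : t' < t) {H : Finset (Fin n)}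
    (h : P.HasPermission E t' H) :
    ∃ H' ∈ (mergeWith E t B).hues, P.HasPermission (mergeWith E t B) t' H' := by
  obtain ⟨r, hw, hf, hpr⟩ := hasPermission_iff.1 hp
  obtain ⟨r', hw', hf', hp'⟩ := hasPermission_iff.1 h
  have h1 : ({t'} : Finset (Fin n)) ≠ {t} := fun h0 => htt.ne (Finset.singleton_injective h0)
  have h2 : {t'} ≠ B := by
    intro h0
    have := hw.mem
    rw [← h0, Finset.mem_singleton] at this
    exact htt.asymm (this ▸ hw.lt)
  have h4 : H ≠ B := by
    rintro rfl
    obtain rfl : r = r' := hw'.min_eq_iff.1 hw.2.2.1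
    exact h1 (hw'.hue_eq.symm.trans hw.hue_eq)
  have ht'N : ({t'} : Finset (Fin n)) ≠ insert t B := fun h0 => htt.ne' <|
    Finset.mem_singleton.1 (h0 ▸ Finset.mem_insert_self t B)
  by_cases h3 : H = {t}
  swap
  · exact ⟨H, mem_hues_mergeWith.2 (Or.inr ⟨hw'.2.1, h3, h4⟩),
      (hw.hasPermission_mergeWith_iff hE hM hw'.1 hw'.2.1 h1 h2 h3 h4).2 h⟩
  subst h3
  have hue_t' : ∀ x, (mergeWith E t B).hue x = {t'} ↔ E.hue x = {t'} := fun x =>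
    hue_mergeWith_eq_of_ne h1 h2 ht'N
  have hrt : t = r' := WithTop.coe_injective (Finset.min_singleton.symm.trans hw'.2.2.1)
  subst hrt
  have hct : P.color t = P.color t' := hw'.2.2.2.1
  rw [← hct] at hf' hp'
  have hEt : E.hue t = {t'} := hw'.hue_eq
  have hwalk := P.isWalk_chainOrder E (P.color t)
  have hnd := hwalk.nodup
  refine ⟨insert t B, mem_hues_mergeWith.2 (Or.inl rfl), hasPermission_iff.2 ⟨t,
    ⟨mem_hues_mergeWith.2 (Or.inr ⟨hw'.1, h1, h2⟩), mem_hues_mergeWith.2 (Or.inl rfl),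
      hw.min_insert, hct, htt, (hue_t' t).2 hEt⟩, ?_, ?_⟩⟩
  · rw [← hct]
    refine ⟨(hw.mem_chainOrder_mergeWith hE hM).2 ⟨hf'.1, hw.lt.ne⟩, (hue_t' t).2 hEt,
      fun x hx hxt => ?_⟩
    exact hf'.2.2 x ((hw.pair_sublist_mergeWith hE hM).1 hx).1 ((hue_t' x).1 hxt)
  rintro x hx y hy hxy ⟨hxt', hyN⟩
  rw [mem_permissionSet, hw.mem_under_mergeWith, not_or] at hx hy
  rw [← hct, hw.permissionBefore_mergeWith hE hM hx.1.2 hy.1.2] at hxy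
  rw [hue_t'] at hxt'
  rw [hw.hue_mergeWith_eq_insert hE] at hyN
  have hxS : x ∈ P.permissionSet E t' {t} t := by
    rw [mem_permissionSet]
    refine ⟨hx.1.1, Or.inl hxt', hx.2.2.1, fun h0 => ?_⟩
    rw [hxt', Finset.min_singleton, WithTop.coe_inj] at h0
    exact htt.ne h0.2
  have hmint : ∀ z, E.hue z = {t} → (E.hue z).min = t := by
    intro z hz
    rw [hz, Finset.min_singleton]
  have hord : ∀ z, E.hue z = {t} → z ∈ P.chainOrder E (P.color t) ∨ P.color z ≠ P.color t :=
    fun z hz => hE.mem_chainOrder_or_color_ne hM (by rw [hz]; exact Finset.mem_singleton_self t)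
      (hE.notMem_under_of_hue_eq_singleton hM hz)
  have hordx : x ∈ P.chainOrder E (P.color t) ∨ P.color x ≠ P.color t := by
    rw [hct]
    exact hE.mem_chainOrder_or_color_ne hM (by rw [hxt']; exact Finset.mem_singleton_self t')
      (hE.notMem_under_of_hue_eq_singleton hM hxt')
  -- This is the permission of $\{t'\}$, unless `w` is left out as the predecessor of `t`. But `r`
  -- stands before `w` and also targets `t`, so `t` would directly follow `r`, leaving no room for
  -- `w`.
  have key : ∀ w, E.hue w = {t} → w ≠ r → P.PermissionBefore E (P.color t) w x := by
    intro w hwt hwr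
    have hwx : w ≠ x := by
      rintro rfl
      exact h1 (hxt'.symm.trans hwt)
    refine (PermissionBefore.total (hord w hwt) hordx hwx).resolve_right fun h0 => ?_
    refine hp' x hxS w ?_ h0 ⟨hxt', hwt⟩
    rw [mem_permissionSet, ← hct]
    refine ⟨hE.notMem_under_of_hue_eq_singleton hM hwt, Or.inr hwt, ?_, fun h5 => ?_⟩
    · rintro rfl
      exact h1 (hEt.symm.trans hwt)
    · have hrw := hf.permissionBefore hE hM hwt hwr
      rw [permissionBefore_iff_of_mem (List.mem_left_of_pair_sublist h5.1)] at hrw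
      rcases hwalk.eq_or_pair_sublist_of_target_mem (hnd.pair_sublist_trans hrw h5.1)
        (hmint r hw.hue_eq) hrw with h6 | h6
      · exact hnd.pair_sublist_ne h5.1 h6
      · exact hnd.pair_sublist_asymm h6 h5.1
  rcases hyN with hyt | hyB
  · exact hxy.asymm (key y hyt hy.1.2)
  -- Both `x` and `t` have hue $\{t'\}$, so $2\le k_{t'}\le k_t$ and some `z` other than `r` has hue
  -- $\{t\}$. It stands before `x`, and `y` stands before it: via `r` if `y` stands before `r`, by
  -- the permission of $\{t\}$ otherwise.
  · have hk2 : 1 < P.k t' := by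
      rw [← hE.card_hue_singleton hw'.1]
      exact Finset.one_lt_card.2 ⟨x, by simp [hxt'], t, by simp [hEt], hx.2.2.1⟩
    have hk1 : 1 < (Finset.univ.filter fun x => E.hue x = {t}).card := by
      rw [hE.card_hue_singleton hw.1]
      exact hk2.trans_le (hE.k_le_of_lt hw.1 htt hct)
    obtain ⟨z, hz, hzr⟩ := Finset.exists_mem_ne hk1 r
    replace hz := (Finset.mem_filter.1 hz).2
    have hzx := key z hz hzr
    refine hxy.asymm (PermissionBefore.trans ?_ hzx)
    by_cases hyr : [y, r] <+ P.chainOrder E (P.color t)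
    · exact PermissionBefore.trans (Or.inl hyr) (hf.permissionBefore hE hM hz hzr)
    · have hyz : y ≠ z := by
        rintro rfl
        exact hw.ne_singleton (hyB.symm.trans hz)
      have hordy : y ∈ P.chainOrder E (P.color t) ∨ P.color y ≠ P.color t := by
        rw [← hw.2.2.2.1]
        exact hE.mem_chainOrder_or_color_ne hM (by rw [hyB]; exact hw.mem) hy.1.1
      refine (PermissionBefore.total hordy (hord z hz) hyz).resolve_right fun h0 => ?_
      refine hpr z ?_ y ?_ h0 ⟨hz, hyB⟩
      · rw [mem_permissionSet]
        refine ⟨hE.notMem_under_of_hue_eq_singleton hM hz, Or.inl hz, hzr, fun h5 => ?_⟩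
        exact hw.lt.ne (WithTop.coe_injective ((hmint z hz).symm.trans h5.2))
      · rw [mem_permissionSet]
        exact ⟨hy.1.1, Or.inr hyB, hy.1.2, fun h5 => hyr h5.1⟩

end ColoredExponents

namespace ColoredExponents

variable {n m : ℕ} {P : ColoredExponents n m} {D E : Marking n} {a t r : Fin n}
  {B : Finset (Fin n)}

theorem Marking.ext_fields {D E : Marking n} (h1 : D.hues = E.hues) (h2 : D.hue = E.hue)
    (h3 : D.under = E.under) : D = E := by
  cases D
  cases E
  simp_all

theorem countP_permissionList {c : Fin m} {S : Finset (Fin n)} (p : Fin n → Prop) [DecidablePred p]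
    (hS : ∀ x ∈ S, x ∈ P.chainOrder D c ∨ P.color x ≠ c) :
    (P.permissionList D c S).countP (fun x => p x) = (S.filter p).card := by
  rw [List.countP_eq_length_filter, ← List.toFinset_card_of_nodup (nodup_permissionList.filter _)]
  congr 1
  ext x
  rw [List.mem_toFinset, List.mem_filter, mem_permissionList, Finset.mem_filter]
  have := hS x
  simp only [decide_eq_true_eq]
  tauto

/-! ### Splitting undoes merging -/

/-- The first steps of the split restore the hues of `r`, of the rest of `B` and of the predecessor
of `r`. The undecided numbers form the permission set, where permission puts those of hue `B` first;
their number is determined by the quota $k_B$. -/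
theorem WantsToMerge.splitInto_mergeWith (hE : P.IsDecoration E) (hM : P.IsMismatched E)
    (hw : P.WantsToMerge E t B r) (hf : P.IsFirstOfHue E (P.color t) {t} r)
    (hp : ∀ x ∈ P.permissionSet E t B r, ∀ y ∈ P.permissionSet E t B r,
      P.PermissionBefore E (P.color t) x y → ¬ (E.hue x = {t} ∧ E.hue y = B)) :
    P.splitInto (mergeWith E t B) t (insert t B) B = E := by
  have hNt : ({t} : Finset (Fin n)) ≠ insert t B := by
    intro h
    have : r ∈ ({t} : Finset (Fin n)) := h ▸ Finset.mem_insert_of_mem hw.mem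
    exact hw.lt.ne' (Finset.mem_singleton.1 this)
  have hNB : B ≠ insert t B := fun h => hw.notMem (h ▸ Finset.mem_insert_self t B)
  have haux : ∀ x, P.splitHueAux (mergeWith E t B) t (insert t B) B x =
      if x = r then {t} else if x ∈ B then B else
        if [x, r] <+ P.chainOrder E (P.color t) ∧ (E.hue x).min = r then B
        else (mergeWith E t B).hue x := by
    intro x
    rw [splitHueAux]
    simp only [hw.min_eq_iff, hw.splitQ_mergeWith hE hM hf]
  have hunder : ∀ x, E.hue x = {t} ∨ E.hue x = B → x ≠ r → (x ∈ E.under ↔ x ∈ B) := by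
    intro x hx hxr
    constructor
    · intro h
      obtain ⟨H, hH, hxH, hj⟩ := (hE.mem_under_iff hM).1 h
      have hxe := hE.hue_block H hH x hxH hj
      rcases hx with hx | hx
      · exact absurd h (hE.notMem_under_of_hue_eq_singleton hM hx)
      · rwa [← hx, hxe]
    · exact fun h => (hE.mem_under_iff_of_mem hM hw.2.1 h).2
        ⟨r, hw.mem, lt_of_le_of_ne (hw.le h) hxr.symm⟩
  have hblock : ∀ x ∈ B, x ≠ r → E.hue x = B := fun x hx hxr =>
    hE.hue_block B hw.2.1 x hx ⟨r, hw.mem, lt_of_le_of_ne (hw.le hx) hxr.symm⟩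
  have hS : (Finset.univ.filter fun x =>
      P.splitHueAux (mergeWith E t B) t (insert t B) B x = insert t B) =
      P.permissionSet E t B r := by
    ext x
    rw [Finset.mem_filter, mem_permissionSet, haux]
    simp only [Finset.mem_univ, true_and]
    split_ifs with h1 h2 h3
    · simp [hNt, h1]
    · simp only [hNB, false_iff]
      intro h
      exact h.1 ((hunder x h.2.1 h1).2 h2)
    · simp [hNB, h3]
    · rw [hw.hue_mergeWith_eq_insert hE]
      constructor
      · exact fun h => ⟨fun h0 => h2 ((hunder x h h1).1 h0), h, h1, h3⟩
      · exact fun h => h.2.1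
  have hauxB : ∀ x, P.splitHueAux (mergeWith E t B) t (insert t B) B x = B ↔
      E.hue x = B ∧ x ∉ P.permissionSet E t B r := by
    intro x
    rw [haux, mem_permissionSet]
    split_ifs with h1 h2 h3
    · subst h1
      simp only [hw.hue_eq]
      simp [hw.ne_singleton.symm]
    · simp only [true_iff]
      have := hblock x h2 h1
      exact ⟨this, fun h => h.1 ((hunder x (Or.inr this) h1).2 h2)⟩
    · simp only [true_iff]
      exact ⟨hw.hue_eq_of_min_eq hE h3.2, fun h => h.2.2.2 h3⟩
    · constructor
      · rw [hue_mergeWith]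
        split_ifs with h4
        · exact fun h => absurd h.symm hNB
        · exact fun h => absurd (Or.inr h) h4
      · rintro ⟨h4, h5⟩
        exact absurd ⟨fun h0 => h2 ((hunder x (Or.inr h4) h1).1 h0), Or.inr h4, h1, h3⟩ h5
  have hord : ∀ x ∈ P.permissionSet E t B r,
      x ∈ P.chainOrder E (P.color t) ∨ P.color x ≠ P.color t := by
    intro x hx
    rw [mem_permissionSet] at hx
    rcases hx.2.1 with h | h
    · exact hE.mem_chainOrder_or_color_ne hM (by rw [h]; exact Finset.mem_singleton_self t) hx.1
    · rw [← hw.2.2.2.1]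
      exact hE.mem_chainOrder_or_color_ne hM (by rw [h]; exact hw.mem) hx.1
  have hlist : P.permissionList (mergeWith E t B) (P.color t) (P.permissionSet E t B r) =
      P.permissionList E (P.color t) (P.permissionSet E t B r) := by
    rw [permissionList, permissionList, hw.chainOrder_mergeWith hE hM, List.filter_filter]
    congr 2
    funext x
    by_cases hx : x = r
    · subst hx
      simp [mem_permissionSet]
    · simp [hx]
  -- The numbers already assigned to `B` are those of hue `B` outside the permission set, so the
  -- unused quota is the number of those inside.
  have hcount : P.kSum B - (Finset.univ.filter fun x =>
      P.splitHueAux (mergeWith E t B) t (insert t B) B x = B).card =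
      (P.permissionList E (P.color t) (P.permissionSet E t B r)).countP
        (fun x => E.hue x = B) := by
    rw [countP_permissionList _ hord, ← hE.hue_card B hw.2.1]
    simp only [hauxB]
    rw [← Finset.card_filter_add_card_filter_not (s := Finset.univ.filter fun x => E.hue x = B)
      (fun x => x ∈ P.permissionSet E t B r), Finset.filter_filter, Finset.filter_filter,
      Nat.add_sub_cancel]
    congr 1
    ext x
    simp only [Finset.mem_filter, Finset.mem_univ, true_and]
    tauto
  have hpiece : P.splitInitial (mergeWith E t B) t (insert t B) B =
      (P.permissionList E (P.color t) (P.permissionSet E t B r)).filter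
        (fun x => E.hue x = B) := by
    rw [splitInitial, hS, hlist, hcount]
    refine List.take_countP_eq_filter (List.pairwise_iff_forall_sublist.2 fun {x y} hxy => ?_)
    rw [pair_sublist_permissionList] at hxy
    simp only [decide_eq_true_eq]
    rintro ⟨h1, h2⟩
    exact hp x hxy.1 y hxy.2.1 hxy.2.2
      ⟨(mem_permissionSet.1 hxy.1).2.1.resolve_right h1, h2⟩
  refine Marking.ext_fields ?_ ?_ ?_
  · ext H
    simp only [splitInto, Finset.mem_insert, Finset.mem_erase, mem_hues_mergeWith]
    have h1 := hw.insert_notMem hE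
    constructor
    · rintro (rfl | rfl | ⟨h2, h3 | h3⟩)
      · exact hw.1
      · exact hw.2.1
      · exact absurd h3 h2
      · exact h3.1
    · intro h
      by_cases h2 : H = {t}
      · exact Or.inl h2
      by_cases h3 : H = B
      · exact Or.inr (Or.inl h3)
      refine Or.inr (Or.inr ⟨?_, Or.inr ⟨h, h2, h3⟩⟩)
      rintro rfl
      exact h1 h
  · funext x
    have hxS : P.splitHueAux (mergeWith E t B) t (insert t B) B x = insert t B ↔
        x ∈ P.permissionSet E t B r := by
      rw [← hS]
      simp
    simp only [splitInto, hpiece, List.mem_filter, mem_permissionList, hxS, decide_eq_true_eq]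
    by_cases hx : x ∈ P.permissionSet E t B r
    · rw [if_pos hx]
      by_cases hxB : E.hue x = B
      · rw [if_pos ⟨⟨hx, hord x hx⟩, hxB⟩, hxB]
      · rw [if_neg fun h => hxB h.2]
        exact ((mem_permissionSet.1 hx).2.1.resolve_right hxB).symm
    · rw [if_neg hx]
      by_cases hxB : E.hue x = B
      · rw [(hauxB x).2 ⟨hxB, hx⟩, hxB]
      · have hx' := hx
        rw [mem_permissionSet] at hx'
        rw [haux]
        split_ifs with h1 h2 h3
        · rw [h1, hw.hue_eq]
        · exact (hblock x h2 h1).symm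
        · exact (hw.hue_eq_of_min_eq hE h3.2).symm
        · rw [hue_mergeWith, if_neg]
          rintro (h4 | h4)
          · exact hx' ⟨hE.notMem_under_of_hue_eq_singleton hM h4, Or.inl h4, h1, h3⟩
          · exact hxB h4
  · ext x
    simp only [splitInto, Finset.mem_filter, hw.mem_under_mergeWith, ne_eq, hw.min_eq_iff]
    have := hw.notMem_under hE hM
    constructor
    · rintro ⟨h1 | h1, h2⟩
      · exact h1
      · exact absurd h1 h2
    · intro h
      refine ⟨Or.inl h, ?_⟩
      rintro rfl
      exact this h

/-! ### Splitting -/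

/-- The data of a split: `B` is a hue with minimum `a`, and `r` is the second smallest element. -/
structure SplitData (P : ColoredExponents n m) (D : Marking n) (a : Fin n) (B : Finset (Fin n))
    (r : Fin n) : Prop where
  isDecoration : P.IsDecoration D
  isMismatched : P.IsMismatched D
  mem_hues : B ∈ D.hues
  min_eq : B.min = (a : WithTop (Fin n))
  min_erase : (B.erase a).min = (r : WithTop (Fin n))

namespace SplitData

theorem mem_self (h : SplitData P D a B r) : a ∈ B := Finset.mem_of_min h.min_eq

theorem mem_erase (h : SplitData P D a B r) : r ∈ B.erase a := Finset.mem_of_min h.min_erase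

theorem mem (h : SplitData P D a B r) : r ∈ B := (Finset.mem_erase.1 h.mem_erase).2

theorem lt_of_mem (h : SplitData P D a B r) {x : Fin n} (hx : x ∈ B.erase a) : a < x :=
  lt_of_le_of_ne (Finset.min_le_of_eq (Finset.mem_erase.1 hx).2 h.min_eq)
    (Finset.mem_erase.1 hx).1.symm

theorem lt (h : SplitData P D a B r) : a < r := h.lt_of_mem h.mem_erase

theorem le (h : SplitData P D a B r) {x : Fin n} (hx : x ∈ B.erase a) : r ≤ x :=
  Finset.min_le_of_eq hx h.min_erase

theorem min_eq_iff (h : SplitData P D a B r) {x : Fin n} :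
    (B.erase a).min = (x : WithTop (Fin n)) ↔ x = r := by
  rw [h.min_erase, WithTop.coe_inj, eq_comm]

theorem singleton_ne (h : SplitData P D a B r) : {a} ≠ B := fun h0 =>
  h.lt.ne' (Finset.mem_singleton.1 (h0 ▸ h.mem))

theorem erase_ne (h : SplitData P D a B r) : B.erase a ≠ B := fun h0 =>
  Finset.notMem_erase a B (h0.symm ▸ h.mem_self)

theorem erase_ne_singleton (h : SplitData P D a B r) : B.erase a ≠ {a} := fun h0 =>
  h.lt.ne' (Finset.mem_singleton.1 (h0 ▸ h.mem_erase))

theorem singleton_notMem (h : SplitData P D a B r) : {a} ∉ D.hues := fun h0 =>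
  h.singleton_ne (h.isDecoration.eq_of_mem h0 h.mem_hues (Finset.mem_singleton_self a) h.mem_self)

theorem erase_notMem (h : SplitData P D a B r) : B.erase a ∉ D.hues := fun h0 =>
  h.erase_ne (h.isDecoration.eq_of_mem h0 h.mem_hues h.mem_erase h.mem)

theorem hue_of_mem (h : SplitData P D a B r) {x : Fin n} (hx : x ∈ B.erase a) : D.hue x = B :=
  h.isDecoration.hue_block B h.mem_hues x (Finset.mem_erase.1 hx).2 ⟨a, h.mem_self, h.lt_of_mem hx⟩

theorem mem_under_of_mem (h : SplitData P D a B r) {x : Fin n} (hx : x ∈ B.erase a) :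
    x ∈ D.under :=
  (h.isDecoration.mem_under_iff_of_mem h.isMismatched h.mem_hues (Finset.mem_erase.1 hx).2).2
    ⟨a, h.mem_self, h.lt_of_mem hx⟩

theorem mem_under_iff (h : SplitData P D a B r) {x : Fin n} (hx : D.hue x = B) :
    x ∈ D.under ↔ x ∈ B.erase a := by
  refine ⟨fun h0 => ?_, h.mem_under_of_mem⟩
  obtain ⟨H, hH, hxH, j, hj, hjx⟩ := (h.isDecoration.mem_under_iff h.isMismatched).1 h0
  have : H = B := (h.isDecoration.hue_block H hH x hxH ⟨j, hj, hjx⟩).symm.trans hx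
  subst this
  refine Finset.mem_erase.2 ⟨?_, hxH⟩
  rintro rfl
  exact absurd (Finset.min_le_of_eq hj h.min_eq) (not_le.2 hjx)

theorem hue_ne (h : SplitData P D a B r) (x : Fin n) : D.hue x ≠ {a} ∧ D.hue x ≠ B.erase a := by
  by_cases hx : x ∈ P.crossed
  · rw [h.isDecoration.hue_crossed x hx]
    exact ⟨(Finset.singleton_ne_empty a).symm, (Finset.Nonempty.ne_empty ⟨r, h.mem_erase⟩).symm⟩
  · have := h.isDecoration.hue_mem x hx
    exact ⟨fun h0 => h.singleton_notMem (h0 ▸ this), fun h0 => h.erase_notMem (h0 ▸ this)⟩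

/-- Numbers in chains are not underlined, whereas all elements of `B.erase a` are. -/
theorem of_splitQ (h : SplitData P D a B r) {q : Fin n}
    (hq : P.splitQ D (P.color a) B (B.erase a) = some q) :
    P.IsFirstOfHue D (P.color a) B q ∧ q ∉ B.erase a := by
  rw [splitQ] at hq
  split_ifs at hq
  rw [find?_eq_some_iff] at hq
  refine ⟨hq, fun h0 => ?_⟩
  have := (P.mem_chainOrder.1 hq.1)
  rw [h.isDecoration.mem_chainSet_iff h.isMismatched] at this
  exact this.2.1 (h.mem_under_of_mem h0)

/-- The numbers that receive their hue in the last step of the splitting procedure. -/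
theorem splitHueAux_eq_iff (h : SplitData P D a B r) {x : Fin n} :
    P.splitHueAux D a B (B.erase a) x = B ↔ D.hue x = B ∧ x ∉ B.erase a ∧
      P.splitQ D (P.color a) B (B.erase a) ≠ some x := by
  rw [splitHueAux]
  simp only [h.min_eq_iff]
  split_ifs with h1 h2 h3
  · subst h1
    simp only [h.singleton_ne, false_iff]
    exact fun h0 => h0.2.1 h.mem_erase
  · simp [h.erase_ne, h2]
  · simp [h.erase_ne, h3]
  · simp [h2, h3]

theorem splitHueAux_eq_erase_iff (h : SplitData P D a B r) {x : Fin n} :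
    P.splitHueAux D a B (B.erase a) x = B.erase a ↔ x ≠ r ∧
      (x ∈ B.erase a ∨ P.splitQ D (P.color a) B (B.erase a) = some x) := by
  rw [splitHueAux]
  simp only [h.min_eq_iff]
  split_ifs with h1 h2 h3
  · simp [h1, h.erase_ne_singleton.symm]
  · simp only [h1, h2, ne_eq, not_false_eq_true, true_or, and_self]
  · simp only [h1, h3, ne_eq, not_false_eq_true, or_true, and_self]
  · simp only [h2, h3, (h.hue_ne x).2, or_self, and_false]

theorem hue_splitInto_of_ne (h : SplitData P D a B r) {x : Fin n} (hx : D.hue x ≠ B) :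
    (P.splitInto D a B (B.erase a)).hue x = D.hue x := by
  have h2 : x ∉ B.erase a := fun h0 => hx (h.hue_of_mem h0)
  have h1 : x ≠ r := fun h0 => h2 (h0 ▸ h.mem_erase)
  have h3 : P.splitQ D (P.color a) B (B.erase a) ≠ some x := fun h0 => hx (h.of_splitQ h0).1.2.1
  have haux : P.splitHueAux D a B (B.erase a) x = D.hue x := by
    rw [splitHueAux, if_neg (mt h.min_eq_iff.1 h1), if_neg h2, if_neg h3]
  simp only [splitInto, haux, if_neg hx]

theorem mem_splitInitial_imp {x : Fin n} (hx : x ∈ P.splitInitial D a B (B.erase a)) :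
    P.splitHueAux D a B (B.erase a) x = B := by
  have := (mem_permissionList.1 (List.mem_of_mem_take hx)).1
  exact (Finset.mem_filter.1 this).2

theorem hue_splitInto_eq_erase_iff (h : SplitData P D a B r) {x : Fin n} :
    (P.splitInto D a B (B.erase a)).hue x = B.erase a ↔
      P.splitHueAux D a B (B.erase a) x = B.erase a ∨ x ∈ P.splitInitial D a B (B.erase a) := by
  simp only [splitInto]
  split_ifs with h1 h2
  · simp [h2]
  · simp [h1, h2, h.erase_ne.symm, h.erase_ne_singleton.symm]
  · simp only [iff_self_or]
    exact fun h2 => absurd (mem_splitInitial_imp h2) h1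

theorem hue_splitInto_r (h : SplitData P D a B r) :
    (P.splitInto D a B (B.erase a)).hue r = {a} := by
  have : P.splitHueAux D a B (B.erase a) r = {a} := by
    rw [splitHueAux, if_pos h.min_erase]
  simp only [splitInto, this, if_neg h.singleton_ne]

theorem hue_splitInto_or (h : SplitData P D a B r) {x : Fin n} (hx : D.hue x = B) :
    (P.splitInto D a B (B.erase a)).hue x = {a} ∨
      (P.splitInto D a B (B.erase a)).hue x = B.erase a := by
  simp only [splitInto]
  split_ifs with h1 h2
  · exact Or.inr rfl
  · exact Or.inl rfl
  · rw [h.splitHueAux_eq_iff] at h1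
    by_cases hxr : x = r
    · left
      rw [hxr, splitHueAux, if_pos h.min_erase]
    · right
      rw [h.splitHueAux_eq_erase_iff]
      tauto

theorem hue_splitInto_iff (h : SplitData P D a B r) {x : Fin n} :
    ((P.splitInto D a B (B.erase a)).hue x = {a} ∨
      (P.splitInto D a B (B.erase a)).hue x = B.erase a) ↔ D.hue x = B := by
  refine ⟨fun h0 => ?_, h.hue_splitInto_or⟩
  by_contra hx
  rw [h.hue_splitInto_of_ne hx] at h0
  exact h0.elim (h.hue_ne x).1 (h.hue_ne x).2

theorem hue_splitInto_eq_of_ne (h : SplitData P D a B r) {H : Finset (Fin n)} (h1 : H ≠ {a})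
    (h2 : H ≠ B.erase a) (h3 : H ≠ B) {x : Fin n} :
    (P.splitInto D a B (B.erase a)).hue x = H ↔ D.hue x = H := by
  by_cases hx : D.hue x = B
  · rw [hx]
    constructor
    · rintro rfl
      exact ((h.hue_splitInto_or hx).elim h1 h2).elim
    · exact fun h0 => absurd h0.symm h3
  · rw [h.hue_splitInto_of_ne hx]

theorem mem_chainOrder_or_color_ne (h : SplitData P D a B r) {x : Fin n} (hx : D.hue x = B)
    (hx' : x ∉ B.erase a) : x ∈ P.chainOrder D (P.color a) ∨ P.color x ≠ P.color a :=
  h.isDecoration.mem_chainOrder_or_color_ne h.isMismatched (by rw [hx]; exact h.mem_self)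
    (mt (h.mem_under_iff hx).1 hx')

theorem one_le_k (h : SplitData P D a B r) {x : Fin n} (hx : x ∈ B) : 1 ≤ P.k x :=
  mem_boxed.1 (h.isDecoration.boxed_of_mem h.mem_hues hx)

theorem kSum_eq (h : SplitData P D a B r) : P.kSum B = P.k a + P.kSum (B.erase a) :=
  (Finset.add_sum_erase B P.k h.mem_self).symm

/-- The truncated subtraction and the `take` have to be exact. The numbers `X` with hue $B'$ before
the last step lie in $B'$ without `r`, plus possibly `q`, so $|X|\le|B'|\le k_{B'}$. The undecided
ones number $k_B-|X|-1$, where the 1 is for `r`; this is at least $k_{B'}-|X|$ because $k_a\ge 1$.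
-/
theorem card_hue_erase (h : SplitData P D a B r) :
    (Finset.univ.filter fun x => (P.splitInto D a B (B.erase a)).hue x = B.erase a).card =
      P.kSum (B.erase a) := by
  set X := Finset.univ.filter fun x => P.splitHueAux D a B (B.erase a) x = B.erase a with hX
  set S := Finset.univ.filter fun x => P.splitHueAux D a B (B.erase a) x = B with hS
  have hXle : X.card ≤ P.kSum (B.erase a) := by
    have h1 : X ⊆ (B.erase a).erase r ∪ (P.splitQ D (P.color a) B (B.erase a)).toFinset := by
      intro x hx
      rw [hX, Finset.mem_filter, h.splitHueAux_eq_erase_iff] at hx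
      simp only [Finset.mem_union, Finset.mem_erase, Option.mem_toFinset, Option.mem_def]
      have := hx.2
      rw [Finset.mem_erase] at this
      tauto
    have h2 : (P.splitQ D (P.color a) B (B.erase a)).toFinset.card ≤ 1 := by
      rw [Option.card_toFinset]
      cases P.splitQ D (P.color a) B (B.erase a) <;> simp
    have h3 := (Finset.card_le_card h1).trans (Finset.card_union_le _ _)
    rw [Finset.card_erase_of_mem h.mem_erase] at h3
    have h4 : 0 < (B.erase a).card := Finset.card_pos.2 ⟨r, h.mem_erase⟩
    have h5 : (B.erase a).card ≤ P.kSum (B.erase a) := by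
      rw [kSum, Finset.card_eq_sum_ones]
      exact Finset.sum_le_sum fun x hx => h.one_le_k (Finset.mem_erase.1 hx).2
    omega
  have hsplit : P.kSum B = S.card + X.card + 1 := by
    rw [← h.isDecoration.hue_card B h.mem_hues]
    have h1 : (Finset.univ.filter fun x => D.hue x = B) = insert r (S ∪ X) := by
      ext x
      simp only [hS, hX, Finset.mem_insert, Finset.mem_union, Finset.mem_filter, Finset.mem_univ,
        true_and, h.splitHueAux_eq_iff, h.splitHueAux_eq_erase_iff]
      constructor
      · intro hx
        tauto
      · rintro (rfl | h0 | ⟨_, h0 | h0⟩)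
        · exact h.hue_of_mem h.mem_erase
        · exact h0.1
        · exact h.hue_of_mem h0
        · exact (h.of_splitQ h0).1.2.1
    rw [h1, Finset.card_insert_of_notMem, Finset.card_union_of_disjoint]
    · rw [Finset.disjoint_filter]
      intro x _ h2 h3
      exact h.erase_ne (h3.symm.trans h2)
    · simp [hS, hX, h.splitHueAux_eq_iff, h.splitHueAux_eq_erase_iff, h.mem, h.lt.ne']
  have hlen : (P.splitInitial D a B (B.erase a)).length = P.kSum (B.erase a) - X.card := by
    have h1 : (P.permissionList D (P.color a) S).length = S.card := by
      rw [← List.toFinset_card_of_nodup nodup_permissionList]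
      congr 1
      ext x
      rw [List.mem_toFinset, mem_permissionList, and_iff_left_iff_imp]
      intro hx
      rw [hS, Finset.mem_filter, h.splitHueAux_eq_iff] at hx
      exact h.mem_chainOrder_or_color_ne hx.2.1 hx.2.2.1
    rw [splitInitial, ← hX, List.length_take, h1, min_eq_left]
    have := h.kSum_eq
    have := h.one_le_k h.mem_self
    omega
  have h1 : (Finset.univ.filter fun x => (P.splitInto D a B (B.erase a)).hue x = B.erase a) =
      X ∪ (P.splitInitial D a B (B.erase a)).toFinset := by
    ext x
    simp [hX, h.hue_splitInto_eq_erase_iff]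
  rw [h1, Finset.card_union_of_disjoint, List.toFinset_card_of_nodup, hlen]
  · omega
  · exact nodup_permissionList.sublist (List.take_sublist _ _)
  · rw [Finset.disjoint_left]
    intro x hx hx'
    rw [List.mem_toFinset] at hx'
    rw [hX, Finset.mem_filter] at hx
    exact h.erase_ne (hx.2.symm.trans (mem_splitInitial_imp hx'))

theorem card_hue_singleton (h : SplitData P D a B r) :
    (Finset.univ.filter fun x => (P.splitInto D a B (B.erase a)).hue x = {a}).card =
      P.kSum {a} := by
  have h1 : (Finset.univ.filter fun x => D.hue x = B) =
      (Finset.univ.filter fun x => (P.splitInto D a B (B.erase a)).hue x = {a}) ∪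
        (Finset.univ.filter fun x => (P.splitInto D a B (B.erase a)).hue x = B.erase a) := by
    rw [← Finset.filter_or]
    simp only [h.hue_splitInto_iff]
  have h2 := h.isDecoration.hue_card B h.mem_hues
  rw [h1, Finset.card_union_of_disjoint, h.card_hue_erase, h.kSum_eq] at h2
  · rw [kSum, Finset.sum_singleton]
    omega
  · rw [Finset.disjoint_filter]
    intro x _ h3 h4
    exact h.erase_ne_singleton (h4.symm.trans h3)

theorem mem_hues_splitInto {H : Finset (Fin n)} :
    H ∈ (P.splitInto D a B (B.erase a)).hues ↔
      H = {a} ∨ H = B.erase a ∨ (H ≠ B ∧ H ∈ D.hues) := by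
  simp only [splitInto, Finset.mem_insert, Finset.mem_erase]

theorem mem_under_splitInto (h : SplitData P D a B r) {x : Fin n} :
    x ∈ (P.splitInto D a B (B.erase a)).under ↔ x ∈ D.under ∧ x ≠ r := by
  simp only [splitInto, Finset.mem_filter, ne_eq, h.min_eq_iff]

theorem subset_of_mem_hues (h : SplitData P D a B r) {H : Finset (Fin n)}
    (hH : H ∈ (P.splitInto D a B (B.erase a)).hues) : ∃ H' ∈ D.hues, H ⊆ H' := by
  rcases mem_hues_splitInto.1 hH with rfl | rfl | ⟨_, hH⟩
  · exact ⟨B, h.mem_hues, Finset.singleton_subset_iff.2 h.mem_self⟩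
  · exact ⟨B, h.mem_hues, Finset.erase_subset a B⟩
  · exact ⟨H, hH, subset_rfl⟩

theorem hue_splitInto_subset (h : SplitData P D a B r) (x : Fin n) :
    (P.splitInto D a B (B.erase a)).hue x ⊆ D.hue x := by
  by_cases hx : D.hue x = B
  · rw [hx]
    rcases h.hue_splitInto_or hx with h0 | h0
    · rw [h0]
      exact Finset.singleton_subset_iff.2 h.mem_self
    · rw [h0]
      exact Finset.erase_subset a B
  · rw [h.hue_splitInto_of_ne hx]

theorem isMismatched_splitInto (h : SplitData P D a B r) :
    P.IsMismatched (P.splitInto D a B (B.erase a)) := by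
  rintro i hi ⟨b, hb, hbi⟩
  exact h.isMismatched i hi ⟨b, h.hue_splitInto_subset i hb, hbi⟩

theorem isDecoration_splitInto (h : SplitData P D a B r) :
    P.IsDecoration (P.splitInto D a B (B.erase a)) where
  hues_nonempty H hH := by
    rcases mem_hues_splitInto.1 hH with rfl | rfl | ⟨_, hH⟩
    · exact Finset.singleton_nonempty a
    · exact ⟨r, h.mem_erase⟩
    · exact h.isDecoration.hues_nonempty H hH
  hues_disjoint := by
    have key : ∀ H ∈ D.hues, H ≠ B → Disjoint {a} H ∧ Disjoint (B.erase a) H := by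
      intro H hH hne
      have := h.isDecoration.hues_disjoint B h.mem_hues H hH hne.symm
      exact ⟨this.mono_left (Finset.singleton_subset_iff.2 h.mem_self),
        this.mono_left (Finset.erase_subset a B)⟩
    have hd : Disjoint {a} (B.erase a) := by simp
    intro H hH H' hH' hne
    rcases mem_hues_splitInto.1 hH with rfl | rfl | ⟨h1, hH⟩ <;>
      rcases mem_hues_splitInto.1 hH' with rfl | rfl | ⟨h2, hH'⟩
    · exact absurd rfl hne
    · exact hd
    · exact (key H' hH' h2).1
    · exact hd.symm
    · exact absurd rfl hne
    · exact (key H' hH' h2).2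
    · exact (key H hH h1).1.symm
    · exact (key H hH h1).2.symm
    · exact h.isDecoration.hues_disjoint H hH H' hH' hne
  hues_union := by
    ext i
    rw [h.isDecoration.mem_boxed_iff, Finset.mem_biUnion]
    simp only [id]
    constructor
    · rintro ⟨H, hH, hi⟩
      obtain ⟨H', hH', hsub⟩ := h.subset_of_mem_hues hH
      exact ⟨H', hH', hsub hi⟩
    · rintro ⟨H, hH, hi⟩
      by_cases hHB : H = B
      · by_cases hia : i = a
        · exact ⟨{a}, mem_hues_splitInto.2 (Or.inl rfl), Finset.mem_singleton.2 hia⟩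
        · exact ⟨B.erase a, mem_hues_splitInto.2 (Or.inr (Or.inl rfl)),
            Finset.mem_erase.2 ⟨hia, hHB ▸ hi⟩⟩
      · exact ⟨H, mem_hues_splitInto.2 (Or.inr (Or.inr ⟨hHB, hH⟩)), hi⟩
  hues_monochromatic H hH i hi j hj := by
    obtain ⟨H', hH', hsub⟩ := h.subset_of_mem_hues hH
    exact h.isDecoration.hues_monochromatic H' hH' i (hsub hi) j (hsub hj)
  hue_crossed i hi := by
    have := h.hue_splitInto_subset i
    rwa [h.isDecoration.hue_crossed i hi, Finset.subset_empty] at this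
  hue_mem i hi := by
    rw [mem_hues_splitInto]
    by_cases hx : D.hue i = B
    · exact (h.hue_splitInto_or hx).imp_right Or.inl
    · rw [h.hue_splitInto_of_ne hx]
      exact Or.inr (Or.inr ⟨hx, h.isDecoration.hue_mem i hi⟩)
  hue_block H hH i hi hj := by
    rcases mem_hues_splitInto.1 hH with rfl | rfl | ⟨h1, hH⟩
    · obtain ⟨j, hj, hji⟩ := hj
      rw [Finset.mem_singleton] at hi hj
      exact absurd (hj.trans hi.symm) hji.ne
    · rw [h.hue_splitInto_eq_erase_iff, h.splitHueAux_eq_erase_iff]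
      obtain ⟨j, hj, hji⟩ := hj
      exact Or.inl ⟨((h.le hj).trans_lt hji).ne', Or.inl hi⟩
    · rw [← h.isDecoration.hue_block H hH i hi hj] at h1
      rw [h.hue_splitInto_of_ne h1]
      exact h.isDecoration.hue_block H hH i hi hj
  hue_card H hH := by
    rcases mem_hues_splitInto.1 hH with rfl | rfl | ⟨h1, hH⟩
    · exact h.card_hue_singleton
    · exact h.card_hue_erase
    · rw [← h.isDecoration.hue_card H hH]
      simp only [h.hue_splitInto_eq_of_ne (fun h0 => h.singleton_notMem (h0 ▸ hH))
        (fun h0 => h.erase_notMem (h0 ▸ hH)) h1]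
  under_boxed i hi := by
    rw [h.mem_under_splitInto, h.isDecoration.mem_under_iff h.isMismatched]
    constructor
    · rintro ⟨⟨H, hH, hiH, j, hj, hji⟩, hir⟩
      by_cases hHB : H = B
      · subst hHB
        have hia : i ∈ H.erase a := Finset.mem_erase.2
          ⟨((Finset.min_le_of_eq hj h.min_eq).trans_lt hji).ne', hiH⟩
        exact ⟨H.erase a, mem_hues_splitInto.2 (Or.inr (Or.inl rfl)), hia, r, h.mem_erase,
          lt_of_le_of_ne (h.le hia) (Ne.symm hir)⟩
      · exact ⟨H, mem_hues_splitInto.2 (Or.inr (Or.inr ⟨hHB, hH⟩)), hiH, j, hj, hji⟩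
    · rintro ⟨H, hH, hiH, j, hj, hji⟩
      obtain ⟨H', hH', hsub⟩ := h.subset_of_mem_hues hH
      refine ⟨⟨H', hH', hsub hiH, j, hsub hj, hji⟩, ?_⟩
      rintro rfl
      rcases mem_hues_splitInto.1 hH with rfl | rfl | ⟨h1, hH⟩
      · exact h.lt.ne' (Finset.mem_singleton.1 hiH)
      · exact absurd (h.le hj) (not_le.2 hji)
      · exact h1 (h.isDecoration.eq_of_mem hH h.mem_hues hiH h.mem)
  under_unboxed i hi h0 := by
    have := (h.mem_under_splitInto.1 h0).1
    exact absurd (h.isDecoration.under_unboxed i hi this) (h.isMismatched i hi)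

/-! ### Merging undoes splitting -/

theorem mergeWith_splitInto (h : SplitData P D a B r) :
    mergeWith (P.splitInto D a B (B.erase a)) a (B.erase a) = D := by
  have hB : insert a (B.erase a) = B := Finset.insert_erase h.mem_self
  refine Marking.ext_fields ?_ ?_ ?_
  · ext H
    rw [mem_hues_mergeWith, mem_hues_splitInto, hB]
    constructor
    · rintro (rfl | ⟨h1 | h1 | h1, h2, h3⟩)
      · exact h.mem_hues
      · exact absurd h1 h2
      · exact absurd h1 h3
      · exact h1.2
    · intro hH
      by_cases hHB : H = B
      · exact Or.inl hHB
      · exact Or.inr ⟨Or.inr (Or.inr ⟨hHB, hH⟩), fun h0 => h.singleton_notMem (h0 ▸ hH),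
          fun h0 => h.erase_notMem (h0 ▸ hH)⟩
  · funext x
    rw [hue_mergeWith, hB]
    by_cases hx : D.hue x = B
    · rw [if_pos (h.hue_splitInto_or hx), hx]
    · rw [if_neg (mt h.hue_splitInto_iff.1 hx), h.hue_splitInto_of_ne hx]
  · ext x
    simp only [mergeWith, Finset.mem_union, h.mem_under_splitInto, Finset.mem_filter, h.min_eq_iff]
    constructor
    · rintro (h1 | h1)
      · exact h1.1
      · exact h.mem_under_of_mem h1.1
    · intro hx
      by_cases hxr : x = r
      · exact Or.inr ⟨hxr ▸ h.mem_erase, hxr⟩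
      · exact Or.inl ⟨hx, hxr⟩

theorem wantsToMerge (h : SplitData P D a B r) :
    P.WantsToMerge (P.splitInto D a B (B.erase a)) a (B.erase a) r :=
  ⟨mem_hues_splitInto.2 (Or.inl rfl), mem_hues_splitInto.2 (Or.inr (Or.inl rfl)), h.min_erase,
    h.isDecoration.hues_monochromatic B h.mem_hues r h.mem a h.mem_self, h.lt, h.hue_splitInto_r⟩

/-- Since merging undoes the split, the effect of a split on the chain order follows from that of a
merge, without analyzing another walk. -/
theorem pair_sublist_iff (h : SplitData P D a B r) {c : Fin m} {x y : Fin n} :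
    [x, y] <+ P.chainOrder D c ↔
      [x, y] <+ P.chainOrder (P.splitInto D a B (B.erase a)) c ∧ x ≠ r ∧ y ≠ r := by
  have := h.wantsToMerge.pair_sublist_mergeWith h.isDecoration_splitInto h.isMismatched_splitInto
    (c := c) (x := x) (y := y)
  rwa [h.mergeWith_splitInto] at this

/-- This is the purpose of `q`. If some `x` of hue $\{a\}$ stood before `r`, then its chain in `D`
would start below `r`, and `q` would exist. As `q` gets hue $B'$, it targets `r`, which must follow
it directly; but `x` stands between them. -/
theorem isFirstOfHue (h : SplitData P D a B r) :
    P.IsFirstOfHue (P.splitInto D a B (B.erase a)) (P.color a) {a} r := by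
  have hw := h.wantsToMerge
  have hwalk := P.isWalk_chainOrder (P.splitInto D a B (B.erase a)) (P.color a)
  have hnd := hwalk.nodup
  refine ⟨hw.mem_chainOrder h.isDecoration_splitInto h.isMismatched_splitInto, hw.hue_eq,
    fun x hxr hxa => ?_⟩
  have hxB : D.hue x = B := h.hue_splitInto_iff.1 (Or.inl hxa)
  have hx : x ∈ P.chainOrder D (P.color a) := by
    have := hw.mem_chainOrder_mergeWith h.isDecoration_splitInto h.isMismatched_splitInto
      (c := P.color a) (x := x)
    rw [h.mergeWith_splitInto] at this
    exact this.2 ⟨List.mem_left_of_pair_sublist hxr, hnd.pair_sublist_ne hxr⟩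
  -- A chain head at or before `x` stands before `r` after the split and is still a head, because a
  -- changed target can only be `r`. Hence it is less than `r`.
  have hcond : ∃ l ∈ P.numberChains D (P.color a),
      (∃ i ∈ l.head?, (i : WithTop (Fin n)) < (B.erase a).min) ∧ ∃ x ∈ l, D.hue x = B := by
    rw [P.exists_chain_iff]
    refine ⟨x, hx, hxB, fun s hs hst => ?_⟩
    rw [h.min_erase, WithTop.coe_lt_coe]
    have hsr : [s, r] <+ P.chainOrder (P.splitInto D a B (B.erase a)) (P.color a) := by
      rcases hs with rfl | hs
      · exact hxr
      · exact hnd.pair_sublist_trans (h.pair_sublist_iff.1 hs).1 hxr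
    have hsne := hnd.pair_sublist_ne hsr
    refine hwalk.lt_of_no_pred (by simp) (fun z hz hzs => ?_) hsr
    refine hst z (h.pair_sublist_iff.2
      ⟨hz, hnd.pair_sublist_ne (hnd.pair_sublist_trans hz hsr), hsne⟩) ?_
    by_cases hzB : D.hue z = B
    · rcases h.hue_splitInto_or hzB with h1 | h1
      · rw [h1, Finset.min_singleton] at hzs
        rw [hzB, h.min_eq, hzs]
      · rw [h1, h.min_erase, WithTop.coe_inj] at hzs
        exact absurd hzs.symm hsne
    · rwa [h.hue_splitInto_of_ne hzB] at hzs
  obtain ⟨q, hq⟩ : ∃ q, (P.chainOrder D (P.color a)).find? (fun i => D.hue i = B) = some q := by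
    rw [← Option.isSome_iff_exists, List.find?_isSome]
    exact ⟨x, hx, by simpa using hxB⟩
  have hQ : P.splitQ D (P.color a) B (B.erase a) = some q := by
    rw [splitQ, if_pos hcond, hq]
  obtain ⟨hqf, hqB⟩ := h.of_splitQ hQ
  have hqr : q ≠ r := fun h0 => hqB (h0 ▸ h.mem_erase)
  have hqE : (P.splitInto D a B (B.erase a)).hue q = B.erase a :=
    h.hue_splitInto_eq_erase_iff.2 (Or.inl (h.splitHueAux_eq_erase_iff.2 ⟨hqr, Or.inr hQ⟩))
  have hqx : q ≠ x := by
    rintro rfl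
    exact h.erase_ne_singleton (hqE.symm.trans hxa)
  have hqxD : [q, x] <+ P.chainOrder D (P.color a) :=
    (List.pair_sublist_total hqf.1 hx hqx).resolve_right fun h0 => hqf.2.2 x h0 hxB
  have hqxE := (h.pair_sublist_iff.1 hqxD).1
  rcases hwalk.eq_or_pair_sublist_of_target_mem (hnd.pair_sublist_trans hqxE hxr)
    (by rw [hqE, h.min_erase]) hqxE with h0 | h0
  · exact hnd.pair_sublist_ne hxr h0
  · exact hnd.pair_sublist_asymm h0 hxr

/-- The permission set consists of numbers decided in the last step of the split. That step gives
hue $B'$ to an initial piece of their permission list, and the order of these numbers is the same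
before and after the split. -/
theorem hasPermission (h : SplitData P D a B r) :
    P.HasPermission (P.splitInto D a B (B.erase a)) a (B.erase a) := by
  have hw := h.wantsToMerge
  have hE := h.isDecoration_splitInto
  have hM := h.isMismatched_splitInto
  rw [hasPermission_iff]
  refine ⟨r, hw, h.isFirstOfHue, ?_⟩
  rintro x hx y hy hxy ⟨hxa, hyB⟩
  rw [mem_permissionSet, h.mem_under_splitInto] at hx hy
  -- The number `q` is the predecessor of `r`, by the result on merges applied to the merge that
  -- leads back to `D`.
  have hQ : ∀ q, P.splitQ D (P.color a) B (B.erase a) = some q ↔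
      [q, r] <+ P.chainOrder (P.splitInto D a B (B.erase a)) (P.color a) ∧
        ((P.splitInto D a B (B.erase a)).hue q).min = r := by
    intro q
    rw [← hw.splitQ_mergeWith hE hM h.isFirstOfHue, h.mergeWith_splitInto,
      Finset.insert_erase h.mem_self]
  have haux : ∀ z, D.hue z = B → z ≠ r → ¬ (z ∈ D.under ∧ z ≠ r) →
      P.splitQ D (P.color a) B (B.erase a) ≠ some z → P.splitHueAux D a B (B.erase a) z = B :=
    fun z h1 h2 h3 h4 => h.splitHueAux_eq_iff.2
      ⟨h1, fun h5 => h3 ⟨h.mem_under_of_mem h5, h2⟩, h4⟩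
  have hauxx := haux x (h.hue_splitInto_iff.1 (Or.inl hxa)) hx.2.2.1 hx.1
    (mt (hQ x).1 hx.2.2.2)
  have hauxy := haux y (h.hue_splitInto_iff.1 (Or.inr hyB)) hy.2.2.1 hy.1
    (mt (hQ y).1 hy.2.2.2)
  have hyI : y ∈ P.splitInitial D a B (B.erase a) := by
    refine (h.hue_splitInto_eq_erase_iff.1 hyB).resolve_left fun h0 => ?_
    exact h.erase_ne (h0.symm.trans hauxy)
  have hxI : x ∉ P.splitInitial D a B (B.erase a) := fun h0 =>
    h.erase_ne_singleton ((h.hue_splitInto_eq_erase_iff.2 (Or.inr h0)).symm.trans hxa)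
  have hxL : x ∈ P.permissionList D (P.color a)
      (Finset.univ.filter fun x => P.splitHueAux D a B (B.erase a) x = B) := by
    rw [mem_permissionList]
    have := h.splitHueAux_eq_iff.1 hauxx
    exact ⟨by simp [hauxx], h.mem_chainOrder_or_color_ne this.1 this.2.1⟩
  have hyx := (pair_sublist_permissionList.1 (List.pair_sublist_of_mem_take hyI hxL hxI)).2.2
  have hyx' := hw.permissionBefore_mergeWith hE hM (c := P.color a) hy.2.2.1 hx.2.2.1
  rw [h.mergeWith_splitInto] at hyx'
  exact hxy.asymm (hyx'.1 hyx)

end SplitData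

end ColoredExponents

theorem IsSignReversingInvolution.sum_eq {α : Type*} [DecidableEq α] {X : Finset α} {ε : α → ℤ}
    {φ : α → α} (h : IsSignReversingInvolution X ε φ) :
    ∑ x ∈ X, ε x = ∑ x ∈ X.filter (fun x => φ x = x), ε x := by
  rw [← Finset.sum_filter_add_sum_filter_not X (fun x => φ x = x), add_eq_left]
  refine Finset.sum_involution (fun x _ => φ x) ?_ ?_ ?_ ?_
  · intro x hx
    rw [Finset.mem_filter] at hx
    rw [h.2.2 x hx.1 hx.2, add_neg_cancel]
  · intro x hx _
    exact (Finset.mem_filter.1 hx).2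
  · intro x hx
    rw [Finset.mem_filter] at hx ⊢
    refine ⟨h.1 x hx.1, fun h0 => hx.2 ?_⟩
    rwa [h.2.1 x hx.1, eq_comm] at h0
  · intro x hx
    exact h.2.1 x (Finset.mem_filter.1 hx).1

namespace ColoredExponents

variable {n m : ℕ} {P : ColoredExponents n m} {D E : Marking n} {a t r : Fin n}
  {B : Finset (Fin n)}

/-! ### The first involution -/

theorem phiUnder_isDecoration (hD : P.IsDecoration D) : P.IsDecoration (P.phiUnder D) := by
  rw [phiUnder]
  split_ifs with h
  · have hx := Finset.min'_mem _ h
    generalize (P.matchedUnboxed D).min' h = x at hx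
    simp only [matchedUnboxed, Finset.mem_filter, Finset.mem_univ, true_and] at hx
    refine ⟨hD.hues_nonempty, hD.hues_disjoint, hD.hues_union, hD.hues_monochromatic,
      hD.hue_crossed, hD.hue_mem, hD.hue_block, hD.hue_card, fun i hi => ?_, fun i hi h0 => ?_⟩
    · rw [← hD.under_boxed i hi]
      have : i ≠ x := by
        rintro rfl
        exact hx.1 hi
      simp [Finset.mem_symmDiff, this]
    · by_cases hix : i = x
      · exact hix ▸ hx.2
      · simp only [Finset.mem_symmDiff, Finset.mem_singleton, hix, not_false_eq_true, and_true,
          false_and, or_false] at h0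
        exact hD.under_unboxed i hi h0
  · exact hD

/-- Matching depends on the hues only, so a second application toggles the same number. -/
theorem matchedUnboxed_phiUnder (D : Marking n) :
    P.matchedUnboxed (P.phiUnder D) = P.matchedUnboxed D := by
  rw [phiUnder]
  split_ifs with h <;> rfl

theorem phiUnder_phiUnder (D : Marking n) : P.phiUnder (P.phiUnder D) = D := by
  by_cases h : (P.matchedUnboxed D).Nonempty
  · have h1 : P.phiUnder D = { D with under := symmDiff D.under {(P.matchedUnboxed D).min' h} } :=
      dif_pos h
    have h2 := P.matchedUnboxed_phiUnder D
    have h3 : (P.matchedUnboxed (P.phiUnder D)).Nonempty := h2 ▸ h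
    have h4 : (P.matchedUnboxed (P.phiUnder D)).min' h3 = (P.matchedUnboxed D).min' h := by
      simp only [h2]
    rw [phiUnder, dif_pos h3, h4, h1]
    simp
  · have h1 : P.phiUnder D = D := dif_neg h
    rw [h1, h1]

theorem phiUnder_eq_iff : P.phiUnder D = D ↔ P.IsMismatched D := by
  have hiff : P.IsMismatched D ↔ ¬ (P.matchedUnboxed D).Nonempty := by
    rw [Finset.not_nonempty_iff_eq_empty, Finset.eq_empty_iff_forall_notMem, IsMismatched]
    simp [matchedUnboxed]
  rw [hiff]
  constructor
  · intro h0 h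
    rw [phiUnder, dif_pos h] at h0
    have h1 := congrArg Marking.under h0
    simp at h1
  · exact fun h => dif_neg h

theorem sign_phiUnder (h : P.phiUnder D ≠ D) : (P.phiUnder D).sign = - D.sign := by
  rw [phiUnder] at h ⊢
  split_ifs at h ⊢ with h1
  · generalize (P.matchedUnboxed D).min' h1 = x
    rw [Marking.sign, Marking.sign]
    by_cases hx : x ∈ D.under
    · have : symmDiff D.under {x} = D.under.erase x := by
        ext y
        simp only [Finset.mem_symmDiff, Finset.mem_singleton, Finset.mem_erase]
        constructor
        · rintro (h | ⟨rfl, h⟩)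
          · exact ⟨h.2, h.1⟩
          · exact absurd hx h
        · exact fun h => Or.inl ⟨h.2, h.1⟩
      rw [this, ← Finset.card_erase_add_one hx, pow_succ]
      ring
    · have : symmDiff D.under {x} = insert x D.under := by
        ext y
        simp only [Finset.mem_symmDiff, Finset.mem_singleton, Finset.mem_insert]
        constructor
        · tauto
        · rintro (rfl | h)
          · exact Or.inr ⟨rfl, hx⟩
          · refine Or.inl ⟨h, ?_⟩
            rintro rfl
            exact hx h
      rw [this, Finset.card_insert_of_notMem hx, pow_succ]
      ring
  · exact absurd rfl h

theorem mem_decorations : D ∈ P.decorations ↔ P.IsDecoration D := by simp [decorations]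

theorem isSignReversingInvolution_phiUnder :
    IsSignReversingInvolution P.decorations Marking.sign P.phiUnder :=
  ⟨fun _ hD => mem_decorations.2 (phiUnder_isDecoration (mem_decorations.1 hD)),
    fun D _ => phiUnder_phiUnder D, fun _ _ h => sign_phiUnder h⟩

theorem sum_decorations_eq :
    ∑ D ∈ P.decorations, D.sign = ∑ D ∈ P.mismatchedDecorations, D.sign := by
  rw [isSignReversingInvolution_phiUnder.sum_eq]
  refine Finset.sum_congr (Finset.ext fun D => ?_) fun _ _ => rfl
  rw [Finset.mem_filter, mem_mismatchedDecorations, mem_decorations, phiUnder_eq_iff]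

/-! ### The second involution -/

theorem mem_splitCandidates {i : Fin n} :
    i ∈ splitCandidates D ↔ ∃ B ∈ D.hues, 1 < B.card ∧ B.min = (i : WithTop (Fin n)) := by
  simp [splitCandidates]

theorem mem_mergeCandidates {i : Fin n} :
    i ∈ P.mergeCandidates D ↔ ∃ B ∈ D.hues, P.HasPermission D i B := by
  simp [mergeCandidates]

theorem HasPermission.mem_hues (h : P.HasPermission D t B) : B ∈ D.hues := by
  obtain ⟨r, hw, _⟩ := h
  exact hw.2.1

theorem HasPermission.singleton_mem (h : P.HasPermission D t B) : {t} ∈ D.hues := by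
  obtain ⟨r, hw, _⟩ := h
  exact hw.1

theorem SplitData.mem_splitCandidates (h : SplitData P D a B r) : a ∈ splitCandidates D :=
  ColoredExponents.mem_splitCandidates.2 ⟨B, h.mem_hues,
    Finset.one_lt_card.2 ⟨a, h.mem_self, r, h.mem, h.lt.ne⟩, h.min_eq⟩

theorem exists_splitData (hD : P.IsDecoration D) (hM : P.IsMismatched D)
    (ha : a ∈ splitCandidates D) : ∃ B r, SplitData P D a B r := by
  obtain ⟨B, hB, hcard, hmin⟩ := mem_splitCandidates.1 ha
  have hne : (B.erase a).Nonempty := by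
    rw [← Finset.card_pos, Finset.card_erase_of_mem (Finset.mem_of_min hmin)]
    omega
  exact ⟨B, (B.erase a).min' hne, hD, hM, hB, hmin, (Finset.coe_min' hne).symm⟩

theorem SplitData.splitBlock_eq (h : SplitData P D a B r) : splitBlock D a = B := by
  have : (D.hues.filter fun B => 1 < B.card ∧ B.min = (a : WithTop (Fin n))) = {B} := by
    ext H
    rw [Finset.mem_filter, Finset.mem_singleton]
    constructor
    · rintro ⟨hH, _, hmin⟩
      exact h.isDecoration.eq_of_mem hH h.mem_hues (Finset.mem_of_min hmin) h.mem_self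
    · rintro rfl
      exact ⟨h.mem_hues, Finset.one_lt_card.2 ⟨a, h.mem_self, r, h.mem, h.lt.ne⟩, h.min_eq⟩
  rw [splitBlock, this, Finset.sup_singleton, id]

theorem HasPermission.mergeBlock_eq (hD : P.IsDecoration D) (h : P.HasPermission D t B) :
    P.mergeBlock D t = B := by
  have : (D.hues.filter fun B => P.HasPermission D t B) = {B} := by
    ext H
    rw [Finset.mem_filter, Finset.mem_singleton]
    constructor
    · rintro ⟨_, hH⟩
      exact hD.hasPermission_unique hH h
    · rintro rfl
      exact ⟨h.mem_hues, h⟩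
  rw [mergeBlock, this, Finset.sup_singleton, id]

theorem min_lt_min_of_forall_lt {α : Type*} [LinearOrder α] {s s' : Finset α} {a : α}
    (ha : a ∈ s) (h : ∀ b ∈ s', a < b) : s.min < s'.min := by
  refine (Finset.min_le ha).trans_lt ?_
  rcases s'.eq_empty_or_nonempty with rfl | hs
  · rw [Finset.min_empty]
    exact WithTop.coe_lt_top a
  · rw [← Finset.coe_min' hs, WithTop.coe_lt_coe]
    exact h _ (Finset.min'_mem s' hs)

theorem SplitData.phiHue_eq (h : SplitData P D a B r) (h1 : ∀ b ∈ splitCandidates D, a ≤ b)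
    (h2 : ∀ b ∈ P.mergeCandidates D, a < b) : P.phiHue D = P.splitInto D a B (B.erase a) := by
  have hne : (splitCandidates D).Nonempty := ⟨a, h.mem_splitCandidates⟩
  have hmin : (splitCandidates D).min' hne = a :=
    le_antisymm (Finset.min'_le _ a h.mem_splitCandidates) (h1 _ (Finset.min'_mem _ hne))
  rw [phiHue, dif_pos ⟨hne, min_lt_min_of_forall_lt h.mem_splitCandidates h2⟩, hmin, splitAt,
    h.splitBlock_eq]

theorem HasPermission.phiHue_eq (hD : P.IsDecoration D) (h : P.HasPermission D t B)
    (h1 : ∀ b ∈ P.mergeCandidates D, t ≤ b) (h2 : ∀ b ∈ splitCandidates D, t < b) :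
    P.phiHue D = mergeWith D t B := by
  have ht : t ∈ P.mergeCandidates D := mem_mergeCandidates.2 ⟨B, h.mem_hues, h⟩
  have hne : (P.mergeCandidates D).Nonempty := ⟨t, ht⟩
  have hmin : (P.mergeCandidates D).min' hne = t :=
    le_antisymm (Finset.min'_le _ t ht) (h1 _ (Finset.min'_mem _ hne))
  have hlt := min_lt_min_of_forall_lt ht h2
  rw [phiHue, dif_neg fun h0 => h0.2.asymm hlt, dif_pos ⟨hne, hlt⟩, hmin, h.mergeBlock_eq hD]

/-- Thus the two minima that the map compares never coincide. -/
theorem notMem_mergeCandidates (hD : P.IsDecoration D) (ha : a ∈ splitCandidates D) :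
    a ∉ P.mergeCandidates D := by
  intro h
  obtain ⟨B, hB, hcard, hmin⟩ := mem_splitCandidates.1 ha
  obtain ⟨H, _, hH⟩ := mem_mergeCandidates.1 h
  rw [hD.eq_of_mem hB hH.singleton_mem (Finset.mem_of_min hmin) (Finset.mem_singleton_self a),
    Finset.card_singleton] at hcard
  exact lt_irrefl _ hcard

theorem phiHue_cases (hD : P.IsDecoration D) (hM : P.IsMismatched D) :
    (∃ a B r, SplitData P D a B r ∧ (∀ b ∈ splitCandidates D, a ≤ b) ∧
      ∀ b ∈ P.mergeCandidates D, a < b) ∨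
    (∃ t B, P.HasPermission D t B ∧ (∀ b ∈ P.mergeCandidates D, t ≤ b) ∧
      ∀ b ∈ splitCandidates D, t < b) ∨
    (splitCandidates D = ∅ ∧ P.mergeCandidates D = ∅) := by
  have split : ∀ hs : (splitCandidates D).Nonempty,
      (∀ b ∈ P.mergeCandidates D, (splitCandidates D).min' hs < b) →
      ∃ a B r, SplitData P D a B r ∧ (∀ b ∈ splitCandidates D, a ≤ b) ∧
        ∀ b ∈ P.mergeCandidates D, a < b := by
    intro hs h
    obtain ⟨B, r, hB⟩ := exists_splitData hD hM (Finset.min'_mem _ hs)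
    exact ⟨_, B, r, hB, fun b hb => Finset.min'_le _ b hb, h⟩
  have merge : ∀ hs : (P.mergeCandidates D).Nonempty,
      (∀ b ∈ splitCandidates D, (P.mergeCandidates D).min' hs < b) →
      ∃ t B, P.HasPermission D t B ∧ (∀ b ∈ P.mergeCandidates D, t ≤ b) ∧
        ∀ b ∈ splitCandidates D, t < b := by
    intro hs h
    obtain ⟨B, _, hB⟩ := mem_mergeCandidates.1 (Finset.min'_mem _ hs)
    exact ⟨_, B, hB, fun b hb => Finset.min'_le _ b hb, h⟩
  rcases (splitCandidates D).eq_empty_or_nonempty with hs | hs <;>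
    rcases (P.mergeCandidates D).eq_empty_or_nonempty with ht | ht
  · exact Or.inr (Or.inr ⟨hs, ht⟩)
  · exact Or.inr (Or.inl (merge ht (by simp [hs])))
  · exact Or.inl (split hs (by simp [ht]))
  · have hsm := Finset.min'_mem _ hs
    have htm := Finset.min'_mem _ ht
    rcases lt_trichotomy ((splitCandidates D).min' hs) ((P.mergeCandidates D).min' ht) with
      h | h | h
    · exact Or.inl (split hs fun b hb => h.trans_le (Finset.min'_le _ b hb))
    · exact absurd (h ▸ htm) (notMem_mergeCandidates hD hsm)
    · exact Or.inr (Or.inl (merge ht fun b hb => h.trans_le (Finset.min'_le _ b hb)))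

theorem phiHue_eq_self (hs : splitCandidates D = ∅) (ht : P.mergeCandidates D = ∅) :
    P.phiHue D = D := by
  rw [phiHue, dif_neg fun h => by simp [hs] at h, dif_neg fun h => by simp [ht] at h]

theorem sign_splitInto (h : SplitData P D a B r) :
    (P.splitInto D a B (B.erase a)).sign = - D.sign := by
  have : (P.splitInto D a B (B.erase a)).under = D.under.erase r := by
    ext x
    rw [h.mem_under_splitInto, Finset.mem_erase, and_comm]
  rw [Marking.sign, Marking.sign, this,
    ← Finset.card_erase_add_one (h.mem_under_of_mem h.mem_erase), pow_succ]
  ring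

theorem sign_mergeWith (hD : P.IsDecoration D) (hM : P.IsMismatched D)
    (h : P.HasPermission D t B) : (mergeWith D t B).sign = - D.sign := by
  obtain ⟨r, hw, _⟩ := h
  have : (mergeWith D t B).under = insert r D.under := by
    ext x
    rw [hw.mem_under_mergeWith, Finset.mem_insert, or_comm]
  rw [Marking.sign, Marking.sign, this, Finset.card_insert_of_notMem (hw.notMem_under hD hM),
    pow_succ]
  ring

theorem sign_ne_zero (D : Marking n) : D.sign ≠ 0 := by
  rw [Marking.sign]
  exact pow_ne_zero _ (by norm_num)

/-- After the merge `t` is the smallest minimum of a non-singleton hue, and a smaller merge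
candidate would have been one before, against the choice of `t`. So the next application splits at
`t`. -/
theorem phiHue_mergeWith (hD : P.IsDecoration D) (hM : P.IsMismatched D)
    (h : P.HasPermission D t B) (h1 : ∀ b ∈ P.mergeCandidates D, t ≤ b)
    (h2 : ∀ b ∈ splitCandidates D, t < b) : P.phiHue (mergeWith D t B) = D := by
  obtain ⟨r, hw, hf, hp⟩ := hasPermission_iff.1 h
  have he : (insert t B).erase t = B := Finset.erase_insert hw.notMem
  have hS : SplitData P (mergeWith D t B) t (insert t B) r :=
    ⟨hw.isDecoration_mergeWith hD hM, hw.isMismatched_mergeWith hD hM,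
      mem_hues_mergeWith.2 (Or.inl rfl), hw.min_insert, he.symm ▸ hw.2.2.1⟩
  rw [hS.phiHue_eq, he, hw.splitInto_mergeWith hD hM hf hp]
  · intro b hb
    obtain ⟨H, hH, hcard, hmin⟩ := mem_splitCandidates.1 hb
    rcases mem_hues_mergeWith.1 hH with rfl | hH
    · exact (WithTop.coe_injective (hw.min_insert.symm.trans hmin)).le
    · exact (h2 b (mem_splitCandidates.2 ⟨H, hH.1, hcard, hmin⟩)).le
  · intro b hb
    by_contra hbt
    rcases lt_or_eq_of_le (not_lt.1 hbt) with hbt | rfl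
    · obtain ⟨H, _, hH⟩ := mem_mergeCandidates.1 hb
      exact absurd (h1 b (mem_mergeCandidates.2 (hw.hasPermission_of_mergeWith hD hM hf hbt hH)))
        (not_le.2 hbt)
    · exact notMem_mergeCandidates hS.isDecoration hS.mem_splitCandidates hb

/-- A merge candidate below `a` created by the split would survive the merge that leads back to `D`,
where all candidates exceed `a`. -/
theorem phiHue_splitInto (h : SplitData P D a B r) (h1 : ∀ b ∈ splitCandidates D, a ≤ b)
    (h2 : ∀ b ∈ P.mergeCandidates D, a < b) :
    P.phiHue (P.splitInto D a B (B.erase a)) = D := by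
  rw [h.hasPermission.phiHue_eq h.isDecoration_splitInto, h.mergeWith_splitInto]
  · intro b hb
    by_contra hba
    obtain ⟨H, _, hH⟩ := mem_mergeCandidates.1 hb
    have := h.isDecoration_splitInto.hasPermission_mergeWith h.isMismatched_splitInto
      h.hasPermission (not_le.1 hba) hH
    rw [h.mergeWith_splitInto] at this
    exact hba (h2 b (mem_mergeCandidates.2 this)).le
  · intro b hb
    obtain ⟨H, hH, hcard, hmin⟩ := mem_splitCandidates.1 hb
    rcases SplitData.mem_hues_splitInto.1 hH with rfl | rfl | hH
    · simp at hcard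
    · rw [h.min_eq_iff] at hmin
      exact hmin ▸ h.lt
    · refine lt_of_le_of_ne (h1 b (mem_splitCandidates.2 ⟨H, hH.2, hcard, hmin⟩)) ?_
      rintro rfl
      exact hH.1 (h.isDecoration.eq_of_mem hH.2 h.mem_hues (Finset.mem_of_min hmin) h.mem_self)

theorem isSignReversingInvolution_phiHue :
    IsSignReversingInvolution P.mismatchedDecorations Marking.sign P.phiHue := by
  have key : ∀ D ∈ P.mismatchedDecorations, P.phiHue D ∈ P.mismatchedDecorations ∧
      P.phiHue (P.phiHue D) = D ∧ (P.phiHue D ≠ D → (P.phiHue D).sign = - D.sign) := by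
    intro D hD
    have hD' := mem_mismatchedDecorations.1 hD
    rcases phiHue_cases hD'.1 hD'.2 with ⟨a, B, r, h, h1, h2⟩ | ⟨t, B, h, h1, h2⟩ | ⟨h1, h2⟩
    · rw [h.phiHue_eq h1 h2]
      exact ⟨mem_mismatchedDecorations.2 ⟨h.isDecoration_splitInto, h.isMismatched_splitInto⟩,
        phiHue_splitInto h h1 h2, fun _ => sign_splitInto h⟩
    · rw [h.phiHue_eq hD'.1 h1 h2]
      obtain ⟨r, hw, _⟩ := hasPermission_iff.1 h
      exact ⟨mem_mismatchedDecorations.2 ⟨hw.isDecoration_mergeWith hD'.1 hD'.2,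
        hw.isMismatched_mergeWith hD'.1 hD'.2⟩, phiHue_mergeWith hD'.1 hD'.2 h h1 h2,
        fun _ => sign_mergeWith hD'.1 hD'.2 h⟩
    · rw [phiHue_eq_self h1 h2]
      exact ⟨hD, phiHue_eq_self h1 h2, fun h0 => absurd rfl h0⟩
  exact ⟨fun D hD => (key D hD).1, fun D hD => (key D hD).2.1, fun D hD => (key D hD).2.2⟩

/-- A split or a merge changes the sign, which is nonzero, so a fixed point allows neither. -/
theorem phiHue_eq_self_iff (hD : D ∈ P.mismatchedDecorations) :
    P.phiHue D = D ↔ P.IsFixedPoint D := by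
  have hD' := mem_mismatchedDecorations.1 hD
  have hneg : - D.sign ≠ D.sign := fun h => sign_ne_zero D (by linarith)
  have hiff : P.phiHue D = D ↔ splitCandidates D = ∅ ∧ P.mergeCandidates D = ∅ := by
    refine ⟨fun h0 => ?_, fun h => phiHue_eq_self h.1 h.2⟩
    rcases phiHue_cases hD'.1 hD'.2 with ⟨a, B, r, h, h1, h2⟩ | ⟨t, B, h, h1, h2⟩ | h
    · rw [h.phiHue_eq h1 h2] at h0
      have := sign_splitInto h
      rw [h0] at this
      exact absurd this.symm hneg
    · rw [h.phiHue_eq hD'.1 h1 h2] at h0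
      have := sign_mergeWith hD'.1 hD'.2 h
      rw [h0] at this
      exact absurd this.symm hneg
    · exact h
  rw [hiff, IsFixedPoint]
  constructor
  · rintro ⟨h1, h2⟩
    refine ⟨hD, fun B hB => ?_, fun t B h => ?_⟩
    · have hne := hD'.1.hues_nonempty B hB
      refine le_antisymm (not_lt.1 fun h => ?_) (Finset.card_pos.2 hne)
      have : B.min' hne ∈ splitCandidates D :=
        mem_splitCandidates.2 ⟨B, hB, h, (Finset.coe_min' hne).symm⟩
      simp [h1] at this
    · have : t ∈ P.mergeCandidates D := mem_mergeCandidates.2 ⟨B, h.mem_hues, h⟩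
      simp [h2] at this
  · rintro ⟨_, h1, h2⟩
    refine ⟨Finset.eq_empty_iff_forall_notMem.2 fun a ha => ?_,
      Finset.eq_empty_iff_forall_notMem.2 fun t ht => ?_⟩
    · obtain ⟨B, hB, hcard, _⟩ := mem_splitCandidates.1 ha
      exact hcard.ne' (h1 B hB)
    · obtain ⟨B, _, hB⟩ := mem_mergeCandidates.1 ht
      exact h2 t B hB

theorem IsFixedPoint.under_eq_empty (h : P.IsFixedPoint D) : D.under = ∅ := by
  have hD := mem_mismatchedDecorations.1 h.1
  refine Finset.eq_empty_iff_forall_notMem.2 fun x hx => ?_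
  obtain ⟨B, hB, hxB, j, hj, hjx⟩ := (hD.1.mem_under_iff hD.2).1 hx
  obtain ⟨b, rfl⟩ := Finset.card_eq_one.1 (h.2.1 B hB)
  rw [Finset.mem_singleton] at hxB hj
  exact hjx.ne (hj.trans hxB.symm)

theorem IsFixedPoint.sign_eq_one (h : P.IsFixedPoint D) : D.sign = 1 := by
  rw [Marking.sign, h.under_eq_empty, Finset.card_empty, pow_zero]

theorem sum_mismatchedDecorations_eq :
    ∑ D ∈ P.mismatchedDecorations, D.sign = (P.fixedPointDecorations.card : ℤ) := by
  have h : P.fixedPointDecorations =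
      P.mismatchedDecorations.filter (fun D => P.phiHue D = D) := by
    ext D
    simp only [fixedPointDecorations, Finset.mem_filter, Finset.mem_univ, true_and]
    exact ⟨fun h => ⟨h.1, (phiHue_eq_self_iff h.1).2 h⟩, fun h => (phiHue_eq_self_iff h.1).1 h.2⟩
  rw [isSignReversingInvolution_phiHue.sum_eq, h, Finset.card_eq_sum_ones, Nat.cast_sum,
    Nat.cast_one]
  refine Finset.sum_congr rfl fun D hD => ?_
  rw [Finset.mem_filter] at hD
  exact ((phiHue_eq_self_iff hD.1).1 hD.2).sign_eq_one

end ColoredExponents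

/-! ### Counting functions with prescribed fiber sizes -/

section Assignments

variable {α β : Type*} [Fintype α] [DecidableEq α] [Fintype β] [DecidableEq β]

/-- The functions that map `T` to `s` in such a way that the fiber of `b ∈ s` has `c b` elements,
and that take the value `d` outside of `T`. -/
def assignments (T : Finset α) (s : Finset β) (c : β → ℕ) (d : β) : Finset (α → β) :=
  Finset.univ.filter fun f => (∀ x ∈ T, f x ∈ s) ∧ (∀ x, x ∉ T → f x = d) ∧
    ∀ b ∈ s, (Finset.univ.filter fun x => f x = b).card = c b

theorem mem_assignments {T : Finset α} {s : Finset β} {c : β → ℕ} {d : β} {f : α → β} :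
    f ∈ assignments T s c d ↔ (∀ x ∈ T, f x ∈ s) ∧ (∀ x, x ∉ T → f x = d) ∧
      ∀ b ∈ s, (Finset.univ.filter fun x => f x = b).card = c b := by
  simp [assignments]

/-- With the fiber `A` of `b` prescribed, its elements may be treated as lying outside of the
domain, by giving them the default value `d`. -/
theorem card_assignments_fiber {s : Finset β} {c : β → ℕ} {d b : β} (hb : b ∉ s) (hd : d ∉ s)
    (hbd : d ≠ b) {T A : Finset α} (hA : A ∈ T.powersetCard (c b)) :
    ((assignments T (insert b s) c d).filter fun f =>
      (Finset.univ.filter fun x => f x = b) = A).card = (assignments (T \ A) s c d).card := by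
  rw [Finset.mem_powersetCard] at hA
  refine Finset.card_nbij' (fun f x => if x ∈ A then d else f x)
    (fun g x => if x ∈ A then b else g x) ?_ ?_ ?_ ?_
  · intro f hf
    simp only [Finset.coe_filter, Set.mem_ofPred_eq, mem_assignments, Finset.mem_insert] at hf
    obtain ⟨⟨h1, h2, h3⟩, h4⟩ := hf
    have h5 : ∀ x, f x = b ↔ x ∈ A := fun x => by rw [← h4]; simp
    simp only [Finset.mem_coe, mem_assignments, Finset.mem_sdiff]
    refine ⟨fun x hx => ?_, fun x hx => ?_, fun e he => ?_⟩
    · rw [if_neg hx.2]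
      exact (h1 x hx.1).resolve_left fun h => hx.2 ((h5 x).1 h)
    · split_ifs with h
      · rfl
      · exact h2 x fun h0 => hx ⟨h0, h⟩
    · rw [← h3 e (Or.inr he)]
      congr 1
      ext x
      simp only [Finset.mem_filter, Finset.mem_univ, true_and]
      split_ifs with h
      · rw [(h5 x).2 h]
        constructor
        · rintro rfl
          exact absurd he hd
        · rintro rfl
          exact absurd he hb
      · rfl
  · intro g hg
    simp only [Finset.mem_coe, mem_assignments, Finset.mem_sdiff] at hg
    obtain ⟨h1, h2, h3⟩ := hg
    have h5 : ∀ x, (if x ∈ A then b else g x) = b ↔ x ∈ A := by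
      intro x
      split_ifs with h
      · simp [h]
      · simp only [h, iff_false]
        intro hx
        by_cases hT : x ∈ T
        · exact hb (hx ▸ h1 x ⟨hT, h⟩)
        · exact hbd ((h2 x fun h0 => hT h0.1).symm.trans hx)
    simp only [Finset.coe_filter, Set.mem_ofPred_eq, mem_assignments, Finset.mem_insert, h5]
    refine ⟨⟨fun x hx => ?_, fun x hx => ?_, fun e he => ?_⟩, ?_⟩
    · split_ifs with h
      · exact Or.inl h
      · exact Or.inr (h1 x ⟨hx, h⟩)
    · rw [if_neg fun h => hx (hA.1 h)]
      exact h2 x fun h0 => hx h0.1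
    · by_cases heb : e = b
      · subst heb
        simp only [h5]
        rw [Finset.filter_mem_eq_inter, Finset.univ_inter, hA.2]
      · rw [← h3 e (he.resolve_left heb)]
        congr 1
        ext x
        simp only [Finset.mem_filter, Finset.mem_univ, true_and]
        split_ifs with h
        · rw [h2 x fun h0 => h0.2 h]
          constructor
          · rintro rfl
            exact absurd rfl heb
          · rintro rfl
            exact absurd (he.resolve_left heb) hd
        · rfl
    · rw [Finset.filter_mem_eq_inter, Finset.univ_inter]
  · intro f hf
    simp only [Finset.coe_filter, Set.mem_ofPred_eq] at hf
    funext x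
    dsimp only
    split_ifs with h
    · rw [← hf.2] at h
      exact (Finset.mem_filter.1 h).2.symm
    · rfl
  · intro g hg
    simp only [Finset.mem_coe, mem_assignments, Finset.mem_sdiff] at hg
    funext x
    dsimp only
    split_ifs with h
    · exact (hg.2.1 x fun h0 => h0.2 h).symm
    · rfl

/-- Choosing the fiber of one value gives the binomial recursion of the multinomial coefficient. -/
theorem card_assignments (s : Finset β) (c : β → ℕ) (d : β) (hd : d ∉ s) (T : Finset α)
    (hT : T.card = ∑ b ∈ s, c b) : (assignments T s c d).card = Nat.multinomial s c := by
  induction s using Finset.induction_on generalizing T with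
  | empty =>
    rw [Finset.sum_empty, Finset.card_eq_zero] at hT
    subst hT
    rw [Nat.multinomial_empty, Finset.card_eq_one]
    refine ⟨fun _ => d, ?_⟩
    ext f
    simp [mem_assignments, funext_iff]
  | insert b s hb ih =>
    rw [Finset.mem_insert, not_or] at hd
    rw [Finset.sum_insert hb] at hT
    rw [Nat.multinomial_insert hb, Finset.card_eq_sum_card_fiberwise (t := T.powersetCard (c b))
      (f := fun f => Finset.univ.filter fun x => f x = b)]
    · have h : ∀ A ∈ T.powersetCard (c b), ((assignments T (insert b s) c d).filter fun f =>
          (Finset.univ.filter fun x => f x = b) = A).card = Nat.multinomial s c := by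
        intro A hA
        rw [card_assignments_fiber hb hd.2 hd.1 hA]
        rw [Finset.mem_powersetCard] at hA
        refine ih hd.2 (T \ A) ?_
        rw [Finset.card_sdiff_of_subset hA.1, hT, hA.2, Nat.add_sub_cancel_left]
      rw [Finset.sum_congr rfl h, Finset.sum_const, Finset.card_powersetCard, hT, smul_eq_mul]
    · intro f hf
      rw [Finset.mem_coe, mem_assignments] at hf
      rw [Finset.mem_coe, Finset.mem_powersetCard]
      refine ⟨fun x hx => ?_, hf.2.2 b (Finset.mem_insert_self b s)⟩
      by_contra h
      exact hd.1 ((hf.2.1 x h).symm.trans (Finset.mem_filter.1 hx).2)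

end Assignments

/-! ### Non-minimal elements of the parts of a partition -/

namespace Finpartition

variable {n : ℕ} (Q : Finpartition (Finset.univ : Finset (Fin n)))

/-- The numbers that are not the minimum of their part. -/
def nonMinima : Finset (Fin n) := Finset.univ.filter fun x => ∃ y ∈ Q.part x, y < x

variable {Q}

theorem mem_nonMinima {x : Fin n} : x ∈ Q.nonMinima ↔ ∃ y ∈ Q.part x, y < x := by
  simp [nonMinima]

theorem mem_part_iff_eq {x y : Fin n} : y ∈ Q.part x ↔ Q.part y = Q.part x := by
  rw [Q.mem_part_iff_part_eq_part (Finset.mem_univ y) (Finset.mem_univ x)]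

theorem self_mem_part (x : Fin n) : x ∈ Q.part x := Q.mem_part_self.2 (Finset.mem_univ x)

theorem part_mem_parts (x : Fin n) : Q.part x ∈ Q.parts := Q.part_mem.2 (Finset.mem_univ x)

theorem exists_eq_part {A : Finset (Fin n)} (hA : A ∈ Q.parts) : ∃ x, A = Q.part x := by
  obtain ⟨x, hx⟩ := Q.nonempty_of_mem_parts hA
  exact ⟨x, (Q.part_eq_of_mem hA hx).symm⟩

theorem card_filter_nonMinima {A : Finset (Fin n)} (hA : A ∈ Q.parts) :
    (Q.nonMinima.filter fun x => Q.part x = A).card = A.card - 1 := by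
  have hne := Q.nonempty_of_mem_parts hA
  have : (Q.nonMinima.filter fun x => Q.part x = A) = A.erase (A.min' hne) := by
    ext x
    rw [Finset.mem_filter, mem_nonMinima, Finset.mem_erase, Q.part_eq_iff_mem hA]
    constructor
    · rintro ⟨⟨y, hy, hyx⟩, hx⟩
      rw [Q.part_eq_of_mem hA hx] at hy
      exact ⟨((A.min'_le y hy).trans_lt hyx).ne', hx⟩
    · rintro ⟨h1, hx⟩
      rw [Q.part_eq_of_mem hA hx]
      exact ⟨⟨A.min' hne, A.min'_mem hne, lt_of_le_of_ne (A.min'_le x hx) h1.symm⟩, hx⟩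
  rw [this, Finset.card_erase_of_mem (A.min'_mem hne)]

theorem card_nonMinima : Q.nonMinima.card = ∑ A ∈ Q.parts, (A.card - 1) := by
  rw [Finset.card_eq_sum_card_fiberwise (t := Q.parts) (f := Q.part)]
  · exact Finset.sum_congr rfl fun A hA => card_filter_nonMinima hA
  · intro x _
    exact part_mem_parts x

theorem card_nonMinima_add : Q.nonMinima.card + Q.parts.card = n := by
  have h1 : ∑ A ∈ Q.parts, A.card = n := by
    rw [Q.sum_card_parts, Finset.card_univ, Fintype.card_fin]
  rw [card_nonMinima, Finset.card_eq_sum_ones, ← Finset.sum_add_distrib]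
  refine (Finset.sum_congr rfl fun A hA => ?_).trans h1
  exact Nat.sub_add_cancel (Finset.card_pos.2 (Q.nonempty_of_mem_parts hA))

end Finpartition

/-! ### Decorations as partitions with assigned parts -/

namespace ColoredExponents

variable {n m : ℕ} {P : ColoredExponents n m} {D : Marking n}
  {Q : Finpartition (Finset.univ : Finset (Fin n))} {f : Fin n → Finset (Fin n)}

theorem boxed_of_lt {x y : Fin n} (hyx : y < x) (hc : P.color y = P.color x) (hx : x ∈ P.boxed) :
    y ∈ P.boxed :=
  mem_boxed.2 (P.k_sorted y x hyx hc (mem_boxed.1 hx)).1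

theorem lt_of_notMem_boxed {x y : Fin n} (hc : P.color y = P.color x) (hy : y ∈ P.boxed)
    (hx : x ∉ P.boxed) : y < x := by
  by_contra h
  rcases lt_or_eq_of_le (not_lt.1 h) with h | rfl
  · exact hx (boxed_of_lt h hc.symm hy)
  · exact hx hy

theorem kSum_inter_boxed (A : Finset (Fin n)) : P.kSum (A ∩ P.boxed) = P.kSum A := by
  rw [kSum, kSum]
  refine Finset.sum_subset Finset.inter_subset_left fun x hx hx' => ?_
  by_contra h
  exact hx' (Finset.mem_inter.2 ⟨hx, mem_boxed.2 (Nat.pos_of_ne_zero h)⟩)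

theorem inter_boxed_nonempty {A : Finset (Fin n)} (h : 0 < P.kSum A) : (A ∩ P.boxed).Nonempty := by
  by_contra h0
  rw [Finset.not_nonempty_iff_eq_empty] at h0
  rw [← kSum_inter_boxed, h0] at h
  simp [kSum] at h

theorem card_crossed (P : ColoredExponents n m) : P.crossed.card = 3 := by
  have h1 : P.crossed.card = (Finset.univ.filter fun c : Fin m => (c : ℕ) < 3).card := by
    refine Finset.card_bij (fun i _ => P.color i) ?_ ?_ ?_
    · intro i hi
      simp only [crossed, Finset.mem_filter, Finset.mem_univ, true_and] at hi ⊢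
      exact hi.1
    · intro i hi j hj hij
      simp only [crossed, Finset.mem_filter, Finset.mem_univ, true_and] at hi hj
      exact le_antisymm (hi.2 j hij.symm) (hj.2 i hij)
    · intro c hc
      obtain ⟨i, hi⟩ := P.color_surjective c
      have hne : (Finset.univ.filter fun j => P.color j = c).Nonempty := ⟨i, by simp [hi]⟩
      have hmin := Finset.min'_mem _ hne
      rw [Finset.mem_filter] at hmin hc
      refine ⟨_, ?_, hmin.2⟩
      rw [crossed, Finset.mem_filter, hmin.2]
      exact ⟨Finset.mem_univ _, hc.2, fun j hj => Finset.min'_le _ j (by simp [hj])⟩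
  have h2 : (Finset.univ.filter fun c : Fin m => (c : ℕ) < 3) =
      Finset.univ.image (Fin.castLE P.three_le) := by
    ext c
    simp only [Finset.mem_filter, Finset.mem_univ, true_and, Finset.mem_image]
    constructor
    · exact fun h => ⟨⟨c, h⟩, rfl⟩
    · rintro ⟨d, rfl⟩
      exact d.2
  rw [h1, h2, Finset.card_image_of_injective _ (Fin.castLE_injective _), Finset.card_univ,
    Fintype.card_fin]

/-- The set partitions that contribute to the alternating sum. -/
def Admissible (P : ColoredExponents n m) (Q : Finpartition (Finset.univ : Finset (Fin n))) :
    Prop :=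
  (∀ A ∈ Q.parts, P.Monochromatic A) ∧ ∀ A ∈ Q.parts, A.card ≤ P.kSum A + 1

/-- The minima of the parts that are not crossed out. -/
def freeMinima (P : ColoredExponents n m) (Q : Finpartition (Finset.univ : Finset (Fin n))) :
    Finset (Fin n) :=
  Finset.univ.filter fun x => x ∉ P.crossed ∧ x ∉ Q.nonMinima

theorem mem_freeMinima {x : Fin n} : x ∈ P.freeMinima Q ↔ x ∉ P.crossed ∧ x ∉ Q.nonMinima := by
  simp [freeMinima]

/-- The ways of assigning a part to each free minimum, counted by the multinomial coefficient. -/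
def partAssignments (P : ColoredExponents n m) (Q : Finpartition (Finset.univ : Finset (Fin n))) :
    Finset (Fin n → Finset (Fin n)) :=
  assignments (P.freeMinima Q) Q.parts (fun A => P.kSum A + 1 - A.card) ∅

/-- The decoration given by a partition and an assignment of parts to the free minima. -/
def toMarking (P : ColoredExponents n m) (Q : Finpartition (Finset.univ : Finset (Fin n)))
    (f : Fin n → Finset (Fin n)) : Marking n where
  hues := (Q.parts.image (· ∩ P.boxed)).erase ∅
  hue x := if x ∈ P.freeMinima Q then f x ∩ P.boxed else
    if x ∈ P.crossed then ∅ else Q.part x ∩ P.boxed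
  under := Q.nonMinima

theorem Admissible.color_eq (hQ : P.Admissible Q) {x y : Fin n} (h : y ∈ Q.part x) :
    P.color y = P.color x :=
  hQ.1 _ (Finpartition.part_mem_parts x) y h x (Finpartition.self_mem_part x)

theorem Admissible.notMem_nonMinima (hQ : P.Admissible Q) {x : Fin n} (hx : x ∈ P.crossed) :
    x ∉ Q.nonMinima := by
  rw [Finpartition.mem_nonMinima]
  rintro ⟨y, hy, hyx⟩
  rw [crossed, Finset.mem_filter] at hx
  exact absurd (hx.2.2 y (hQ.color_eq hy)) (not_le.2 hyx)

/-- The part has at least two elements, so $|A|\le k_A+1$ makes $k_A$ positive. -/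
theorem Admissible.part_inter_nonempty (hQ : P.Admissible Q) {x : Fin n} (hx : x ∈ Q.nonMinima) :
    (Q.part x ∩ P.boxed).Nonempty := by
  obtain ⟨y, hy, hyx⟩ := Finpartition.mem_nonMinima.1 hx
  have h1 : 1 < (Q.part x).card :=
    Finset.one_lt_card.2 ⟨y, hy, x, Finpartition.self_mem_part x, hyx.ne⟩
  have h2 := hQ.2 _ (Finpartition.part_mem_parts (Q := Q) x)
  exact inter_boxed_nonempty (by omega)

/-- A part that receives a number has a positive quota $k_A+1-|A|$, so $k_A\ge|A|\ge 1$. -/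
theorem assignment_inter_nonempty (hf : f ∈ P.partAssignments Q) {x : Fin n}
    (hx : x ∈ P.freeMinima Q) : f x ∈ Q.parts ∧ (f x ∩ P.boxed).Nonempty := by
  rw [partAssignments, mem_assignments] at hf
  have h1 := hf.1 x hx
  refine ⟨h1, inter_boxed_nonempty ?_⟩
  have h2 : 0 < (Finset.univ.filter fun y => f y = f x).card := Finset.card_pos.2 ⟨x, by simp⟩
  rw [hf.2.2 _ h1] at h2
  have := Finset.card_pos.2 (Q.nonempty_of_mem_parts h1)
  omega

theorem eq_of_inter_boxed_eq {A A' : Finset (Fin n)} (hA : A ∈ Q.parts) (hA' : A' ∈ Q.parts)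
    (hne : (A ∩ P.boxed).Nonempty) (h : A ∩ P.boxed = A' ∩ P.boxed) : A = A' := by
  obtain ⟨x, hx⟩ := hne
  have hx' := hx
  rw [h] at hx'
  exact (Q.part_eq_of_mem hA (Finset.mem_inter.1 hx).1).symm.trans
    (Q.part_eq_of_mem hA' (Finset.mem_inter.1 hx').1)

/-- A crossed out number is the minimum of its color and hence of its part, so both sides are
$\ell-3$; on the right, $(n-3)+\ell-n$. -/
theorem card_freeMinima (hQ : P.Admissible Q) :
    (P.freeMinima Q).card = ∑ A ∈ Q.parts, (P.kSum A + 1 - A.card) := by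
  have h1 : (P.freeMinima Q).card + P.crossed.card + Q.nonMinima.card = n := by
    have h2 : (P.freeMinima Q) = Finset.univ \ (P.crossed ∪ Q.nonMinima) := by
      ext x
      simp [mem_freeMinima]
    have h3 : Disjoint P.crossed Q.nonMinima :=
      Finset.disjoint_left.2 fun x hx => hQ.notMem_nonMinima hx
    have h4 := Finset.card_sdiff_add_card_eq_card (Finset.subset_univ (P.crossed ∪ Q.nonMinima))
    rw [← h2, Finset.card_union_of_disjoint h3, Finset.card_univ, Fintype.card_fin] at h4
    omega
  have h5 : ∑ A ∈ Q.parts, (P.kSum A + 1 - A.card) + ∑ A ∈ Q.parts, A.card =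
      ∑ A ∈ Q.parts, P.kSum A + Q.parts.card := by
    rw [Finset.card_eq_sum_ones, ← Finset.sum_add_distrib, ← Finset.sum_add_distrib]
    exact Finset.sum_congr rfl fun A hA => Nat.sub_add_cancel (hQ.2 A hA)
  have h6 : ∑ A ∈ Q.parts, P.kSum A = ∑ i, P.k i := by
    simp only [kSum]
    have h := Finset.sum_biUnion (f := P.k) Q.disjoint
    rw [Q.biUnion_parts] at h
    exact h.symm
  have h7 : ∑ A ∈ Q.parts, A.card = n := by
    rw [Q.sum_card_parts, Finset.card_univ, Fintype.card_fin]
  have h8 := Finpartition.card_nonMinima_add (Q := Q)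
  have h9 := P.sum_k
  have h10 := P.card_crossed
  omega

theorem card_partAssignments (hQ : P.Admissible Q) :
    (P.partAssignments Q).card = P.multinomialTerm Q := by
  rw [multinomialTerm, if_pos hQ.2, partAssignments,
    card_assignments _ _ _ Q.empty_notMem_parts _ (card_freeMinima hQ)]

theorem mem_hues_toMarking {H : Finset (Fin n)} : H ∈ (P.toMarking Q f).hues ↔
    H.Nonempty ∧ ∃ A ∈ Q.parts, A ∩ P.boxed = H := by
  simp only [toMarking, Finset.mem_erase, Finset.mem_image, Finset.nonempty_iff_ne_empty]

/-- A hue gets its $k_A$ numbers from the $|A|-1$ non-minima of the part and the $k_A+1-|A|$ free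
minima assigned to it. Passing to boxed elements keeps distinct hues distinct, since every part that
is used contains a boxed number. -/
theorem isDecoration_toMarking (hQ : P.Admissible Q) (hf : f ∈ P.partAssignments Q) :
    P.IsDecoration (P.toMarking Q f) where
  hues_nonempty H hH := (mem_hues_toMarking.1 hH).1
  hues_disjoint H hH H' hH' hne := by
    obtain ⟨_, A, hA, rfl⟩ := mem_hues_toMarking.1 hH
    obtain ⟨_, A', hA', rfl⟩ := mem_hues_toMarking.1 hH'
    have : Disjoint A A' := Q.disjoint hA hA' fun h => hne (by rw [h])
    exact this.mono Finset.inter_subset_left Finset.inter_subset_left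
  hues_union := by
    ext x
    rw [Finset.mem_biUnion]
    simp only [mem_hues_toMarking, id]
    constructor
    · rintro ⟨H, ⟨_, A, hA, rfl⟩, hx⟩
      exact (Finset.mem_inter.1 hx).2
    · intro hx
      have : x ∈ Q.part x ∩ P.boxed := Finset.mem_inter.2 ⟨Finpartition.self_mem_part x, hx⟩
      exact ⟨_, ⟨⟨x, this⟩, Q.part x, Finpartition.part_mem_parts x, rfl⟩, this⟩
  hues_monochromatic H hH i hi j hj := by
    obtain ⟨_, A, hA, rfl⟩ := mem_hues_toMarking.1 hH
    exact hQ.1 A hA i (Finset.mem_inter.1 hi).1 j (Finset.mem_inter.1 hj).1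
  hue_crossed i hi := by
    have : i ∉ P.freeMinima Q := fun h => (mem_freeMinima.1 h).1 hi
    simp only [toMarking, if_neg this, if_pos hi]
  hue_mem i hi := by
    rw [mem_hues_toMarking]
    by_cases h : i ∈ P.freeMinima Q
    · simp only [toMarking, if_pos h]
      have := assignment_inter_nonempty hf h
      exact ⟨this.2, _, this.1, rfl⟩
    · simp only [toMarking, if_neg h, if_neg hi]
      have h1 : i ∈ Q.nonMinima := by
        rw [mem_freeMinima] at h
        tauto
      exact ⟨hQ.part_inter_nonempty h1, _, Finpartition.part_mem_parts i, rfl⟩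
  hue_block H hH i hi hj := by
    obtain ⟨_, A, hA, rfl⟩ := mem_hues_toMarking.1 hH
    obtain ⟨j, hj, hji⟩ := hj
    rw [Finset.mem_inter] at hi hj
    have hiA : Q.part i = A := Q.part_eq_of_mem hA hi.1
    have h1 : i ∈ Q.nonMinima := Finpartition.mem_nonMinima.2 ⟨j, hiA ▸ hj.1, hji⟩
    have h2 : i ∉ P.freeMinima Q := fun h => (mem_freeMinima.1 h).2 h1
    have h3 : i ∉ P.crossed := fun h => hQ.notMem_nonMinima h h1
    simp only [toMarking, if_neg h2, if_neg h3, hiA]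
  hue_card H hH := by
    obtain ⟨hne, A, hA, rfl⟩ := mem_hues_toMarking.1 hH
    have hf' := hf
    rw [partAssignments, mem_assignments] at hf'
    have hAne : A.Nonempty := Q.nonempty_of_mem_parts hA
    have hset : (Finset.univ.filter fun x => (P.toMarking Q f).hue x = A ∩ P.boxed) =
        (Finset.univ.filter fun x => f x = A) ∪ Q.nonMinima.filter fun x => Q.part x = A := by
      ext x
      rw [Finset.mem_union, Finset.mem_filter, Finset.mem_filter, Finset.mem_filter]
      simp only [Finset.mem_univ, true_and, toMarking]
      by_cases h1 : x ∈ P.freeMinima Q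
      · have h2 := (mem_freeMinima.1 h1).2
        simp only [if_pos h1, h2, false_and, or_false]
        constructor
        · intro h
          have := assignment_inter_nonempty hf h1
          exact eq_of_inter_boxed_eq this.1 hA this.2 h
        · rintro rfl
          rfl
      · have h2 : f x ≠ A := by
          rw [hf'.2.1 x h1]
          exact hAne.ne_empty.symm
        simp only [if_neg h1, h2, false_or]
        by_cases h3 : x ∈ P.crossed
        · simp [h3, hQ.notMem_nonMinima h3, hne.ne_empty.symm]
        · have h4 : x ∈ Q.nonMinima := by
            rw [mem_freeMinima] at h1
            tauto
          simp only [if_neg h3, h4, true_and]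
          constructor
          · exact eq_of_inter_boxed_eq (Finpartition.part_mem_parts x) hA
              (hQ.part_inter_nonempty h4)
          · rintro rfl
            rfl
    rw [hset, Finset.card_union_of_disjoint, hf'.2.2 A hA, Finpartition.card_filter_nonMinima hA,
      kSum_inter_boxed]
    · have := hQ.2 A hA
      have := Finset.card_pos.2 hAne
      omega
    · rw [Finset.disjoint_left]
      intro x h1 h2
      rw [Finset.mem_filter] at h1 h2
      have h3 : x ∉ P.freeMinima Q := fun h => (mem_freeMinima.1 h).2 h2.1
      exact hAne.ne_empty (h1.2.symm.trans (hf'.2.1 x h3))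
  under_boxed i hi := by
    have hiP : i ∈ Q.part i ∩ P.boxed := Finset.mem_inter.2 ⟨Finpartition.self_mem_part i, hi⟩
    simp only [mem_hues_toMarking]
    constructor
    · intro h
      obtain ⟨y, hy, hyi⟩ := Finpartition.mem_nonMinima.1 h
      exact ⟨_, ⟨⟨i, hiP⟩, _, Finpartition.part_mem_parts i, rfl⟩, hiP, y,
        Finset.mem_inter.2 ⟨hy, boxed_of_lt hyi (hQ.color_eq hy) hi⟩, hyi⟩
    · rintro ⟨H, ⟨_, A, hA, rfl⟩, hiA, j, hj, hji⟩
      refine Finpartition.mem_nonMinima.2 ⟨j, ?_, hji⟩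
      rw [Q.part_eq_of_mem hA (Finset.mem_inter.1 hiA).1]
      exact (Finset.mem_inter.1 hj).1
  under_unboxed i hi h := by
    have h1 : i ∈ Q.nonMinima := h
    have h2 : i ∉ P.freeMinima Q := fun h => (mem_freeMinima.1 h).2 h1
    have h3 : i ∉ P.crossed := fun h => hQ.notMem_nonMinima h h1
    obtain ⟨b, hb⟩ := hQ.part_inter_nonempty h1
    refine ⟨b, ?_, hQ.color_eq (Finset.mem_inter.1 hb).1⟩
    simp only [toMarking, if_neg h2, if_neg h3]
    exact hb

/-- The hue that determines the part of `x`, or `{x}` if the part of `x` is an unboxed singleton. -/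
def key (P : ColoredExponents n m) (D : Marking n) (x : Fin n) : Finset (Fin n) :=
  if x ∈ P.boxed then (D.hues.filter fun B => x ∈ B).sup id
  else if x ∈ D.under then D.hue x else {x}

theorem IsDecoration.key_of_mem (hD : P.IsDecoration D) {B : Finset (Fin n)} (hB : B ∈ D.hues)
    {x : Fin n} (hx : x ∈ B) : P.key D x = B := by
  have : (D.hues.filter fun B => x ∈ B) = {B} := by
    ext H
    rw [Finset.mem_filter, Finset.mem_singleton]
    constructor
    · exact fun h => hD.eq_of_mem h.1 hB h.2 hx
    · rintro rfl
      exact ⟨hB, hx⟩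
  rw [key, if_pos (hD.boxed_of_mem hB hx), this, Finset.sup_singleton, id]

theorem IsDecoration.key_of_boxed (hD : P.IsDecoration D) {x : Fin n} (hx : x ∈ P.boxed) :
    P.key D x ∈ D.hues ∧ x ∈ P.key D x := by
  obtain ⟨B, hB, hxB⟩ := hD.mem_boxed_iff.1 hx
  rw [hD.key_of_mem hB hxB]
  exact ⟨hB, hxB⟩

theorem IsDecoration.key_of_under (hD : P.IsDecoration D) {x : Fin n} (hx : x ∉ P.boxed)
    (hu : x ∈ D.under) : P.key D x = D.hue x ∧ D.hue x ∈ D.hues := by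
  rw [key, if_neg hx, if_pos hu]
  exact ⟨rfl, hD.hue_mem_of_hueMatches (hD.under_unboxed x hx hu)⟩

theorem key_of_notMem {x : Fin n} (hx : x ∉ P.boxed) (hu : x ∉ D.under) : P.key D x = {x} := by
  rw [key, if_neg hx, if_neg hu]

theorem key_toMarking (hQ : P.Admissible Q) (hf : f ∈ P.partAssignments Q) (x : Fin n) :
    P.key (P.toMarking Q f) x =
      if (Q.part x ∩ P.boxed).Nonempty then Q.part x ∩ P.boxed else {x} := by
  by_cases hx : x ∈ P.boxed
  · have hxP : x ∈ Q.part x ∩ P.boxed := Finset.mem_inter.2 ⟨Finpartition.self_mem_part x, hx⟩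
    rw [if_pos ⟨x, hxP⟩]
    exact (isDecoration_toMarking hQ hf).key_of_mem (mem_hues_toMarking.2
      ⟨⟨x, hxP⟩, _, Finpartition.part_mem_parts x, rfl⟩) hxP
  · by_cases hu : x ∈ Q.nonMinima
    · have h2 : x ∉ P.freeMinima Q := fun h => (mem_freeMinima.1 h).2 hu
      have h3 : x ∉ P.crossed := fun h => hQ.notMem_nonMinima h hu
      rw [if_pos (hQ.part_inter_nonempty hu), key, if_neg hx]
      simp only [toMarking, if_neg h2, if_neg h3, if_pos hu]
    · rw [key_of_notMem hx hu, if_neg]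
      rintro ⟨b, hb⟩
      rw [Finset.mem_inter] at hb
      exact hu (Finpartition.mem_nonMinima.2
        ⟨b, hb.1, lt_of_notMem_boxed (hQ.color_eq hb.1) hb.2 hx⟩)

/-- A part without boxed numbers has $k_A=0$, so admissibility makes it a singleton. Every other
part is identified by its boxed elements. -/
theorem key_toMarking_eq_iff (hQ : P.Admissible Q) (hf : f ∈ P.partAssignments Q) {x y : Fin n} :
    P.key (P.toMarking Q f) x = P.key (P.toMarking Q f) y ↔ Q.part x = Q.part y := by
  have hsing : ∀ {x}, ¬ (Q.part x ∩ P.boxed).Nonempty → Q.part x = {x} ∧ x ∉ P.boxed := by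
    intro x hx
    refine ⟨?_, fun h => hx ⟨x, Finset.mem_inter.2 ⟨Finpartition.self_mem_part x, h⟩⟩⟩
    have h1 := hQ.2 _ (Finpartition.part_mem_parts (Q := Q) x)
    have h2 : P.kSum (Q.part x) = 0 := by
      by_contra h
      exact hx (inter_boxed_nonempty (Nat.pos_of_ne_zero h))
    rw [h2, zero_add] at h1
    exact (Finset.eq_singleton_iff_unique_mem.2 ⟨Finpartition.self_mem_part x,
      fun y hy => Finset.card_le_one.1 h1 y hy x (Finpartition.self_mem_part x)⟩)
  rw [key_toMarking hQ hf, key_toMarking hQ hf]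
  constructor
  · intro h
    split_ifs at h with h1 h2 h2
    · exact eq_of_inter_boxed_eq (Finpartition.part_mem_parts x) (Finpartition.part_mem_parts y)
        h1 h
    · have : y ∈ Q.part x ∩ P.boxed := h ▸ Finset.mem_singleton_self y
      exact absurd (Finset.mem_inter.1 this).2 (hsing h2).2
    · have : x ∈ Q.part y ∩ P.boxed := h ▸ Finset.mem_singleton_self x
      exact absurd (Finset.mem_inter.1 this).2 (hsing h1).2
    · rw [Finset.singleton_injective h]
  · intro h
    rw [h]
    split_ifs with h1
    · rfl
    · rw [← h] at h1
      rw [← (hsing h1).1, h, (hsing (h ▸ h1)).1]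

theorem toMarking_injective {Q' : Finpartition (Finset.univ : Finset (Fin n))}
    {f' : Fin n → Finset (Fin n)} (hQ : P.Admissible Q) (hf : f ∈ P.partAssignments Q)
    (hQ' : P.Admissible Q') (hf' : f' ∈ P.partAssignments Q')
    (h : P.toMarking Q f = P.toMarking Q' f') : Q = Q' ∧ f = f' := by
  have hpart : ∀ x, Q.part x = Q'.part x := by
    intro x
    ext y
    rw [Finpartition.mem_part_iff_eq, Finpartition.mem_part_iff_eq, ← key_toMarking_eq_iff hQ hf,
      ← key_toMarking_eq_iff hQ' hf', h]
  have hQQ : Q = Q' := by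
    ext A
    constructor
    · intro hA
      obtain ⟨x, rfl⟩ := Finpartition.exists_eq_part hA
      rw [hpart]
      exact Finpartition.part_mem_parts x
    · intro hA
      obtain ⟨x, rfl⟩ := Finpartition.exists_eq_part hA
      rw [← hpart]
      exact Finpartition.part_mem_parts x
  subst hQQ
  refine ⟨rfl, funext fun x => ?_⟩
  by_cases hx : x ∈ P.freeMinima Q
  · have h1 := congrFun (congrArg Marking.hue h) x
    simp only [toMarking, if_pos hx] at h1
    have h2 := assignment_inter_nonempty hf hx
    exact eq_of_inter_boxed_eq h2.1 (assignment_inter_nonempty hf' hx).1 h2.2 h1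
  · rw [partAssignments, mem_assignments] at hf hf'
    rw [hf.2.1 x hx, hf'.2.1 x hx]

instance (P : ColoredExponents n m) (D : Marking n) : DecidableRel (Setoid.ker (P.key D)) :=
  fun x y => decEq (P.key D x) (P.key D y)

/-- The partition of all numbers given by a decoration. -/
def toPartition (P : ColoredExponents n m) (D : Marking n) :
    Finpartition (Finset.univ : Finset (Fin n)) :=
  Finpartition.ofSetoid (Setoid.ker (P.key D))

theorem mem_part_toPartition {x y : Fin n} :
    y ∈ (P.toPartition D).part x ↔ P.key D x = P.key D y :=
  Finpartition.mem_part_ofSetoid_iff_rel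

namespace IsDecoration

theorem eq_of_key_eq (hD : P.IsDecoration D) {x y : Fin n} (hx : x ∉ P.boxed) (hu : x ∉ D.under)
    (h : P.key D y = P.key D x) : y = x := by
  rw [key_of_notMem hx hu] at h
  have hnot : {x} ∉ D.hues := fun h0 => hx (hD.boxed_of_mem h0 (Finset.mem_singleton_self x))
  by_cases hy : y ∈ P.boxed
  · exact absurd (h ▸ (hD.key_of_boxed hy).1) hnot
  by_cases hyu : y ∈ D.under
  · have := hD.key_of_under hy hyu
    exact absurd (h ▸ this.1 ▸ this.2) hnot
  · rw [key_of_notMem hy hyu] at h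
    exact Finset.singleton_injective h

theorem color_eq_of_mem_key (hD : P.IsDecoration D) {x b : Fin n} (hb : b ∈ P.key D x) :
    P.color b = P.color x := by
  by_cases hx : x ∈ P.boxed
  · have := hD.key_of_boxed hx
    exact hD.hues_monochromatic _ this.1 b hb x this.2
  by_cases hu : x ∈ D.under
  · have := hD.key_of_under hx hu
    rw [this.1] at hb
    exact (hD.hueMatches_iff this.2 hb).1 (hD.under_unboxed x hx hu)
  · rw [key_of_notMem hx hu, Finset.mem_singleton] at hb
    rw [hb]

theorem key_nonempty (hD : P.IsDecoration D) (x : Fin n) : (P.key D x).Nonempty := by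
  by_cases hx : x ∈ P.boxed
  · exact ⟨x, (hD.key_of_boxed hx).2⟩
  by_cases hu : x ∈ D.under
  · have := hD.key_of_under hx hu
    rw [this.1]
    exact hD.hues_nonempty _ this.2
  · rw [key_of_notMem hx hu]
    exact Finset.singleton_nonempty x

theorem color_eq_of_key_eq (hD : P.IsDecoration D) {x y : Fin n} (h : P.key D x = P.key D y) :
    P.color x = P.color y := by
  obtain ⟨b, hb⟩ := hD.key_nonempty x
  rw [← hD.color_eq_of_mem_key hb, hD.color_eq_of_mem_key (h ▸ hb)]

/-- An underlined unboxed number shares its part with boxed numbers of its color, which are smaller;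
an unboxed number without underline is alone in its part. -/
theorem under_eq_nonMinima (hD : P.IsDecoration D) : D.under = (P.toPartition D).nonMinima := by
  ext x
  rw [Finpartition.mem_nonMinima]
  simp only [mem_part_toPartition]
  by_cases hx : x ∈ P.boxed
  · rw [hD.under_boxed x hx]
    constructor
    · rintro ⟨B, hB, hxB, j, hj, hjx⟩
      exact ⟨j, by rw [hD.key_of_mem hB hxB, hD.key_of_mem hB hj], hjx⟩
    · rintro ⟨y, hy, hyx⟩
      have h1 := hD.key_of_boxed hx
      have h2 := hD.key_of_boxed (boxed_of_lt hyx (hD.color_eq_of_key_eq hy).symm hx)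
      exact ⟨_, h1.1, h1.2, y, hy ▸ h2.2, hyx⟩
  · constructor
    · intro hu
      have h1 := hD.key_of_under hx hu
      obtain ⟨b, hb⟩ := hD.key_nonempty x
      refine ⟨b, ?_, ?_⟩
      · rw [hD.key_of_mem (h1.1 ▸ h1.2) hb]
      · exact lt_of_notMem_boxed (hD.color_eq_of_mem_key hb)
          (hD.boxed_of_mem (h1.1 ▸ h1.2) hb) hx
    · rintro ⟨y, hy, hyx⟩
      by_contra hu
      exact hyx.ne (hD.eq_of_key_eq hx hu hy.symm)

theorem key_of_mem_under (hD : P.IsDecoration D) {x : Fin n} (hu : x ∈ D.under) :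
    P.key D x = D.hue x ∧ D.hue x ∈ D.hues := by
  by_cases hx : x ∈ P.boxed
  · obtain ⟨B, hB, hxB, hj⟩ := (hD.under_boxed x hx).1 hu
    rw [hD.key_of_mem hB hxB, hD.hue_block B hB x hxB hj]
    exact ⟨rfl, hB⟩
  · exact hD.key_of_under hx hu

theorem mem_part_of_key_mem (hD : P.IsDecoration D) {x b : Fin n} (h : P.key D x ∈ D.hues) :
    b ∈ (P.toPartition D).part x ∩ P.boxed ↔ b ∈ P.key D x := by
  rw [Finset.mem_inter, mem_part_toPartition]
  constructor
  · rintro ⟨h1, h2⟩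
    rw [h1]
    exact (hD.key_of_boxed h2).2
  · exact fun hb => ⟨(hD.key_of_mem h hb).symm, hD.boxed_of_mem h hb⟩

theorem part_inter_boxed (hD : P.IsDecoration D) {x : Fin n} (h : P.key D x ∈ D.hues) :
    (P.toPartition D).part x ∩ P.boxed = P.key D x :=
  Finset.ext fun _ => hD.mem_part_of_key_mem h

theorem key_mem_or (hD : P.IsDecoration D) (x : Fin n) : P.key D x ∈ D.hues ∨
    (x ∉ P.boxed ∧ (P.toPartition D).part x = {x}) := by
  by_cases hx : x ∈ P.boxed
  · exact Or.inl (hD.key_of_boxed hx).1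
  by_cases hu : x ∈ D.under
  · have := hD.key_of_under hx hu
    exact Or.inl (this.1 ▸ this.2)
  · refine Or.inr ⟨hx, Finset.ext fun y => ?_⟩
    rw [mem_part_toPartition, Finset.mem_singleton]
    exact ⟨fun h => hD.eq_of_key_eq hx hu h.symm, fun h => by rw [h]⟩

/-- The numbers of a hue are the non-minima of its part and the free minima assigned to it. This
yields both admissibility and the fiber sizes of the assignment. -/
theorem card_hue_eq (hD : P.IsDecoration D) {x : Fin n} (h : P.key D x ∈ D.hues) :
    (Finset.univ.filter fun y => y ∈ P.freeMinima (P.toPartition D) ∧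
      D.hue y = P.key D x).card + (((P.toPartition D).part x).card - 1) =
      P.kSum ((P.toPartition D).part x) := by
  rw [← kSum_inter_boxed, hD.part_inter_boxed h, ← hD.hue_card _ h,
    ← Finpartition.card_filter_nonMinima (Finpartition.part_mem_parts x),
    ← Finset.card_union_of_disjoint]
  · congr 1
    ext y
    simp only [Finset.mem_union, Finset.mem_filter, Finset.mem_univ, true_and, mem_freeMinima,
      ← hD.under_eq_nonMinima]
    have hiff : (P.toPartition D).part y = (P.toPartition D).part x ↔ P.key D x = P.key D y := by
      rw [← Finpartition.mem_part_iff_eq, mem_part_toPartition]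
    rw [hiff]
    constructor
    · rintro (h1 | ⟨h1, h2⟩)
      · exact h1.2
      · rw [h2]
        exact (hD.key_of_mem_under h1).1.symm
    · intro h1
      have h2 : y ∉ P.crossed := hD.notMem_crossed (h1 ▸ h)
      by_cases hu : y ∈ D.under
      · exact Or.inr ⟨hu, by rw [(hD.key_of_mem_under hu).1, h1]⟩
      · exact Or.inl ⟨⟨h2, hu⟩, h1⟩
  · rw [Finset.disjoint_left]
    intro y h1 h2
    rw [Finset.mem_filter] at h1 h2
    exact (mem_freeMinima.1 h1.2.1).2 h2.1

theorem admissible_toPartition (hD : P.IsDecoration D) : P.Admissible (P.toPartition D) := by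
  constructor
  · intro A hA i hi j hj
    obtain ⟨x, rfl⟩ := Finpartition.exists_eq_part hA
    rw [mem_part_toPartition] at hi hj
    exact hD.color_eq_of_key_eq (hi.symm.trans hj)
  · intro A hA
    obtain ⟨x, rfl⟩ := Finpartition.exists_eq_part hA
    rcases hD.key_mem_or x with h | h
    · have := hD.card_hue_eq h
      omega
    · rw [h.2, Finset.card_singleton]
      omega

theorem exists_toMarking_eq (hD : P.IsDecoration D) :
    ∃ f ∈ P.partAssignments (P.toPartition D), P.toMarking (P.toPartition D) f = D := by
  have hhue : ∀ x ∈ P.freeMinima (P.toPartition D), D.hue x ∈ D.hues := fun x hx =>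
    hD.hue_mem x (mem_freeMinima.1 hx).1
  have hpart : ∀ x, D.hue x ∈ D.hues → ∃ b, P.key D b = D.hue x := by
    intro x hx
    obtain ⟨b, hb⟩ := hD.hues_nonempty _ hx
    exact ⟨b, hD.key_of_mem hx hb⟩
  have hset : ∀ x b, P.key D b = D.hue x →
      (Finset.univ.filter fun y => P.key D y = D.hue x) = (P.toPartition D).part b := by
    intro x b hb
    ext y
    rw [mem_part_toPartition, hb, Finset.mem_filter, eq_comm]
    simp
  -- The numbers whose key is the hue of `x` form the part whose boxed elements make up this hue.
  refine ⟨fun x => if x ∈ P.freeMinima (P.toPartition D) then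
    Finset.univ.filter fun y => P.key D y = D.hue x else ∅, ?_, ?_⟩
  · rw [partAssignments, mem_assignments]
    refine ⟨fun x hx => ?_, fun x hx => if_neg hx, fun A hA => ?_⟩
    · rw [if_pos hx]
      obtain ⟨b, hb⟩ := hpart x (hhue x hx)
      rw [hset x b hb]
      exact Finpartition.part_mem_parts b
    · obtain ⟨z, rfl⟩ := Finpartition.exists_eq_part hA
      have hiff : ∀ x, (if x ∈ P.freeMinima (P.toPartition D) then
          Finset.univ.filter fun y => P.key D y = D.hue x else ∅) = (P.toPartition D).part z ↔
          x ∈ P.freeMinima (P.toPartition D) ∧ D.hue x = P.key D z := by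
        intro x
        split_ifs with hx
        · obtain ⟨b, hb⟩ := hpart x (hhue x hx)
          rw [hset x b hb, ← Finpartition.mem_part_iff_eq, mem_part_toPartition, hb]
          simp [hx, eq_comm]
        · simp only [hx, false_and, iff_false]
          exact fun h => ((P.toPartition D).nonempty_of_mem_parts hA).ne_empty h.symm
      simp only [hiff]
      rcases hD.key_mem_or z with h | h
      · have h1 := hD.card_hue_eq h
        have h2 : 0 < ((P.toPartition D).part z).card :=
          Finset.card_pos.2 ⟨z, Finpartition.self_mem_part z⟩
        omega
      -- An unboxed singleton part has quota $0+1-1=0$, and indeed every hue consists of boxed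
      -- numbers.
      · have h1 : P.k z = 0 := by
          by_contra h0
          exact h.1 (mem_boxed.2 (Nat.pos_of_ne_zero h0))
        rw [h.2, kSum, Finset.sum_singleton, h1, Finset.card_singleton, Finset.card_eq_zero,
          Finset.filter_eq_empty_iff]
        rintro x _ ⟨hx, hxz⟩
        obtain ⟨b, hb⟩ := hD.hues_nonempty _ (hhue x hx)
        have hbz : b ∈ (P.toPartition D).part z := by
          rw [mem_part_toPartition, hD.key_of_mem (hhue x hx) hb, hxz]
        rw [h.2, Finset.mem_singleton] at hbz
        exact h.1 (hbz ▸ hD.boxed_of_mem (hhue x hx) hb)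
  · refine Marking.ext_fields ?_ ?_ hD.under_eq_nonMinima.symm
    · ext H
      rw [mem_hues_toMarking]
      constructor
      · rintro ⟨⟨b, hb⟩, A, hA, rfl⟩
        obtain ⟨x, rfl⟩ := Finpartition.exists_eq_part hA
        rcases hD.key_mem_or x with h | h
        · rwa [hD.part_inter_boxed h]
        · rw [h.2, Finset.mem_inter, Finset.mem_singleton] at hb
          exact absurd (hb.1 ▸ hb.2) h.1
      · intro hH
        obtain ⟨b, hb⟩ := hD.hues_nonempty H hH
        have hk := hD.key_of_mem hH hb
        refine ⟨⟨b, hb⟩, _, Finpartition.part_mem_parts b, ?_⟩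
        rw [hD.part_inter_boxed (hk.symm ▸ hH), hk]
    · funext x
      simp only [toMarking]
      split_ifs with h1 h2
      · obtain ⟨b, hb⟩ := hpart x (hhue x h1)
        rw [hset x b hb, hD.part_inter_boxed (hb.symm ▸ hhue x h1), hb]
      · exact (hD.hue_crossed x h2).symm
      · have hu : x ∈ D.under := by
          rw [hD.under_eq_nonMinima]
          rw [mem_freeMinima] at h1
          tauto
        have := hD.key_of_mem_under hu
        rw [hD.part_inter_boxed (this.1.symm ▸ this.2), this.1]

end IsDecoration

/-- Partitions that are not admissible contribute zero. For the others the multinomial coefficient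
is the number of assignments, and the exponent of the sign is the number of underlines. -/
theorem alternatingSum_eq (P : ColoredExponents n m) :
    P.alternatingSum = ∑ D ∈ P.decorations, D.sign := by
  classical
  have h1 : P.alternatingSum = ∑ Q ∈ Finset.univ.filter P.Admissible,
      ∑ f ∈ P.partAssignments Q, (P.toMarking Q f).sign := by
    rw [alternatingSum]
    have hsub : Finset.univ.filter P.Admissible ⊆
        (Finset.univ.filter fun Q : Finpartition (Finset.univ : Finset (Fin n)) =>
          ∀ B ∈ Q.parts, P.Monochromatic B) := by
      intro Q hQ
      rw [Finset.mem_filter] at hQ ⊢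
      exact ⟨hQ.1, hQ.2.1⟩
    rw [← Finset.sum_subset hsub]
    · refine Finset.sum_congr rfl fun Q hQ => ?_
      rw [Finset.mem_filter] at hQ
      rw [← card_partAssignments hQ.2, ← Finpartition.card_nonMinima]
      simp only [Marking.sign, toMarking]
      rw [Finset.sum_const, nsmul_eq_mul, mul_comm]
    · intro Q hQ hQ'
      rw [Finset.mem_filter] at hQ hQ'
      rw [multinomialTerm, if_neg fun h => hQ' ⟨hQ.1, hQ.2, h⟩, Nat.cast_zero, mul_zero]
  rw [h1, Finset.sum_sigma']
  refine Finset.sum_bij (fun x _ => P.toMarking x.1 x.2) ?_ ?_ ?_ fun _ _ => rfl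
  · rintro ⟨Q, f⟩ hx
    simp only [Finset.mem_sigma, Finset.mem_filter, Finset.mem_univ, true_and] at hx
    exact mem_decorations.2 (isDecoration_toMarking hx.1 hx.2)
  · rintro ⟨Q, f⟩ hx ⟨Q', f'⟩ hx' h
    simp only [Finset.mem_sigma, Finset.mem_filter, Finset.mem_univ, true_and] at hx hx'
    obtain ⟨rfl, rfl⟩ := toMarking_injective hx.1 hx.2 hx'.1 hx'.2 h
    rfl
  · intro D hD
    rw [mem_decorations] at hD
    obtain ⟨f, hf, h⟩ := hD.exists_toMarking_eq
    refine ⟨⟨P.toPartition D, f⟩, ?_, h⟩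
    simp only [Finset.mem_sigma, Finset.mem_filter, Finset.mem_univ, true_and]
    exact ⟨hD.admissible_toPartition, hf⟩

end ColoredExponents

theorem mainTheorem6 {n m : ℕ} (P : ColoredExponents n m) :
    -- the alternating sum is the signed count of all decorations
    P.alternatingSum = ∑ D ∈ P.decorations, D.sign ∧
    -- the first involution, its fixed points, and the reduced sum
    IsSignReversingInvolution P.decorations Marking.sign P.phiUnder ∧
    (∀ D ∈ P.decorations, P.phiUnder D = D ↔ D ∈ P.mismatchedDecorations) ∧
    P.alternatingSum = ∑ D ∈ P.mismatchedDecorations, D.sign ∧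
    -- a hue has permission to merge with at most one hue
    (∀ D ∈ P.mismatchedDecorations, ∀ t B B',
      P.HasPermission D t B → P.HasPermission D t B' → B = B') ∧
    -- the second involution
    IsSignReversingInvolution P.mismatchedDecorations Marking.sign P.phiHue ∧
    -- its fixed points are the fixed point decorations, without underlines and of positive sign
    (∀ D ∈ P.mismatchedDecorations, P.phiHue D = D ↔ P.IsFixedPoint D) ∧
    (∀ D ∈ P.mismatchedDecorations, P.phiHue D = D → D.under = ∅ ∧ D.sign = 1) ∧
    -- the resulting positive formula
    P.alternatingSum = (P.fixedPointDecorations.card : ℤ) := by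
  open ColoredExponents in
  exact ⟨P.alternatingSum_eq, isSignReversingInvolution_phiUnder,
    fun D hD => by
      rw [phiUnder_eq_iff, mem_mismatchedDecorations, and_iff_right (mem_decorations.1 hD)],
    P.alternatingSum_eq.trans sum_decorations_eq,
    fun D hD _ _ _ h h' => (mem_mismatchedDecorations.1 hD).1.hasPermission_unique h h',
    isSignReversingInvolution_phiHue, fun D hD => phiHue_eq_self_iff hD,
    fun D hD h =>
      ⟨((phiHue_eq_self_iff hD).1 h).under_eq_empty, ((phiHue_eq_self_iff hD).1 h).sign_eq_one⟩,
    (P.alternatingSum_eq.trans sum_decorations_eq).trans sum_mismatchedDecorations_eq⟩
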